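/- Let $\mathfrak g$ be the complex Kac--Moody algebra of a generalized Cartan matrix, with Cartan subalgebra $\mathfrak h$, simple roots $\alpha_1,\dots,\alpha_l$, simple coroots $\alpha_1^\vee,\dots,\alpha_l^\vee$, Chevalley generators $e_i,f_i$, and triangular decomposition $\mathfrak g=N^-\oplus\mathfrak h\oplus N^+$. Put $\mathfrak g'=[\mathfrak g,\mathfrak g]$, $\mathfrak h'=\mathfrak g'\cap\mathfrak h$, and fix a subspace $\mathfrak h''$ with $\mathfrak h=\mathfrak h'\oplus\mathfrak h''$. Let $A$ be a finitely generated commutative associative unital $\mathbb C$-algebra. Let $\tilde{\mathfrak g}=\mathfrak g'\otimes A\oplus\mathfrak h''$ be the Lie algebra with $[X\otimes a,Y\otimes b]=[X,Y]\otimes ab$, $[h,X\otimes a]=[h,X]\otimes a$, $[h,h_1]=0$ for $X,Y\in\mathfrak g'$, $h,h_1\in\mathfrak h''$, $a,b\in A$, and put $\tilde{\mathfrak h}=\mathfrak h'\otimes A\oplus\mathfrak h''$. Regard $\mathfrak h=\mathfrak h'\otimes 1\oplus\mathfrak h''$ as a subspace of $\tilde{\mathfrak h}$, and $\mathfrak g=\mathfrak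 g'\otimes 1+\mathfrak h''$ as a subalgebra of $\tilde{\mathfrak g}$. For a linear map $\psi:\tilde{\mathfrak h}\to\mathbb C$ let $M(\psi)=U(\tilde{\mathfrak g})v$ be the Verma module, induced from the one-dimensional representation of $N^+\otimes A\oplus\tilde{\mathfrak h}$ on which $N^+\otimes A$ acts by $0$ and $\tilde{\mathfrak h}$ by $\psi$. Let $I$ be a cofinite ideal of $A$, and suppose that $\psi|_{\mathfrak h'\otimes I}=0$ and that $\lambda=\psi|_{\mathfrak h}$ is dominant integral, i.e. $\lambda(\alpha_i^\vee)\in\mathbb Z_{\ge 0}$ for all $i$. Let $M(\psi,I)$ be the quotient of $M(\psi)$ by the submodule generated by all $(X\otimes a)v$, where $X\in\mathfrak g_{-\beta}$, $\beta=\sum_i m_i\alpha_i$ is a positive root, and $a\in I^{N_{\lambda,\beta}}$ with $N_{\lambda,\beta}=\sum_i m_i\lambda(\alpha_i^\vee)$ (and $I^0=A$). A $\tilde{\mathfrak g}$-module is called integrable if it is $\mathfrak h$-diagonalisable and all $e_i$ and $f_i$ act locally nilpotently. The Weyl module $W(\psi,I)$ is the maximal integrable quotient of $M(\psi,I)$,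 of which every integrable quotient of $M(\psi,I)$ is a quotient. **Corollary.** Let $I=\bigcap_{i=1}^k\mathfrak m_i$, where $\mathfrak m_1,\dots,\mathfrak m_k$ are distinct maximal ideals of $A$. For each $i$ let $\psi_i:\tilde{\mathfrak h}\to\mathbb C$ be a linear map such that $\psi_i|_{\mathfrak h'\otimes\mathfrak m_i}=0$ and $\psi_i|_{\mathfrak h}=\lambda_i$ is dominant integral. Put $\psi=\sum_{i=1}^k\psi_i$. Then, as $\tilde{\mathfrak g}$-modules, $$W(\psi,I)\;\cong\;\bigotimes_{i=1}^k W(\psi_i,\mathfrak m_i).$$ -/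

import Mathlib

open scoped TensorProduct

noncomputable section

/-! ## Tensor products of finite families of Lie modules -/

namespace PiTensorLie

variable {κ : Type*} [Fintype κ] [DecidableEq κ] {R L : Type*} [CommRing R] [LieRing L]
  [LieAlgebra R L] (V : κ → Type*) [∀ i, AddCommGroup (V i)] [∀ i, Module R (V i)]
  [∀ i, LieRingModule L (V i)] [∀ i, LieModule R L (V i)]

/-- The operator `1 ⊗ ⋯ ⊗ x ⊗ ⋯ ⊗ 1` with `x` acting on the `i`-th tensor factor. -/
def actAt (i : κ) (x : L) : Module.End R (⨂[R] j, V j) :=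
  PiTensorProduct.map
    (Function.update (fun j => (LinearMap.id : V j →ₗ[R] V j)) i (LieModule.toEnd R L (V i) x))

/-- The action of `x` on `⨂ᵢ Vᵢ`, that is `∑ᵢ 1 ⊗ ⋯ ⊗ x ⊗ ⋯ ⊗ 1`. -/
def act (x : L) : Module.End R (⨂[R] j, V j) := ∑ i, actAt V i x

variable {V}

set_option linter.unusedSectionVars false in
theorem actAt_tprod (i : κ) (x : L) (v : ∀ j, V j) :
    actAt (R := R) V i x (PiTensorProduct.tprod R v)
      = PiTensorProduct.tprod R (Function.update v i ⁅x, v i⁆) := by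
  rw [actAt, PiTensorProduct.map_tprod]
  congr 1
  funext j
  by_cases h : j = i
  · subst h; simp
  · simp [h]

theorem act_tprod (x : L) (v : ∀ j, V j) :
    act (R := R) V x (PiTensorProduct.tprod R v)
      = ∑ i, PiTensorProduct.tprod R (Function.update v i ⁅x, v i⁆) := by
  simp [act, actAt_tprod]

theorem act_add (x y : L) : act (R := R) V (x + y) = act V x + act V y := by
  ext v
  simp [act_tprod, Finset.sum_add_distrib]

theorem act_smul (c : R) (x : L) : act (R := R) V (c • x) = c • act V x := by
  ext v
  simp [act_tprod, Finset.smul_sum]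

theorem act_lie (x y : L) :
    act (R := R) V ⁅x, y⁆ = act V x * act V y - act V y * act V x := by
  have key : ∀ i j (v : ∀ j, V j), i ≠ j →
      actAt (R := R) V i x (actAt V j y (PiTensorProduct.tprod R v))
        = actAt V j y (actAt V i x (PiTensorProduct.tprod R v)) := by
    intro i j v hij
    rw [actAt_tprod, actAt_tprod, actAt_tprod, actAt_tprod, Function.update_of_ne hij,
      Function.update_of_ne hij.symm, Function.update_comm hij.symm]
  ext v
  simp only [act, LinearMap.compMultilinearMap_apply, LinearMap.sum_apply, LinearMap.sub_apply,
    Module.End.mul_apply, map_sum]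
  rw [Finset.sum_comm (f := fun i j => actAt V j y (actAt V i x (PiTensorProduct.tprod R v))),
    ← Finset.sum_sub_distrib]
  refine Finset.sum_congr rfl fun i _ => ?_
  rw [← Finset.sum_sub_distrib, Finset.sum_eq_single i]
  · simp [actAt_tprod]
  · intro j _ hj
    exact sub_eq_zero.mpr (key _ _ v hj)
  · simp

instance : LieRingModule L (⨂[R] j, V j) where
  bracket x t := act V x t
  add_lie x y t := by simp [act_add]
  lie_add x t u := map_add _ _ _
  leibniz_lie x y t := by simp [act_lie]

instance : LieModule R L (⨂[R] j, V j) where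
  smul_lie c x t := by
    change act V (c • x) t = c • act V x t
    simp [act_smul]
  lie_smul c x t := map_smul (act V x) c t

/-- The defining formula `x (⊗ vⱼ) = ∑ᵢ v₁ ⊗ ⋯ ⊗ x vᵢ ⊗ ⋯ ⊗ vₖ`. -/
theorem lie_tprod (x : L) (v : ∀ j, V j) :
    ⁅x, PiTensorProduct.tprod R v⁆
      = ∑ i, PiTensorProduct.tprod R (Function.update v i ⁅x, v i⁆) :=
  act_tprod x v

end PiTensorLie

/-! ## Kac--Moody algebras -/

namespace KacMoody

/-- Generalized Cartan matrices. -/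
structure IsGCM {ι : Type*} (C : Matrix ι ι ℤ) : Prop where
  diag : ∀ i, C i i = 2
  nonpos : ∀ i j, i ≠ j → C i j ≤ 0
  symm_zero : ∀ i j, C i j = 0 → C j i = 0

/-- A (minimal) realization `(H, Π, Π^∨)` of a generalized Cartan matrix `C` of size `l`:
linearly independent simple roots in `H*` and simple coroots in `H`, with `α_j(α_i^∨) = C_{ij}` and
`dim H = 2 l - rank C`. -/
structure Realization {ι : Type*} [Fintype ι] (C : Matrix ι ι ℤ)
    (H : Type*) [AddCommGroup H] [Module ℂ H] where
  gcm : IsGCM C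
  root : ι → Module.Dual ℂ H
  coroot : ι → H
  root_indep : LinearIndependent ℂ root
  coroot_indep : LinearIndependent ℂ coroot
  pairing : ∀ i j, root j (coroot i) = (C i j : ℂ)
  finite : Module.Finite ℂ H
  finrank_add_rank :
    Module.finrank ℂ H + (C.map (Int.cast : ℤ → ℂ)).rank = 2 * Fintype.card ι

/-- Generators `e_i`, `f_i` (`i ∈ ι`) and `h` (`h ∈ H`). -/
inductive Gen (ι H : Type*)
  | e (i : ι) : Gen ι H
  | f (i : ι) : Gen ι H
  | h (x : H) : Gen ι H

section

variable {ι : Type*} [Fintype ι] {C : Matrix ι ι ℤ} {H : Type*} [AddCommGroup H] [Module ℂ H]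
  (R : Realization C H)

/-- A generator, as an element of the free Lie algebra. -/
abbrev gen (g : Gen ι H) : FreeLieAlgebra ℂ (Gen ι H) := FreeLieAlgebra.of ℂ g

/-- The relators of the auxiliary algebra: `h ↦ h` is linear, `[h, h'] = 0`,
`[h, e_i] = α_i(h) e_i`, `[h, f_i] = - α_i(h) f_i` and `[e_i, f_j] = δ_{ij} α_i^∨`. -/
inductive IsRelator : FreeLieAlgebra ℂ (Gen ι H) → Prop
  | add (x y : H) : IsRelator (gen (.h (x + y)) - (gen (.h x) + gen (.h y)))
  | smul (c : ℂ) (x : H) : IsRelator (gen (.h (c • x)) - c • gen (.h x))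
  | hh (x y : H) : IsRelator ⁅gen (ι := ι) (.h x), gen (.h y)⁆
  | he (x : H) (i : ι) : IsRelator (⁅gen (ι := ι) (.h x), gen (.e i)⁆ - R.root i x • gen (.e i))
  | hf (x : H) (i : ι) : IsRelator (⁅gen (ι := ι) (.h x), gen (.f i)⁆ + R.root i x • gen (.f i))
  | ef (i : ι) : IsRelator (⁅gen (H := H) (.e i), gen (.f i)⁆ - gen (.h (R.coroot i)))
  | ef_ne (i j : ι) (hij : i ≠ j) : IsRelator ⁅gen (H := H) (.e i), gen (.f j)⁆

/-- The ideal generated by the relators. -/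
def relIdeal : LieIdeal ℂ (FreeLieAlgebra ℂ (Gen ι H)) :=
  LieSubmodule.lieSpan ℂ (FreeLieAlgebra ℂ (Gen ι H)) {x | IsRelator R x}

/-- The auxiliary Lie algebra (before dividing out the radical). -/
def AuxAlg : Type _ := FreeLieAlgebra ℂ (Gen ι H) ⧸ relIdeal R

instance : LieRing (AuxAlg R) :=
  inferInstanceAs (LieRing (FreeLieAlgebra ℂ (Gen ι H) ⧸ relIdeal R))
instance : LieAlgebra ℂ (AuxAlg R) :=
  inferInstanceAs (LieAlgebra ℂ (FreeLieAlgebra ℂ (Gen ι H) ⧸ relIdeal R))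

/-- The class of a generator in the auxiliary algebra. -/
def auxGen (g : Gen ι H) : AuxAlg R :=
  LieSubmodule.Quotient.mk (N := relIdeal R) (FreeLieAlgebra.of ℂ g)

variable {R} in
theorem mk_relator {x : FreeLieAlgebra ℂ (Gen ι H)} (hx : IsRelator R x) :
    (LieSubmodule.Quotient.mk (N := relIdeal R) x) = 0 :=
  LieSubmodule.Quotient.mk_eq_zero'.mpr (LieSubmodule.subset_lieSpan hx)

/-- The canonical linear map `H → AuxAlg R`. -/
def auxCartan : H →ₗ[ℂ] AuxAlg R where
  toFun x := auxGen R (Gen.h x)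
  map_add' x y := sub_eq_zero.mp (mk_relator (IsRelator.add x y))
  map_smul' c x := sub_eq_zero.mp (mk_relator (IsRelator.smul c x))

/-- The largest ideal of the auxiliary algebra that meets the Cartan subalgebra trivially,
as the sum of all such ideals. -/
def radical : LieIdeal ℂ (AuxAlg R) :=
  sSup {J : LieIdeal ℂ (AuxAlg R) |
    Disjoint (J : Submodule ℂ (AuxAlg R)) (LinearMap.range (auxCartan R))}

/-- The Kac--Moody algebra `𝔤` attached to the realization `R`. -/
def Alg : Type _ := AuxAlg R ⧸ radical R

instance : LieRing (Alg R) := inferInstanceAs (LieRing (AuxAlg R ⧸ radical R))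
instance : LieAlgebra ℂ (Alg R) := inferInstanceAs (LieAlgebra ℂ (AuxAlg R ⧸ radical R))

/-- The projection from the auxiliary algebra onto `𝔤`. -/
def toAlg : AuxAlg R →ₗ⁅ℂ⁆ Alg R where
  toFun x := LieSubmodule.Quotient.mk (N := radical R) x
  map_add' _ _ := rfl
  map_smul' _ _ := rfl
  map_lie' := fun {x y} => LieSubmodule.Quotient.mk_bracket (I := radical R) x y

/-- The Chevalley generator `e_i` of `𝔤`. -/
def e (i : ι) : Alg R := toAlg R (auxGen R (Gen.e i))
/-- The Chevalley generator `f_i` of `𝔤`. -/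
def f (i : ι) : Alg R := toAlg R (auxGen R (Gen.f i))
/-- The canonical map `H → 𝔤`. -/
def cartanMap : H →ₗ[ℂ] Alg R := (toAlg R : AuxAlg R →ₗ[ℂ] Alg R) ∘ₗ auxCartan R

theorem cartanMap_lie (x y : H) : ⁅cartanMap R x, cartanMap R y⁆ = 0 := by
  have h : ⁅auxCartan R x, auxCartan R y⁆ = 0 := mk_relator (IsRelator.hh x y)
  simp [cartanMap, ← LieHom.map_lie, h]

theorem cartanMap_e (x : H) (i : ι) : ⁅cartanMap R x, e R i⁆ = R.root i x • e R i := by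
  have h : ⁅auxCartan R x, auxGen R (Gen.e i)⁆ = R.root i x • auxGen R (Gen.e i) :=
    sub_eq_zero.mp (mk_relator (IsRelator.he x i))
  simp [cartanMap, e, ← LieHom.map_lie, h]

theorem cartanMap_f (x : H) (i : ι) : ⁅cartanMap R x, f R i⁆ = -(R.root i x • f R i) := by
  have h : ⁅auxCartan R x, auxGen R (Gen.f i)⁆ = -(R.root i x • auxGen R (Gen.f i)) :=
    add_eq_zero_iff_eq_neg.mp (mk_relator (IsRelator.hf x i))
  simp [cartanMap, f, ← LieHom.map_lie, h]

theorem e_f (i : ι) : ⁅e R i, f R i⁆ = cartanMap R (R.coroot i) := by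
  have h : ⁅auxGen R (Gen.e i), auxGen R (Gen.f i)⁆ = auxCartan R (R.coroot i) :=
    sub_eq_zero.mp (mk_relator (IsRelator.ef i))
  simp [cartanMap, e, f, ← LieHom.map_lie, h]

/-- The Cartan subalgebra `𝔥` of `𝔤`. -/
def cartan : LieSubalgebra ℂ (Alg R) where
  __ := LinearMap.range (cartanMap R)
  lie_mem' := by
    rintro _ _ ⟨x, rfl⟩ ⟨y, rfl⟩
    simp [cartanMap_lie]

/-- The derived algebra `𝔤' = [𝔤, 𝔤]`. -/
def derived : LieIdeal ℂ (Alg R) := ⁅(⊤ : LieIdeal ℂ (Alg R)), (⊤ : LieIdeal ℂ (Alg R))⁆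

/-- `𝔥' = 𝔤' ∩ 𝔥`, as a subalgebra of `𝔥`. -/
def cartan' : LieSubalgebra ℂ (cartan R) :=
  (LieIdeal.toLieSubalgebra ℂ (Alg R) (derived R)).comap (cartan R).incl

theorem lie_mem_derived (x y : Alg R) : ⁅x, y⁆ ∈ derived R :=
  LieSubmodule.lie_mem_lie (LieSubmodule.mem_top x) (LieSubmodule.mem_top y)

theorem e_mem_derived (i : ι) : e R i ∈ derived R := by
  have h := (derived R).smul_mem (2⁻¹ : ℂ) (lie_mem_derived R (cartanMap R (R.coroot i)) (e R i))
  simpa [cartanMap_e, R.pairing, R.gcm.diag] using h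

theorem f_mem_derived (i : ι) : f R i ∈ derived R := by
  have h := (derived R).smul_mem (-2⁻¹ : ℂ) (lie_mem_derived R (cartanMap R (R.coroot i)) (f R i))
  simpa [cartanMap_f, R.pairing, R.gcm.diag] using h

/-- `e_i` as an element of `𝔤'`. -/
def e' (i : ι) : derived R := ⟨e R i, e_mem_derived R i⟩
/-- `f_i` as an element of `𝔤'`. -/
def f' (i : ι) : derived R := ⟨f R i, f_mem_derived R i⟩

/-- The simple coroot `α_i^∨` as an element of `𝔥`. -/
def corootH (i : ι) : cartan R := ⟨cartanMap R (R.coroot i), R.coroot i, rfl⟩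

/-- The simple coroot `α_i^∨` as an element of `𝔥'`. -/
def coroot' (i : ι) : cartan' R :=
  ⟨corootH R i, by
    change cartanMap R (R.coroot i) ∈ derived R
    rw [← e_f]; exact lie_mem_derived R _ _⟩

/-- The inclusion `𝔥' → 𝔤'`. -/
def cartan'Incl : cartan' R →ₗ[ℂ] derived R where
  toFun x := ⟨(x : cartan R), x.2⟩
  map_add' _ _ := rfl
  map_smul' _ _ := rfl

/-- The space `𝔤_α` for `α = ∑ m_i α_i`; for `m ≠ 0` it is nonzero exactly when `α` is a root. -/
def rootSpace (m : ι → ℤ) : Submodule ℂ (Alg R) where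
  carrier := {x | ∀ y : H, ⁅cartanMap R y, x⁆ = (∑ i, (m i : ℂ) * R.root i y) • x}
  add_mem' hx hy z := by rw [lie_add, hx z, hy z, smul_add]
  zero_mem' z := by simp
  smul_mem' c x hx z := by rw [lie_smul, hx z, smul_comm]

/-- Dominant integral weights of `𝔤`. -/
def IsDominantIntegral (lam : Module.Dual ℂ (cartan R)) : Prop :=
  ∀ i, ∃ n : ℕ, lam (corootH R i) = n

/-! ## The Lie algebra `𝔤' ⊗ A ⊕ 𝔥''` -/

variable (A : Type*) [CommRing A] [Algebra ℂ A]

/-- The action of `𝔤` on its ideal `𝔤'` by derivations. -/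
def adDerived : Alg R →ₗ⁅ℂ⁆ LieDerivation ℂ (derived R) (derived R) where
  toFun x :=
    { toLinearMap := LieModule.toEnd ℂ (Alg R) (derived R) x
      leibniz' := by
        intro a b
        apply Subtype.ext
        change ⁅x, ⁅(a : Alg R), (b : Alg R)⁆⁆
          = ⁅(a : Alg R), ⁅x, (b : Alg R)⁆⁆ - ⁅(b : Alg R), ⁅x, (a : Alg R)⁆⁆
        rw [leibniz_lie x, ← lie_skew (b : Alg R) ⁅x, (a : Alg R)⁆]
        abel }
  map_add' x y := by ext a; simp
  map_smul' c x := by ext a; simp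
  map_lie' := by intro x y; ext a; simp

variable (D : LieSubalgebra ℂ (cartan R))

/-- The action of a subalgebra `𝔥''` of `𝔥` on `𝔤' ⊗ A`: `h (a ⊗ X) = a ⊗ [h, X]`. -/
def curAct : D →ₗ⁅ℂ⁆ LieDerivation ℂ (A ⊗[ℂ] derived R) (A ⊗[ℂ] derived R) :=
  (Lie.Derivation.ofLieDerivation A).comp
    ((adDerived R).comp ((cartan R).incl.comp D.incl))

/-- The Lie algebra `𝔤̃ = 𝔤' ⊗ A ⊕ 𝔥''` (the algebra `A` is written on the left), with
`[X ⊗ a, Y ⊗ b] = [X, Y] ⊗ ab`, `[h, X ⊗ a] = [h, X] ⊗ a` and `[h, h'] = 0`. -/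
abbrev Cur : Type _ := LieAlgebra.SemiDirectSum (A ⊗[ℂ] derived R) D (curAct R A D)

/-- `𝔥̃ = 𝔥' ⊗ A ⊕ 𝔥''`. -/
abbrev CurCartan : Type _ := (A ⊗[ℂ] cartan' R) × D

variable {A}

/-- The element `X ⊗ a` of `𝔤̃`. -/
def elt (a : A) (x : derived R) : Cur R A D :=
  LieAlgebra.SemiDirectSum.inl (curAct R A D) (a ⊗ₜ[ℂ] x)

variable (A)

/-- The inclusion of `𝔥̃` into `𝔤̃`. -/
def curCartanIncl : CurCartan R A D →ₗ[ℂ] Cur R A D :=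
  LinearMap.coprod
    ((LieAlgebra.SemiDirectSum.inl (curAct R A D) : A ⊗[ℂ] derived R →ₗ[ℂ] Cur R A D) ∘ₗ
      (cartan'Incl R).lTensor A)
    (LieAlgebra.SemiDirectSum.inr (curAct R A D) : D →ₗ[ℂ] Cur R A D)

variable {A D}

/-- `ψ` restricts to `lam` on `𝔥 = 𝔥' ⊕ 𝔥''`. -/
def RestrictsTo (ψ : Module.Dual ℂ (CurCartan R A D)) (lam : Module.Dual ℂ (cartan R)) : Prop :=
  (∀ x : cartan' R, ψ ((1 : A) ⊗ₜ[ℂ] x, 0) = lam x) ∧ ∀ x : D, ψ (0, x) = lam x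

/-- `ψ` vanishes on `𝔥' ⊗ I`. -/
def VanishesOn (ψ : Module.Dual ℂ (CurCartan R A D)) (I : Ideal A) : Prop :=
  ∀ a ∈ I, ∀ x : cartan' R, ψ (a ⊗ₜ[ℂ] x, 0) = 0

variable (A D)

/-! ## Highest weight modules -/

/-- The enveloping algebra of `𝔤̃`. -/
abbrev Env : Type _ := UniversalEnvelopingAlgebra ℂ (Cur R A D)

/-- `U(𝔤̃)` as a `𝔤̃`-module by left multiplication. -/
instance : LieRingModule (Cur R A D) (Env R A D) where
  bracket x u := UniversalEnvelopingAlgebra.ι ℂ x * u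
  add_lie x y u := by rw [map_add, add_mul]
  lie_add x u w := mul_add _ _ _
  leibniz_lie x y u := by
    simp only [LieHom.map_lie, LieRing.of_associative_ring_bracket, sub_mul, mul_assoc]
    abel

instance : LieModule ℂ (Cur R A D) (Env R A D) where
  smul_lie c x u := by
    change UniversalEnvelopingAlgebra.ι ℂ (c • x) * u = c • (UniversalEnvelopingAlgebra.ι ℂ x * u)
    rw [map_smul, smul_mul_assoc]
  lie_smul c x u := mul_smul_comm _ _ _

variable {A D}

/-- The left ideal of `U(𝔤̃)` generated by `N⁺ ⊗ A` and by `h - ψ(h)` for `h ∈ 𝔥̃`. -/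
def vermaIdeal (ψ : Module.Dual ℂ (CurCartan R A D)) : LieSubmodule ℂ (Cur R A D) (Env R A D) :=
  LieSubmodule.lieSpan ℂ (Cur R A D)
    ({u | ∃ (m : ι → ℕ) (x : derived R) (a : A), m ≠ 0 ∧
        (x : Alg R) ∈ rootSpace R (fun i => (m i : ℤ)) ∧
        u = UniversalEnvelopingAlgebra.ι ℂ (elt R D a x)} ∪
     {u | ∃ h : CurCartan R A D,
        u = UniversalEnvelopingAlgebra.ι ℂ (curCartanIncl R A D h)
          - algebraMap ℂ (Env R A D) (ψ h)})

/-- The Verma module `M(ψ) = U(𝔤̃) ⊗_{U(Ñ⁺ ⊕ 𝔥̃)} ℂ_ψ`, as the quotient of `U(𝔤̃)` by the left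
ideal of annihilators of its highest weight vector. -/
def Verma (ψ : Module.Dual ℂ (CurCartan R A D)) : Type _ := Env R A D ⧸ vermaIdeal R ψ

section
variable (ψ : Module.Dual ℂ (CurCartan R A D))
instance : AddCommGroup (Verma R ψ) := inferInstanceAs (AddCommGroup (_ ⧸ vermaIdeal R ψ))
instance : Module ℂ (Verma R ψ) := inferInstanceAs (Module ℂ (_ ⧸ vermaIdeal R ψ))
instance : LieRingModule (Cur R A D) (Verma R ψ) :=
  inferInstanceAs (LieRingModule (Cur R A D) (_ ⧸ vermaIdeal R ψ))
instance : LieModule ℂ (Cur R A D) (Verma R ψ) :=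
  inferInstanceAs (LieModule ℂ (Cur R A D) (_ ⧸ vermaIdeal R ψ))

/-- The highest weight vector of `M(ψ)`. -/
def vermaVec : Verma R ψ := LieSubmodule.Quotient.mk (N := vermaIdeal R ψ) 1

/-- The natural number `λ(α_i^∨)`, where `λ = ψ|_𝔥` is dominant integral. -/
def wt (i : ι) : ℕ := ⌊(ψ ((1 : A) ⊗ₜ[ℂ] coroot' R i, 0)).re⌋₊

/-- `N_{λ, β} = ∑ m_i λ(α_i^∨)` for `β = ∑ m_i α_i` and `λ = ψ|_𝔥`. -/
def expo (m : ι → ℕ) : ℕ := ∑ i, m i * wt R ψ i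

variable (I : Ideal A)

/-- The submodule of `M(ψ)` generated by all `(X ⊗ a) v`, where `X ∈ 𝔤_{-β}`, `β` is a positive
root, and `a ∈ I^{N_{λ, β}}`. -/
def hwIdeal : LieSubmodule ℂ (Cur R A D) (Verma R ψ) :=
  LieSubmodule.lieSpan ℂ (Cur R A D)
    {w | ∃ (m : ι → ℕ) (x : derived R) (a : A), m ≠ 0 ∧
        (x : Alg R) ∈ rootSpace R (fun i => -(m i : ℤ)) ∧ a ∈ I ^ expo R ψ m ∧
        w = ⁅elt R D a x, vermaVec R ψ⁆}

/-- The module `M(ψ, I)`. -/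
def HWModule : Type _ := Verma R ψ ⧸ hwIdeal R ψ I

instance : AddCommGroup (HWModule R ψ I) := inferInstanceAs (AddCommGroup (_ ⧸ hwIdeal R ψ I))
instance : Module ℂ (HWModule R ψ I) := inferInstanceAs (Module ℂ (_ ⧸ hwIdeal R ψ I))
instance : LieRingModule (Cur R A D) (HWModule R ψ I) :=
  inferInstanceAs (LieRingModule (Cur R A D) (_ ⧸ hwIdeal R ψ I))
instance : LieModule ℂ (Cur R A D) (HWModule R ψ I) :=
  inferInstanceAs (LieModule ℂ (Cur R A D) (_ ⧸ hwIdeal R ψ I))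

end

/-! ## Integrability and Weyl modules -/

section
variable (A D) (V : Type*) [AddCommGroup V] [Module ℂ V] [LieRingModule (Cur R A D) V]
  [LieModule ℂ (Cur R A D) V]

/-- The weight space of weight `μ` for `𝔥 = 𝔥' ⊗ 1 ⊕ 𝔥''`. -/
def weightSpace (μ : Module.Dual ℂ (cartan R)) : Submodule ℂ V where
  carrier := {v |
    (∀ x : cartan' R, ⁅curCartanIncl R A D ((1 : A) ⊗ₜ[ℂ] x, 0), v⁆ = μ x • v) ∧
    ∀ x : D, ⁅curCartanIncl R A D (0, x), v⁆ = μ x • v}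
  add_mem' hv hw := ⟨fun x => by rw [lie_add, hv.1 x, hw.1 x, smul_add],
    fun x => by rw [lie_add, hv.2 x, hw.2 x, smul_add]⟩
  zero_mem' := by simp
  smul_mem' c v hv := ⟨fun x => by rw [lie_smul, hv.1 x, smul_comm],
    fun x => by rw [lie_smul, hv.2 x, smul_comm]⟩

/-- A `𝔤̃`-module is integrable (over `𝔤`) if it is `𝔥`-diagonalisable and all Chevalley
generators `e_i`, `f_i` act locally nilpotently. -/
structure IsIntegrable : Prop where
  diagonalisable : ⨆ μ : Module.Dual ℂ (cartan R), weightSpace R A D V μ = ⊤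
  e_nilpotent : ∀ (i : ι) (v : V), ∃ n : ℕ,
    ((LieModule.toEnd ℂ (Cur R A D) V (elt R D 1 (e' R i))) ^ n) v = 0
  f_nilpotent : ∀ (i : ι) (v : V), ∃ n : ℕ,
    ((LieModule.toEnd ℂ (Cur R A D) V (elt R D 1 (f' R i))) ^ n) v = 0

end

variable (ψ : Module.Dual ℂ (CurCartan R A D)) (I : Ideal A)

/-- The intersection of the kernels of all integrable quotients of `M(ψ, I)`. -/
def weylIdeal : LieSubmodule ℂ (Cur R A D) (HWModule R ψ I) :=
  sInf {N : LieSubmodule ℂ (Cur R A D) (HWModule R ψ I) |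
    IsIntegrable R A D (HWModule R ψ I ⧸ N)}

/-- The Weyl module `W(ψ, I)`: the maximal integrable quotient of `M(ψ, I)`. -/
def Weyl : Type _ := HWModule R ψ I ⧸ weylIdeal R ψ I

instance : AddCommGroup (Weyl R ψ I) := inferInstanceAs (AddCommGroup (_ ⧸ weylIdeal R ψ I))
instance : Module ℂ (Weyl R ψ I) := inferInstanceAs (Module ℂ (_ ⧸ weylIdeal R ψ I))
instance : LieRingModule (Cur R A D) (Weyl R ψ I) :=
  inferInstanceAs (LieRingModule (Cur R A D) (_ ⧸ weylIdeal R ψ I))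
instance : LieModule ℂ (Cur R A D) (Weyl R ψ I) :=
  inferInstanceAs (LieModule ℂ (Cur R A D) (_ ⧸ weylIdeal R ψ I))

end

end KacMoody

end

/-!
Write `v_j` for the highest weight vector of `W(ψ_j, 𝔪_j)`, `v` for that of `W = W(∑ ψ_j, I)`, and
`N_{λ, β}` for the exponents in the definition of `M(ψ, I)`. The proof gives mutually inverse maps
between `W` and `⨂ W(ψ_j, 𝔪_j)`.

*The map `φ` from `W` to the tensor product.* Since `N_{λ, β}` is additive in `λ`, the vector
`⨂ v_j` satisfies the relations of `M(∑ ψ_j, I)` (`KacMoody.isHWVector_tprod`). The tensor product is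
integrable because its factors are. This uses that `W(ψ, I)`, defined as the quotient by an
intersection, is itself integrable (`KacMoody.weyl_f_nilpotent`): in an integrable highest weight
module the `α_i`-string of weights through a given weight has a length that is bounded
independently of the module (`KacMoody.gr_string_eq_bot`). So the universal property of `W`
(`KacMoody.exists_weyl_hom`) provides `φ` with `φ v = ⨂ v_j`.

*Idempotents.* On a module generated by a highest weight vector of `M(ψ, I)`, each vector is
killed by `X ⊗ Iᴺ` for large `N` (`KacMoody.IsHWVector.isLocallyAdic`). So for an element `ε` of
the `I`-adic completion of `A` there are operators `X ⊗ a ε`. By the Chinese remainder theorem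
(`KacMoody.exists_adicIdem`) the completion at `I = ⋂ 𝔪_j` contains orthogonal idempotents `ε_j`
with sum `1`. For each `j`, letting `X ⊗ a` act as `X ⊗ a ε_j`, and shifting the action of `𝔥''`
by a character, makes `W` into another `𝔤̃`-module, `KacMoody.SplitModule`. These actions of
`𝔤' ⊗ A` for different `j` commute, and their sum is the original action.

*The map back.* In the `j`-th modified module, `v` has weight `ψ_j`, and the `f_i` act locally
nilpotently, since they still lower weights along strings of bounded length. A highest weight
vector on which the `f_i` are nilpotent satisfies the relations of `M(ψ_j, 𝔪_j)` automatically
(`KacMoody.isHWVector_of_nilpotent`). This is an identity of Garland type: with `n = λ(α_i^∨)`,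
the operators `e_i ⊗ a_1, …, e_i ⊗ a_n` with coefficients in `𝔪_j` turn `(f_i ⊗ 1)ⁿ⁺¹ v`,
which is zero, into a nonzero multiple of `(f_i ⊗ a_1 ⋯ a_n) v`, and roots that are not simple follow by taking
brackets. Hence there is a map `θ_j` from `W(ψ_j, 𝔪_j)` to the modified module with `θ_j v_j = v`.
As the modified actions commute, the `θ_j` combine to a linear map `Θ` on the tensor product with
`Θ (⨂ v_j) = v` that commutes with all `f_i ⊗ a` (`KacMoody.exists_tensor_lift`).

Since `v` generates `W` under the `f_i ⊗ a` (`KacMoody.highestWeight_induction`), `Θ ∘ φ` is the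
identity. Finally `φ` is surjective: if `a` approximates `b ε_j`, then `f_i ⊗ a` acts on a given
pure tensor as `f_i ⊗ b` on the `j`-th factor and as `0` on the others
(`KacMoody.surjective_of_map_eq_tprod`).
-/

/-! ### Iterated brackets and root spaces of the Kac--Moody algebra -/

namespace KacMoody

section Words

open scoped Classical in
/-- `IsWord g m y` says that `y = [g_{i₁}, [g_{i₂}, …, g_{iᵣ}]]` is a right-normed iterated bracket
(with `r ≥ 1`) of the given elements, and that each index `i` occurs `m i` times in it. -/
inductive IsWord {ι L : Type*} [LieRing L] (g : ι → L) : (ι → ℕ) → L → Prop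
  | single (i : ι) : IsWord g (Pi.single i 1) (g i)
  | lie (i : ι) {m : ι → ℕ} {y : L} (hy : IsWord g m y) : IsWord g (m + Pi.single i 1) ⁅g i, y⁆

theorem IsWord.ne_zero {ι L : Type*} [LieRing L] {g : ι → L} {m : ι → ℕ} {y : L}
    (h : IsWord g m y) : m ≠ 0 := by
  classical
  cases h with
  | single i => intro h; simpa using congrFun h i
  | lie i hy => intro h; simpa using congrFun h i

variable {ι : Type*} [Fintype ι] {C : Matrix ι ι ℤ} {H : Type*} [AddCommGroup H] [Module ℂ H]
  (R : Realization C H)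

theorem e_f_ne {i j : ι} (hij : i ≠ j) : ⁅e R i, f R j⁆ = 0 := by
  have h : ⁅auxGen R (Gen.e i), auxGen R (Gen.f j)⁆ = 0 := mk_relator (IsRelator.ef_ne i j hij)
  simp [e, f, ← LieHom.map_lie, h]

theorem e_f_mem_range (i j : ι) : ⁅e R i, f R j⁆ ∈ LinearMap.range (cartanMap R) := by
  by_cases h : i = j
  · subst h
    exact ⟨_, (e_f R i).symm⟩
  · simp [e_f_ne R h]

/-- A Lie subalgebra of `𝔤` containing the generators is everything. -/
theorem eq_top_of_generators (K : LieSubalgebra ℂ (Alg R)) (he : ∀ i, e R i ∈ K)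
    (hf : ∀ i, f R i ∈ K) (hh : ∀ x, cartanMap R x ∈ K) : K = ⊤ := by
  let q : FreeLieAlgebra ℂ (Gen ι H) →ₗ⁅ℂ⁆ AuxAlg R :=
    { toFun := fun x => LieSubmodule.Quotient.mk (N := relIdeal R) x
      map_add' := fun _ _ => rfl
      map_smul' := fun _ _ => rfl
      map_lie' := fun {x y} => LieSubmodule.Quotient.mk_bracket (I := relIdeal R) x y }
  have hg : ∀ g : Gen ι H, toAlg R (auxGen R g) ∈ K := by
    rintro (i | i | x)
    exacts [he i, hf i, hh x]
  let φ : FreeLieAlgebra ℂ (Gen ι H) →ₗ⁅ℂ⁆ K :=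
    FreeLieAlgebra.lift ℂ fun g => ⟨toAlg R (auxGen R g), hg g⟩
  have hφ : K.incl.comp φ = (toAlg R).comp q := by
    apply FreeLieAlgebra.hom_ext
    intro g
    simp only [LieHom.comp_apply, φ, FreeLieAlgebra.lift_of_apply]
    rfl
  rw [eq_top_iff]
  intro x _
  obtain ⟨y, rfl⟩ : ∃ y, toAlg R y = x := LieSubmodule.Quotient.surjective_mk' _ x
  obtain ⟨z, rfl⟩ : ∃ z, q z = y := LieSubmodule.Quotient.surjective_mk' _ y
  have := LieHom.congr_fun hφ z
  rw [LieHom.comp_apply, LieHom.comp_apply] at this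
  rw [← this]
  exact (φ z).2

variable {R} in
theorem rootSpace_lie {p q : ι → ℤ} {x y : Alg R} (hx : x ∈ rootSpace R p)
    (hy : y ∈ rootSpace R q) : ⁅x, y⁆ ∈ rootSpace R (p + q) := by
  intro z
  rw [leibniz_lie, hx z, hy z, smul_lie, lie_smul, ← add_smul, ← Finset.sum_add_distrib]
  congr 1
  refine Finset.sum_congr rfl fun i _ => ?_
  simp only [Pi.add_apply]
  push_cast
  ring

open scoped Classical in
theorem e_mem_rootSpace (i : ι) : e R i ∈ rootSpace R (Pi.single i 1) := by
  intro y
  rw [cartanMap_e, Finset.sum_eq_single i]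
  · simp
  · intro j _ hj; simp [hj]
  · simp

open scoped Classical in
theorem f_mem_rootSpace (i : ι) : f R i ∈ rootSpace R (-Pi.single i 1) := by
  intro y
  rw [cartanMap_f, Finset.sum_eq_single i]
  · simp
  · intro j _ hj; simp [hj]
  · simp

theorem IsWord.e_mem_rootSpace {m : ι → ℕ} {y : Alg R} (h : IsWord (e R) m y) :
    y ∈ rootSpace R (fun i => (m i : ℤ)) := by
  classical
  induction h with
  | single i =>
    convert KacMoody.e_mem_rootSpace R i using 2
    ext j; by_cases h : j = i
    · subst h; simp
    · simp [h]
  | lie i hy ih =>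
    convert rootSpace_lie (KacMoody.e_mem_rootSpace R i) ih using 2
    ext j; by_cases h : j = i
    · subst h; simp [add_comm]
    · simp [h]

theorem IsWord.f_mem_rootSpace {m : ι → ℕ} {y : Alg R} (h : IsWord (f R) m y) :
    y ∈ rootSpace R (fun i => -(m i : ℤ)) := by
  classical
  induction h with
  | single i =>
    convert KacMoody.f_mem_rootSpace R i using 2
    ext j; by_cases h : j = i
    · subst h; simp
    · simp [h]
  | lie i hy ih =>
    convert rootSpace_lie (KacMoody.f_mem_rootSpace R i) ih using 2
    ext j; by_cases h : j = i
    · subst h; simp [add_comm]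
    · simp [h]

/-- The span of the iterated brackets of a family of elements. -/
noncomputable def wordSpan (g : ι → Alg R) : Submodule ℂ (Alg R) :=
  Submodule.span ℂ {y | ∃ m, IsWord g m y}

variable {R} in
theorem lie_mem_wordSpan (g : ι → Alg R) (i : ι) {y : Alg R} (hy : y ∈ wordSpan R g) :
    ⁅g i, y⁆ ∈ wordSpan R g := by
  induction hy using Submodule.span_induction with
  | mem y hy => obtain ⟨m, hm⟩ := hy; exact Submodule.subset_span ⟨_, hm.lie i⟩
  | zero => simp
  | add x y _ _ hx hy => rw [lie_add]; exact add_mem hx hy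
  | smul c x _ hx => rw [lie_smul]; exact Submodule.smul_mem _ _ hx

variable {R} in
theorem cartan_lie_mem_wordSpan {g : ι → Alg R}
    (hg : ∀ m y, IsWord g m y → ∃ p, y ∈ rootSpace R p) (x : H) {y : Alg R}
    (hy : y ∈ wordSpan R g) : ⁅cartanMap R x, y⁆ ∈ wordSpan R g := by
  induction hy using Submodule.span_induction with
  | mem y hy =>
    obtain ⟨m, hm⟩ := hy
    obtain ⟨p, hp⟩ := hg m y hm
    rw [hp x]
    exact Submodule.smul_mem _ _ (Submodule.subset_span ⟨m, hm⟩)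
  | zero => simp
  | add x y _ _ hx hy => rw [lie_add]; exact add_mem hx hy
  | smul c x _ hx => rw [lie_smul]; exact Submodule.smul_mem _ _ hx

/-- Bracketing with a generator of the opposite sign takes an iterated bracket to the sum of an
element of the Cartan subalgebra and a combination of iterated brackets. -/
theorem opposite_lie_mem {g g' : ι → Alg R}
    (hg : ∀ m y, IsWord g m y → ∃ p, y ∈ rootSpace R p)
    (hgg' : ∀ i j, ⁅g' i, g j⁆ ∈ LinearMap.range (cartanMap R)) (i : ι) {y : Alg R}
    (hy : y ∈ wordSpan R g) :
    ⁅g' i, y⁆ ∈ wordSpan R g ⊔ LinearMap.range (cartanMap R) := by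
  induction hy using Submodule.span_induction with
  | mem y hy =>
    obtain ⟨m, hm⟩ := hy
    induction hm with
    | single j => exact Submodule.mem_sup_right (hgg' i j)
    | lie j hy ih =>
      rw [leibniz_lie]
      refine add_mem (Submodule.mem_sup_left ?_) ?_
      · obtain ⟨x, hx⟩ := hgg' i j
        rw [← hx]
        exact cartan_lie_mem_wordSpan hg x (Submodule.subset_span ⟨_, hy⟩)
      · obtain ⟨a, ha, b, ⟨x, rfl⟩, hab⟩ := Submodule.mem_sup.mp ih
        rw [← hab, lie_add]
        refine Submodule.mem_sup_left (add_mem (lie_mem_wordSpan g j ha) ?_)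
        obtain ⟨p, hp⟩ := hg _ _ (IsWord.single j)
        rw [← lie_skew, hp x]
        exact neg_mem (Submodule.smul_mem _ _ (Submodule.subset_span ⟨_, IsWord.single j⟩))
  | zero => simp
  | add x y _ _ hx hy => rw [lie_add]; exact add_mem hx hy
  | smul c x _ hx => rw [lie_smul]; exact Submodule.smul_mem _ _ hx

/-- The triangular decomposition `𝔤 = N⁻ + 𝔥 + N⁺`, where `N⁻` and `N⁺` are spanned by the iterated
brackets of the `f_i` and of the `e_i`. -/
theorem triangular :
    wordSpan R (f R) ⊔ LinearMap.range (cartanMap R) ⊔ wordSpan R (e R) = ⊤ := by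
  set S := wordSpan R (f R) ⊔ LinearMap.range (cartanMap R) ⊔ wordSpan R (e R) with hS
  have hf : ∀ m y, IsWord (f R) m y → ∃ p, y ∈ rootSpace R p :=
    fun m y h => ⟨_, h.f_mem_rootSpace⟩
  have he : ∀ m y, IsWord (e R) m y → ∃ p, y ∈ rootSpace R p :=
    fun m y h => ⟨_, h.e_mem_rootSpace⟩
  have hfS : wordSpan R (f R) ≤ S := le_sup_left.trans le_sup_left
  have hhS : LinearMap.range (cartanMap R) ≤ S := le_sup_right.trans le_sup_left
  have heS : wordSpan R (e R) ≤ S := le_sup_right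
  have key : ∀ x : Alg R, (∀ y ∈ wordSpan R (f R), ⁅x, y⁆ ∈ S) →
      (∀ y, ⁅x, cartanMap R y⁆ ∈ S) → (∀ y ∈ wordSpan R (e R), ⁅x, y⁆ ∈ S) →
      ∀ y ∈ S, ⁅x, y⁆ ∈ S := by
    intro x h1 h2 h3 y hy
    obtain ⟨a', ha', c, hc, rfl⟩ := Submodule.mem_sup.mp hy
    obtain ⟨a, ha, _, ⟨b, rfl⟩, rfl⟩ := Submodule.mem_sup.mp ha'
    rw [lie_add, lie_add]
    exact add_mem (add_mem (h1 a ha) (h2 b)) (h3 c hc)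
  have hgen : ∀ (g : ι → Alg R) (i : ι) (p : ι → ℤ), wordSpan R g ≤ S → g i ∈ rootSpace R p →
      ∀ y, ⁅g i, cartanMap R y⁆ ∈ S := by
    intro g i p hg hp y
    rw [← lie_skew, hp y]
    exact neg_mem (Submodule.smul_mem _ _ (hg (Submodule.subset_span ⟨_, IsWord.single i⟩)))
  let K : LieSubalgebra ℂ (Alg R) :=
    { carrier := {x | ∀ y ∈ S, ⁅x, y⁆ ∈ S}
      add_mem' := fun hx hy z hz => by rw [add_lie]; exact add_mem (hx z hz) (hy z hz)
      zero_mem' := fun z _ => by simp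
      smul_mem' := fun c x hx z hz => by rw [smul_lie]; exact Submodule.smul_mem _ _ (hx z hz)
      lie_mem' := fun {x y} hx hy z hz => by
        rw [lie_lie]; exact sub_mem (hx _ (hy z hz)) (hy _ (hx z hz)) }
  have hK : K = ⊤ := by
    refine eq_top_of_generators R K (fun i => key _ ?_ ?_ ?_) (fun i => key _ ?_ ?_ ?_)
      fun x => key _ ?_ ?_ ?_
    · exact fun y hy => (sup_le hfS hhS) (opposite_lie_mem R hf (e_f_mem_range R) i hy)
    · exact hgen _ i _ heS (IsWord.single i : IsWord (e R) _ _).e_mem_rootSpace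
    · exact fun y hy => heS (lie_mem_wordSpan _ i hy)
    · exact fun y hy => hfS (lie_mem_wordSpan _ i hy)
    · exact hgen _ i _ hfS (IsWord.single i : IsWord (f R) _ _).f_mem_rootSpace
    · refine fun y hy => (sup_le heS hhS) (opposite_lie_mem R he (fun i j => ?_) i hy)
      rw [← lie_skew]
      exact neg_mem (e_f_mem_range R j i)
    · exact fun y hy => hfS (cartan_lie_mem_wordSpan hf x hy)
    · exact fun y => by rw [cartanMap_lie]; exact zero_mem _
    · exact fun y hy => heS (cartan_lie_mem_wordSpan he x hy)
  let S' : LieSubalgebra ℂ (Alg R) :=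
    { S with
      lie_mem' := fun {x y} _ hy => by
        have hx : x ∈ K := hK ▸ LieSubalgebra.mem_top x
        exact hx y hy }
  have hS' : S' = ⊤ := eq_top_of_generators R S'
    (fun i => heS (Submodule.subset_span ⟨_, IsWord.single i⟩))
    (fun i => hfS (Submodule.subset_span ⟨_, IsWord.single i⟩)) (fun x => hhS ⟨x, rfl⟩)
  rw [eq_top_iff]
  intro x _
  have : x ∈ S' := hS' ▸ LieSubalgebra.mem_top x
  exact this

/-- The weight spaces of `𝔤` are independent, as the simple roots are linearly independent. -/
theorem rootSpace_iSupIndep : iSupIndep (rootSpace R) := by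
  have hcomm : ∀ x y : H, Commute (LieAlgebra.ad ℂ (Alg R) (cartanMap R x))
      (LieAlgebra.ad ℂ (Alg R) (cartanMap R y)) := by
    intro x y
    ext z
    simp only [Module.End.mul_apply, LieAlgebra.ad_apply]
    rw [leibniz_lie, cartanMap_lie, zero_lie, zero_add]
  have h := Module.End.independent_iInf_maxGenEigenspace_of_forall_mapsTo
    (fun x : H => LieAlgebra.ad ℂ (Alg R) (cartanMap R x))
    (fun x y φ => Module.End.mapsTo_maxGenEigenspace_of_comm (hcomm y x) φ)
  have hinj : Function.Injective fun (m : ι → ℤ) (y : H) => ∑ i, (m i : ℂ) * R.root i y := by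
    intro m n hmn
    have h0 : ∑ i, ((m i : ℂ) - n i) • R.root i = 0 := by
      ext y
      have := congrFun hmn y
      simp only at this
      simp [sub_mul, Finset.sum_sub_distrib, this]
    ext i
    have := Fintype.linearIndependent_iff.mp R.root_indep _ h0 i
    exact_mod_cast sub_eq_zero.mp this
  refine (h.comp hinj).mono fun m x hx => ?_
  simp only [Function.comp_apply, Submodule.mem_iInf]
  intro y
  refine Module.End.mem_maxGenEigenspace _ _ _ |>.mpr ⟨1, ?_⟩
  simp [hx y]

/-- For `β ≠ 0` the space `𝔤_{-β}` is spanned by the iterated brackets of the `f_i` of content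
`β`. -/
theorem rootSpace_neg_le (m : ι → ℕ) (hm : m ≠ 0) :
    rootSpace R (fun i => -(m i : ℤ)) ≤ Submodule.span ℂ {y | IsWord (f R) m y} := by
  intro x hx
  set p : ι → ℤ := fun i => -(m i : ℤ) with hp
  set P := Submodule.span ℂ {y | IsWord (f R) m y} with hP
  have hPle : P ≤ rootSpace R p := Submodule.span_le.mpr fun y hy => IsWord.f_mem_rootSpace R hy
  set Q := ⨆ q, ⨆ _ : q ≠ p, rootSpace R q with hQ
  have hle : ∀ q, q ≠ p → rootSpace R q ≤ Q := fun q hq => le_iSup₂_of_le q hq le_rfl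
  have htop : P ⊔ Q = ⊤ := by
    rw [eq_top_iff, ← triangular R]
    refine sup_le (sup_le (Submodule.span_le.mpr ?_) ?_) (Submodule.span_le.mpr ?_)
    · rintro y ⟨n, hn⟩
      by_cases hnm : n = m
      · subst hnm
        exact Submodule.mem_sup_left (Submodule.subset_span hn)
      · refine Submodule.mem_sup_right (hle _ (fun h => hnm ?_) (IsWord.f_mem_rootSpace R hn))
        ext i
        simpa [hp] using congrFun h i
    · rintro _ ⟨y, rfl⟩
      refine Submodule.mem_sup_right (hle 0 (fun h => hm ?_) fun z => ?_)
      · ext i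
        simpa [hp] using (congrFun h i).symm
      · simp [cartanMap_lie]
    · rintro y ⟨n, hn⟩
      refine Submodule.mem_sup_right (hle _ (fun h => hm ?_) (IsWord.e_mem_rootSpace R hn))
      ext i
      have := congrFun h i
      simp only [hp] at this
      simp only [Pi.zero_apply]
      omega
  obtain ⟨y, hy, z, hz, rfl⟩ := Submodule.mem_sup.mp (htop ▸ Submodule.mem_top : x ∈ P ⊔ Q)
  have hz' : z ∈ rootSpace R p := by simpa using sub_mem hx (hPle hy)
  have := Submodule.disjoint_def.mp ((rootSpace_iSupIndep R) p) z hz' hz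
  simpa [this] using hy

end Words

end KacMoody

/-! ### The Lie algebra `𝔤' ⊗ A ⊕ 𝔥''` and its highest weight modules -/

namespace KacMoody

section Derived

variable {ι : Type*} [Fintype ι] {C : Matrix ι ι ℤ} {H : Type*} [AddCommGroup H] [Module ℂ H]
  (R : Realization C H)

theorem IsWord.exists_derived {g : ι → Alg R} {g' : ι → derived R}
    (hg : ∀ i, (g' i : Alg R) = g i) {m : ι → ℕ} {y : Alg R} (h : IsWord g m y) :
    ∃ y' : derived R, IsWord g' m y' ∧ (y' : Alg R) = y := by
  induction h with
  | single i => exact ⟨g' i, .single i, hg i⟩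
  | lie i hy ih =>
    obtain ⟨y', hy', rfl⟩ := ih
    exact ⟨⁅g' i, y'⁆, hy'.lie i, by rw [← hg i]; rfl⟩

theorem IsWord.coe_derived {g : ι → Alg R} {g' : ι → derived R}
    (hg : ∀ i, (g' i : Alg R) = g i) {m : ι → ℕ} {y : derived R} (h : IsWord g' m y) :
    IsWord g m (y : Alg R) := by
  induction h with
  | single i => rw [hg i]; exact .single i
  | @lie i m y hy ih =>
    have : ((⁅g' i, y⁆ : derived R) : Alg R) = ⁅g i, (y : Alg R)⁆ := by rw [← hg i]; rfl
    rw [this]; exact ih.lie i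

variable {R} in
/-- `𝔤'` is spanned by the iterated brackets of the `f_i`, by `𝔥'` and by the iterated brackets of
the `e_i`. -/
theorem derived_eq_top (P : Submodule ℂ (derived R))
    (hf : ∀ m y, IsWord (f' R) m y → y ∈ P) (hh : ∀ x : cartan' R, cartan'Incl R x ∈ P)
    (he : ∀ m y, IsWord (e' R) m y → y ∈ P) : P = ⊤ := by
  have key : ∀ (g : ι → Alg R) (g' : ι → derived R), (∀ i, (g' i : Alg R) = g i) →
      (∀ m y, IsWord g' m y → y ∈ P) → ∀ y ∈ wordSpan R g, ∃ y' ∈ P, (y' : Alg R) = y := by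
    intro g g' hg hP y hy
    have : wordSpan R g ≤ P.map (derived R).toSubmodule.subtype := by
      refine Submodule.span_le.mpr ?_
      rintro y ⟨m, hm⟩
      obtain ⟨y', hy', rfl⟩ := hm.exists_derived R hg
      exact ⟨y', hP _ _ hy', rfl⟩
    obtain ⟨y', hy', h⟩ := this hy
    exact ⟨y', hy', h⟩
  rw [eq_top_iff]
  rintro ⟨x, hx⟩ -
  obtain ⟨y, hy, c, hc, hyc⟩ := Submodule.mem_sup.mp (triangular R ▸ Submodule.mem_top (x := x))
  obtain ⟨a, ha, b, hb, rfl⟩ := Submodule.mem_sup.mp hy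
  obtain ⟨a', ha', rfl⟩ := key _ (f' R) (fun _ => rfl) hf a ha
  obtain ⟨c', hc', rfl⟩ := key _ (e' R) (fun _ => rfl) he c hc
  have hbd : b ∈ derived R := by
    have : b = x - a' - c' := by rw [← hyc]; abel
    rw [this]
    exact sub_mem (sub_mem hx a'.2) c'.2
  have hb' := hh ⟨⟨b, hb⟩, hbd⟩
  have : (⟨x, hx⟩ : derived R) = a' + cartan'Incl R ⟨⟨b, hb⟩, hbd⟩ + c' :=
    Subtype.ext hyc.symm
  rw [this]
  exact add_mem (add_mem ha' hb') hc'

variable {R} in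
/-- For `β ≠ 0` the space `𝔤_{-β} ∩ 𝔤'` is spanned by iterated brackets of the `f_i`. -/
theorem mem_span_word_of_mem_rootSpace_neg {m : ι → ℕ} (hm : m ≠ 0) {x : derived R}
    (hx : (x : Alg R) ∈ rootSpace R (fun i => -(m i : ℤ))) :
    x ∈ Submodule.span ℂ {y | IsWord (f' R) m y} := by
  have : Submodule.span ℂ {y | IsWord (f R) m y} ≤
      (Submodule.span ℂ {y | IsWord (f' R) m y}).map (derived R).toSubmodule.subtype := by
    refine Submodule.span_le.mpr ?_
    intro y hy
    obtain ⟨y', hy', rfl⟩ := IsWord.exists_derived R (g' := f' R) (fun _ => rfl) hy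
    exact ⟨y', Submodule.subset_span hy', rfl⟩
  obtain ⟨y, hy, h⟩ := this (rootSpace_neg_le R m hm hx)
  rwa [← Subtype.ext (a1 := y) h]

end Derived

section Current

variable {ι : Type*} [Fintype ι] {C : Matrix ι ι ℤ} {H : Type*} [AddCommGroup H] [Module ℂ H]
  {R : Realization C H} {A : Type*} [CommRing A] [Algebra ℂ A] {D : LieSubalgebra ℂ (cartan R)}

variable (R A D) in
/-- The inclusion of `𝔤' ⊗ A` into `𝔤̃`. -/
noncomputable abbrev curInl : A ⊗[ℂ] derived R →ₗ⁅ℂ⁆ Cur R A D :=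
  LieAlgebra.SemiDirectSum.inl (curAct R A D)

variable (R A D) in
/-- The inclusion of `𝔥''` into `𝔤̃`. -/
noncomputable abbrev curInr : D →ₗ⁅ℂ⁆ Cur R A D := LieAlgebra.SemiDirectSum.inr (curAct R A D)

theorem elt_eq (a : A) (x : derived R) : elt R D a x = curInl R A D (a ⊗ₜ x) := rfl

theorem elt_add (a : A) (x y : derived R) : elt R D a (x + y) = elt R D a x + elt R D a y := by
  rw [elt_eq, TensorProduct.tmul_add, map_add]; rfl

theorem elt_add_left (a b : A) (x : derived R) :
    elt R D (a + b) x = elt R D a x + elt R D b x := by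
  rw [elt_eq, TensorProduct.add_tmul, map_add]; rfl

theorem elt_smul (c : ℂ) (a : A) (x : derived R) : elt R D a (c • x) = c • elt R D a x := by
  rw [elt_eq, TensorProduct.tmul_smul, map_smul]; rfl

theorem elt_smul_left (c : ℂ) (a : A) (x : derived R) :
    elt R D (c • a) x = c • elt R D a x := by
  rw [elt_eq, TensorProduct.smul_tmul]; exact elt_smul c a x

theorem elt_zero (a : A) : elt R D a 0 = 0 := by
  rw [elt_eq, TensorProduct.tmul_zero, map_zero]

theorem elt_zero_left (x : derived R) : elt R D (0 : A) x = 0 := by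
  rw [elt_eq, TensorProduct.zero_tmul, map_zero]

theorem lie_elt (a b : A) (x y : derived R) :
    ⁅elt R D a x, elt R D b y⁆ = elt R D (a * b) ⁅x, y⁆ := by
  rw [elt_eq, elt_eq, ← LieHom.map_lie, LieAlgebra.ExtendScalars.bracket_tmul]; rfl

theorem inr_lie_inl (d : D) (x : A ⊗[ℂ] derived R) :
    ⁅curInr R A D d, curInl R A D x⁆ = curInl R A D (curAct R A D d x) := by
  apply LieAlgebra.SemiDirectSum.ext
  · change ⁅(0 : A ⊗[ℂ] derived R), x⁆ + curAct R A D d x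
      - curAct R A D (0 : D) (0 : A ⊗[ℂ] derived R) = _
    rw [zero_lie, map_zero, zero_add, sub_zero]; rfl
  · change ⁅d, (0 : D)⁆ = 0
    rw [lie_zero]

theorem curAct_tmul (d : D) (a : A) (x : derived R) :
    curAct R A D d (a ⊗ₜ x) = a ⊗ₜ ⁅((d : cartan R) : Alg R), x⁆ := rfl

theorem curAct_smul (d : D) (a : A) (x : A ⊗[ℂ] derived R) :
    curAct R A D d (a • x) = a • curAct R A D d x := by
  induction x using TensorProduct.induction_on with
  | zero => rw [smul_zero, map_zero, smul_zero]
  | tmul b y => rw [TensorProduct.smul_tmul', curAct_tmul, curAct_tmul, TensorProduct.smul_tmul']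
  | add x y hx hy => rw [smul_add, map_add, hx, hy, map_add, smul_add]

theorem inr_lie_elt (d : D) (a : A) (x : derived R) :
    ⁅curInr R A D d, elt R D a x⁆ = elt R D a ⁅((d : cartan R) : Alg R), x⁆ := by
  rw [elt_eq, inr_lie_inl, curAct_tmul]; rfl

theorem curCartanIncl_tmul (a : A) (x : cartan' R) :
    curCartanIncl R A D (a ⊗ₜ x, 0) = elt R D a (cartan'Incl R x) := by
  rw [curCartanIncl, LinearMap.coprod_apply, map_zero, add_zero]; rfl

theorem curCartanIncl_right (d : D) : curCartanIncl R A D (0, d) = curInr R A D d := by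
  rw [curCartanIncl, LinearMap.coprod_apply, map_zero, zero_add]; rfl

/-- A Lie subalgebra of `𝔤̃` containing all `e_i ⊗ a`, all `f_i ⊗ a` and `𝔥̃` is everything. -/
theorem cur_eq_top (K : LieSubalgebra ℂ (Cur R A D)) (he : ∀ i a, elt R D a (e' R i) ∈ K)
    (hf : ∀ i a, elt R D a (f' R i) ∈ K) (hh : ∀ h, curCartanIncl R A D h ∈ K) : K = ⊤ := by
  have hword : ∀ g : ι → derived R, (∀ i a, elt R D a (g i) ∈ K) → ∀ m y, IsWord g m y →
      ∀ a, elt R D a y ∈ K := by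
    intro g hg m y h
    induction h with
    | single i => exact hg i
    | @lie i m y hy ih =>
      intro a
      have := K.lie_mem (hg i 1) (ih a)
      rwa [lie_elt, one_mul] at this
  let P : Submodule ℂ (derived R) :=
    { carrier := {x | ∀ a, elt R D a x ∈ K}
      add_mem' := fun hx hy a => by rw [elt_add]; exact add_mem (hx a) (hy a)
      zero_mem' := fun a => by rw [elt_zero]; exact zero_mem _
      smul_mem' := fun c x hx a => by rw [elt_smul]; exact K.smul_mem c (hx a) }
  have hP : P = ⊤ := derived_eq_top P (fun m y h => hword _ hf m y h)
    (fun x a => by rw [← curCartanIncl_tmul]; exact hh _) (fun m y h => hword _ he m y h)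
  have hinl : ∀ x, curInl R A D x ∈ K := by
    intro x
    induction x using TensorProduct.induction_on with
    | zero => rw [map_zero]; exact zero_mem _
    | tmul a y => exact (hP ▸ Submodule.mem_top : y ∈ P) a
    | add x y hx hy => rw [map_add]; exact add_mem hx hy
  rw [eq_top_iff]
  intro x _
  have : x = curInl R A D x.left + curInr R A D x.right := by
    apply LieAlgebra.SemiDirectSum.ext
    · change x.left = x.left + 0; rw [add_zero]
    · change x.right = 0 + x.right; rw [zero_add]
  rw [this, ← curCartanIncl_right]
  exact add_mem (hinl _) (hh _)

theorem derived_ext {x y : derived R} (h : (x : Alg R) = y) : x = y := Subtype.ext h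

theorem cartan_lie_f' (x : cartan R) (i : ι) : ∃ c : ℂ, ⁅(x : Alg R), f' R i⁆ = c • f' R i := by
  obtain ⟨_, y, rfl⟩ := x
  refine ⟨-R.root i y, derived_ext ?_⟩
  change ⁅cartanMap R y, f R i⁆ = -R.root i y • f R i
  rw [cartanMap_f, neg_smul]

theorem curCartanIncl_lie_f (h : CurCartan R A D) (i : ι) (a : A) :
    ∃ c : A, ⁅curCartanIncl R A D h, elt R D a (f' R i)⁆ = elt R D c (f' R i) := by
  obtain ⟨h, d⟩ := h
  have h1 : ∃ c : A, ⁅curCartanIncl R A D (h, 0), elt R D a (f' R i)⁆ = elt R D c (f' R i) := by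
    induction h using TensorProduct.induction_on with
    | zero => exact ⟨0, by rw [show ((0 : A ⊗[ℂ] cartan' R), (0 : D)) = 0 from rfl, map_zero,
        zero_lie, elt_zero_left]⟩
    | tmul b x =>
      obtain ⟨c, hc⟩ := cartan_lie_f' (x : cartan R) i
      refine ⟨c • (b * a), ?_⟩
      rw [curCartanIncl_tmul, lie_elt, elt_smul_left, ← elt_smul, ← hc]
      rfl
    | add x y hx hy =>
      obtain ⟨c, hc⟩ := hx
      obtain ⟨c', hc'⟩ := hy
      refine ⟨c + c', ?_⟩
      rw [show ((x + y : A ⊗[ℂ] cartan' R), (0 : D)) = (x, 0) + (y, 0) by simp, map_add, add_lie,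
        hc, hc', elt_add_left]
  obtain ⟨c, hc⟩ := h1
  obtain ⟨c', hc'⟩ := cartan_lie_f' (d : cartan R) i
  refine ⟨c + c' • a, ?_⟩
  rw [show (h, d) = (h, 0) + ((0 : A ⊗[ℂ] cartan' R), d) by simp, map_add, add_lie, hc,
    curCartanIncl_right, inr_lie_elt, hc', elt_add_left, elt_smul_left, elt_smul]

theorem e'_lie_f' (i : ι) : ⁅e' R i, f' R i⁆ = cartan'Incl R (coroot' R i) :=
  derived_ext (e_f R i)

theorem elt_e_lie_elt_f (i : ι) (a b : A) :
    ⁅elt R D a (e' R i), elt R D b (f' R i)⁆ =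
      curCartanIncl R A D ((a * b) ⊗ₜ coroot' R i, 0) := by
  rw [lie_elt, e'_lie_f', curCartanIncl_tmul]

theorem elt_e_lie_elt_f_ne {i j : ι} (h : i ≠ j) (a b : A) :
    ⁅elt R D a (e' R i), elt R D b (f' R j)⁆ = 0 := by
  rw [lie_elt, derived_ext (show ((⁅e' R i, f' R j⁆ : derived R) : Alg R) = (0 : derived R) from
    e_f_ne R h), elt_zero]

section HighestWeight

variable {V : Type*} [AddCommGroup V] [Module ℂ V] [LieRingModule (Cur R A D) V]
  [LieModule ℂ (Cur R A D) V]

/-- If `v` is a `𝔥̃`-eigenvector that generates `V` and is annihilated by all `e_i ⊗ a`, then every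
subspace of `V` that contains `v` and is stable under all `f_i ⊗ a` is everything. -/
theorem highestWeight_induction {v : V} {ψ : Module.Dual ℂ (CurCartan R A D)}
    (hspan : LieSubmodule.lieSpan ℂ (Cur R A D) {v} = ⊤)
    (he : ∀ i (a : A), ⁅elt R D a (e' R i), v⁆ = 0)
    (hh : ∀ h, ⁅curCartanIncl R A D h, v⁆ = ψ h • v)
    (P : Submodule ℂ V) (hv : v ∈ P)
    (hf : ∀ i (a : A), ∀ w ∈ P, ⁅elt R D a (f' R i), w⁆ ∈ P) : P = ⊤ := by
  -- The least such subspace is shown to be stable under `𝔥̃` and then under all `e_i ⊗ a`.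
  let S : Set (Submodule ℂ V) :=
    {Q | v ∈ Q ∧ ∀ i (a : A), ∀ w ∈ Q, ⁅elt R D a (f' R i), w⁆ ∈ Q}
  set P₀ : Submodule ℂ V := sInf S with hP₀
  have hmin : ∀ Q ∈ S, P₀ ≤ Q := fun Q hQ => sInf_le hQ
  have hv₀ : v ∈ P₀ := Submodule.mem_sInf.mpr fun Q hQ => hQ.1
  have hf₀ : ∀ i (a : A), ∀ w ∈ P₀, ⁅elt R D a (f' R i), w⁆ ∈ P₀ := fun i a w hw =>
    Submodule.mem_sInf.mpr fun Q hQ => hQ.2 i a w (Submodule.mem_sInf.mp hw Q hQ)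
  have hh₀ : ∀ w ∈ P₀, ∀ h, ⁅curCartanIncl R A D h, w⁆ ∈ P₀ := by
    let Q : Submodule ℂ V :=
      { carrier := {w | w ∈ P₀ ∧ ∀ h, ⁅curCartanIncl R A D h, w⁆ ∈ P₀}
        add_mem' := fun hx hy => ⟨add_mem hx.1 hy.1, fun h => by
          rw [lie_add]; exact add_mem (hx.2 h) (hy.2 h)⟩
        zero_mem' := ⟨zero_mem _, fun h => by rw [lie_zero]; exact zero_mem _⟩
        smul_mem' := fun c x hx => ⟨P₀.smul_mem c hx.1, fun h => by
          rw [lie_smul]; exact P₀.smul_mem c (hx.2 h)⟩ }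
    have hQ : Q ∈ S := by
      refine ⟨⟨hv₀, fun h => ?_⟩, fun i a w hw => ⟨hf₀ i a w hw.1, fun h => ?_⟩⟩
      · rw [hh]; exact P₀.smul_mem _ hv₀
      · obtain ⟨c, hc⟩ := curCartanIncl_lie_f h i a
        rw [leibniz_lie, hc]
        exact add_mem (hf₀ i c w hw.1) (hf₀ i a _ (hw.2 h))
    exact fun w hw => (hmin Q hQ hw).2
  have he₀ : ∀ w ∈ P₀, ∀ i (a : A), ⁅elt R D a (e' R i), w⁆ ∈ P₀ := by
    let Q : Submodule ℂ V :=
      { carrier := {w | w ∈ P₀ ∧ ∀ i (a : A), ⁅elt R D a (e' R i), w⁆ ∈ P₀}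
        add_mem' := fun hx hy => ⟨add_mem hx.1 hy.1, fun i a => by
          rw [lie_add]; exact add_mem (hx.2 i a) (hy.2 i a)⟩
        zero_mem' := ⟨zero_mem _, fun i a => by rw [lie_zero]; exact zero_mem _⟩
        smul_mem' := fun c x hx => ⟨P₀.smul_mem c hx.1, fun i a => by
          rw [lie_smul]; exact P₀.smul_mem c (hx.2 i a)⟩ }
    have hQ : Q ∈ S := by
      refine ⟨⟨hv₀, fun i a => ?_⟩, fun i a w hw => ⟨hf₀ i a w hw.1, fun j b => ?_⟩⟩
      · rw [he]; exact zero_mem _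
      · rw [leibniz_lie]
        refine add_mem ?_ (hf₀ i a _ (hw.2 j b))
        by_cases hij : j = i
        · subst hij
          rw [elt_e_lie_elt_f]
          exact hh₀ w hw.1 _
        · rw [elt_e_lie_elt_f_ne hij, zero_lie]
          exact zero_mem _
    exact fun w hw => (hmin Q hQ hw).2
  let K : LieSubalgebra ℂ (Cur R A D) :=
    { carrier := {x | ∀ w ∈ P₀, ⁅x, w⁆ ∈ P₀}
      add_mem' := fun hx hy z hz => by rw [add_lie]; exact add_mem (hx z hz) (hy z hz)
      zero_mem' := fun z _ => by rw [zero_lie]; exact zero_mem _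
      smul_mem' := fun c x hx z hz => by rw [smul_lie]; exact Submodule.smul_mem _ _ (hx z hz)
      lie_mem' := fun {x y} hx hy z hz => by
        rw [lie_lie]; exact sub_mem (hx _ (hy z hz)) (hy _ (hx z hz)) }
  have hK : K = ⊤ := cur_eq_top K (fun i a w hw => he₀ w hw i a) (fun i a w hw => hf₀ i a w hw)
    (fun h w hw => hh₀ w hw h)
  let N : LieSubmodule ℂ (Cur R A D) V :=
    { P₀ with
      lie_mem := fun {x w} hw => (hK ▸ LieSubalgebra.mem_top x : x ∈ K) w hw }
  have hN : LieSubmodule.lieSpan ℂ (Cur R A D) {v} ≤ N :=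
    LieSubmodule.lieSpan_le.mpr (Set.singleton_subset_iff.mpr hv₀)
  rw [hspan] at hN
  rw [eq_top_iff]
  exact fun w _ => hmin P ⟨hv, hf⟩ (hN (LieSubmodule.mem_top w))

end HighestWeight

end Current

end KacMoody

/-! ### Weight strings -/

namespace KacMoody

section Sl2

variable {L V : Type*} [LieRing L] [LieAlgebra ℂ L] [AddCommGroup V] [Module ℂ V]
  [LieRingModule L V] [LieModule ℂ L V]

theorem sl2_lie_h_pow {f h : L} (hf : ⁅h, f⁆ = -((2 : ℂ) • f)) {w : V} {μ : ℂ}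
    (hw : ⁅h, w⁆ = μ • w) (n : ℕ) :
    ⁅h, (LieModule.toEnd ℂ L V f ^ n) w⁆ = (μ - 2 * n) • (LieModule.toEnd ℂ L V f ^ n) w := by
  induction n with
  | zero => simpa using hw
  | succ n ih =>
    rw [pow_succ', Module.End.mul_apply, LieModule.toEnd_apply_apply, leibniz_lie, hf, ih,
      lie_smul, neg_lie, smul_lie, ← neg_smul, ← add_smul]
    congr 1
    push_cast
    ring

theorem sl2_lie_e_pow_succ {e f h : L} (hef : ⁅e, f⁆ = h) (hf : ⁅h, f⁆ = -((2 : ℂ) • f))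
    {w : V} {μ : ℂ} (hw : ⁅h, w⁆ = μ • w) (he : ⁅e, w⁆ = 0) (n : ℕ) :
    ⁅e, (LieModule.toEnd ℂ L V f ^ (n + 1)) w⁆
      = ((n + 1) * (μ - n)) • (LieModule.toEnd ℂ L V f ^ n) w := by
  induction n with
  | zero => simp [leibniz_lie e, hef, he, hw]
  | succ n ih =>
    rw [pow_succ', Module.End.mul_apply, LieModule.toEnd_apply_apply, leibniz_lie, hef, ih,
      lie_smul, sl2_lie_h_pow hf hw, ← LieModule.toEnd_apply_apply ℂ L V f,
      ← Module.End.mul_apply, ← pow_succ', ← add_smul]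
    congr 1
    push_cast
    ring

/-- A nonzero vector annihilated by `e`, of weight `μ` and annihilated by a power of `f`, generates
a string of length `μ + 1`; in particular `μ` is a natural number. -/
theorem sl2_exists_nat {e f h : L} (hef : ⁅e, f⁆ = h) (hf : ⁅h, f⁆ = -((2 : ℂ) • f))
    {w : V} {μ : ℂ} (hw : ⁅h, w⁆ = μ • w) (he : ⁅e, w⁆ = 0) (hw0 : w ≠ 0)
    (hnil : ∃ n : ℕ, (LieModule.toEnd ℂ L V f ^ n) w = 0) :
    ∃ r : ℕ, μ = r ∧ (LieModule.toEnd ℂ L V f ^ r) w ≠ 0 ∧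
      (LieModule.toEnd ℂ L V f ^ (r + 1)) w = 0 := by
  classical
  obtain ⟨r, hr⟩ : ∃ r, Nat.find hnil = r + 1 := Nat.exists_eq_succ_of_ne_zero fun h0 => hw0 <| by
    simpa [h0] using Nat.find_spec hnil
  have h1 : (LieModule.toEnd ℂ L V f ^ (r + 1)) w = 0 := hr ▸ Nat.find_spec hnil
  have h2 : (LieModule.toEnd ℂ L V f ^ r) w ≠ 0 := Nat.find_min hnil (by omega)
  refine ⟨r, ?_, h2, h1⟩
  have h3 := sl2_lie_e_pow_succ hef hf hw he r
  rw [h1, lie_zero, eq_comm, smul_eq_zero, or_iff_left h2, mul_eq_zero] at h3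
  rcases h3 with h3 | h3
  · exact absurd h3 (by exact_mod_cast Nat.succ_ne_zero r)
  · exact sub_eq_zero.mp h3

end Sl2

section Weights

variable {ι : Type*} [Fintype ι] {C : Matrix ι ι ℤ} {H : Type*} [AddCommGroup H] [Module ℂ H]
  {R : Realization C H} {A : Type*} [CommRing A] [Algebra ℂ A] {D : LieSubalgebra ℂ (cartan R)}

open scoped Classical in
variable (R) in
/-- There are fundamental coweights, since the simple roots are linearly independent. -/
theorem exists_dual_root (i : ι) : ∃ y : H, ∀ j, R.root j y = if j = i then 1 else 0 := by
  have := R.finite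
  obtain ⟨g, hg⟩ := LinearMap.exists_leftInverse_of_injective
    (Finsupp.linearCombination ℂ R.root) (LinearMap.ker_eq_bot.mpr R.root_indep)
  obtain ⟨y, hy⟩ := (Module.evalEquiv ℂ H).surjective ((Finsupp.lapply i).comp g)
  refine ⟨y, fun j => ?_⟩
  have h1 := LinearMap.congr_fun hy (R.root j)
  have h2 := LinearMap.congr_fun hg (Finsupp.single j 1)
  simp only [LinearMap.comp_apply, Finsupp.linearCombination_single, one_smul,
    LinearMap.id_apply] at h2
  simp only [LinearMap.comp_apply, h2, Finsupp.lapply_apply] at h1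
  rw [Module.evalEquiv_apply] at h1
  simpa [Finsupp.single_apply] using h1

variable (R) in
/-- The canonical map from `H` onto the Cartan subalgebra of `𝔤`. -/
noncomputable def toCartan : H →ₗ[ℂ] cartan R := (cartanMap R).rangeRestrict

theorem coe_toCartan (y : H) : (toCartan R y : Alg R) = cartanMap R y := rfl

theorem toCartan_surjective : Function.Surjective (toCartan R) := by
  rintro ⟨_, y, rfl⟩
  exact ⟨y, rfl⟩

theorem toCartan_coroot (i : ι) : toCartan R (R.coroot i) = corootH R i := rfl

variable (A) in
/-- The embedding of `𝔥 = 𝔥' ⊕ 𝔥''` into `𝔥̃ = 𝔥' ⊗ A ⊕ 𝔥''`. -/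
noncomputable def cartanLift (hD : IsCompl (cartan' R).toSubmodule D.toSubmodule) :
    cartan R →ₗ[ℂ] CurCartan R A D :=
  ((TensorProduct.mk ℂ A (cartan' R) 1).comp (Submodule.projectionOnto _ _ hD)).prod
    (Submodule.projectionOnto _ _ hD.symm)

variable (hD : IsCompl (cartan' R).toSubmodule D.toSubmodule)

theorem cartanLift_cartan' (x : cartan' R) :
    cartanLift A hD (x : cartan R) = ((1 : A) ⊗ₜ x, 0) := by
  refine Prod.ext ?_ ?_
  · exact congrArg (fun z => (1 : A) ⊗ₜ[ℂ] z) (Submodule.projectionOnto_apply_left hD x)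
  · exact Submodule.projectionOnto_apply_right hD.symm x

theorem cartanLift_right (x : D) : cartanLift A hD (x : cartan R) = (0, x) := by
  refine Prod.ext ?_ ?_
  · exact (congrArg (fun z => (1 : A) ⊗ₜ[ℂ] z) (Submodule.projectionOnto_apply_right hD x)).trans
      (TensorProduct.tmul_zero _ _)
  · exact Submodule.projectionOnto_apply_left hD.symm x

include hD in
theorem exists_cartan_eq_add (x : cartan R) :
    ∃ (x' : cartan' R) (x'' : D), x = (x' : cartan R) + (x'' : cartan R) := by
  obtain ⟨y, hy, z, hz, h⟩ := Submodule.mem_sup.mp (hD.sup_eq_top ▸ Submodule.mem_top (x := x))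
  exact ⟨⟨y, hy⟩, ⟨z, hz⟩, h.symm⟩

theorem apply_cartanLift {ψ : Module.Dual ℂ (CurCartan R A D)} {lam : Module.Dual ℂ (cartan R)}
    (h : RestrictsTo R ψ lam) (x : cartan R) : ψ (cartanLift A hD x) = lam x := by
  obtain ⟨x', x'', rfl⟩ := exists_cartan_eq_add hD x
  rw [map_add, map_add, map_add, cartanLift_cartan', cartanLift_right, h.1, h.2]

variable (A) in
/-- The image in `𝔤̃` of an element of `H`. -/
noncomputable def hElt : H →ₗ[ℂ] Cur R A D :=
  (curCartanIncl R A D).comp ((cartanLift A hD).comp (toCartan R))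

theorem hElt_lie_elt (y : H) (a : A) (x : derived R) :
    ⁅hElt A hD y, elt R D a x⁆ = elt R D a ⁅cartanMap R y, x⁆ := by
  obtain ⟨x', x'', h⟩ := exists_cartan_eq_add hD (toCartan R y)
  have h2 : ⁅cartanMap R y, x⁆ = ⁅cartan'Incl R x', x⁆ + ⁅((x'' : cartan R) : Alg R), x⁆ := by
    rw [← coe_toCartan, h]
    exact add_lie (((x' : cartan R) : Alg R)) ((x'' : cartan R) : Alg R) x
  rw [h2, elt_add, hElt, LinearMap.comp_apply, LinearMap.comp_apply, h, map_add, map_add,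
    cartanLift_cartan', cartanLift_right, curCartanIncl_tmul, curCartanIncl_right, add_lie,
    lie_elt, inr_lie_elt, one_mul]

theorem hElt_lie_elt_f (y : H) (a : A) (i : ι) :
    ⁅hElt A hD y, elt R D a (f' R i)⁆ = -(R.root i y • elt R D a (f' R i)) := by
  rw [hElt_lie_elt, ← neg_smul, ← elt_smul]
  congr 1
  refine derived_ext ?_
  change ⁅cartanMap R y, f R i⁆ = -R.root i y • f R i
  rw [cartanMap_f, neg_smul]

theorem hElt_lie_elt_e (y : H) (a : A) (i : ι) :
    ⁅hElt A hD y, elt R D a (e' R i)⁆ = R.root i y • elt R D a (e' R i) := by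
  rw [hElt_lie_elt, ← elt_smul]
  congr 1
  exact derived_ext (cartanMap_e R y i)

theorem hElt_coroot (i : ι) :
    hElt A hD (R.coroot i) = ⁅elt R D (1 : A) (e' R i), elt R D (1 : A) (f' R i)⁆ := by
  rw [elt_e_lie_elt_f, one_mul, hElt, LinearMap.comp_apply, LinearMap.comp_apply, toCartan_coroot]
  exact congrArg _ (cartanLift_cartan' hD (coroot' R i))

variable (V : Type*) [AddCommGroup V] [Module ℂ V] [LieRingModule (Cur R A D) V]
  [LieModule ℂ (Cur R A D) V]

variable (A) in
/-- The vectors of weight `χ` for the action of `H`. -/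
def hSpace (χ : Module.Dual ℂ H) : Submodule ℂ V where
  carrier := {w | ∀ y, ⁅hElt A hD y, w⁆ = χ y • w}
  add_mem' hx hy z := by rw [lie_add, hx z, hy z, smul_add]
  zero_mem' z := by simp
  smul_mem' c x hx z := by rw [lie_smul, hx z, smul_comm]

variable (A) in
/-- The vectors of weight `χ - ∑ m_i α_i`. -/
def gr (χ : Module.Dual ℂ H) (m : ι → ℤ) : Submodule ℂ V :=
  hSpace A hD V (χ - ∑ i, (m i : ℂ) • R.root i)

theorem mem_gr {χ : Module.Dual ℂ H} {m : ι → ℤ} {w : V} :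
    w ∈ gr A hD V χ m ↔ ∀ y, ⁅hElt A hD y, w⁆ = (χ y - ∑ i, (m i : ℂ) * R.root i y) • w := by
  refine forall_congr' fun y => ?_
  simp [LinearMap.sub_apply]

variable {V} {χ : Module.Dual ℂ H}

theorem map_mem_gr {V' : Type*} [AddCommGroup V'] [Module ℂ V'] [LieRingModule (Cur R A D) V']
    [LieModule ℂ (Cur R A D) V'] (g : V →ₗ⁅ℂ, Cur R A D⁆ V') {m : ι → ℤ} {w : V}
    (hw : w ∈ gr A hD V χ m) : g w ∈ gr A hD V' χ m := by
  intro y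
  rw [← LieModuleHom.map_lie, hw y, map_smul]

open scoped Classical in
theorem sum_root_add_single (m : ι → ℤ) (i : ι) (n : ℤ) (y : H) :
    ∑ j, (((m + Pi.single i n : ι → ℤ) j : ℤ) : ℂ) * R.root j y
      = ∑ j, (m j : ℂ) * R.root j y + n * R.root i y := by
  have : ∑ j, (((Pi.single i n : ι → ℤ) j : ℤ) : ℂ) * R.root j y = n * R.root i y := by
    rw [Finset.sum_eq_single i]
    · simp
    · intro j _ hj; simp [hj]
    · simp
  rw [← this, ← Finset.sum_add_distrib]
  refine Finset.sum_congr rfl fun j _ => ?_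
  rw [Pi.add_apply]
  push_cast
  ring

open scoped Classical in
theorem elt_f_lie_mem_gr {m : ι → ℤ} {w : V} (hw : w ∈ gr A hD V χ m) (i : ι) (a : A) :
    ⁅elt R D a (f' R i), w⁆ ∈ gr A hD V χ (m + Pi.single i 1) := by
  rw [mem_gr] at hw ⊢
  intro y
  rw [leibniz_lie, hw y, hElt_lie_elt_f, lie_smul, neg_lie, smul_lie, ← neg_smul, ← add_smul,
    sum_root_add_single]
  congr 1
  push_cast
  ring

open scoped Classical in
theorem elt_e_lie_mem_gr {m : ι → ℤ} {w : V} (hw : w ∈ gr A hD V χ m) (i : ι) (a : A) :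
    ⁅elt R D a (e' R i), w⁆ ∈ gr A hD V χ (m + Pi.single i (-1)) := by
  rw [mem_gr] at hw ⊢
  intro y
  rw [leibniz_lie, hw y, hElt_lie_elt_e, lie_smul, smul_lie, ← add_smul,
    sum_root_add_single]
  congr 1
  push_cast
  ring

open scoped Classical in
theorem elt_f_pow_mem_gr {m : ι → ℤ} {w : V} (hw : w ∈ gr A hD V χ m) (i : ι) (a : A) (n : ℕ) :
    (LieModule.toEnd ℂ (Cur R A D) V (elt R D a (f' R i)) ^ n) w
      ∈ gr A hD V χ (m + Pi.single i (n : ℤ)) := by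
  induction n with
  | zero => simpa using hw
  | succ n ih =>
    rw [pow_succ', Module.End.mul_apply, LieModule.toEnd_apply_apply]
    convert elt_f_lie_mem_gr hD ih i a using 2
    rw [add_assoc, ← Pi.single_add]
    push_cast
    rfl

open scoped Classical in
theorem elt_e_pow_mem_gr {m : ι → ℤ} {w : V} (hw : w ∈ gr A hD V χ m) (i : ι) (a : A) (n : ℕ) :
    (LieModule.toEnd ℂ (Cur R A D) V (elt R D a (e' R i)) ^ n) w
      ∈ gr A hD V χ (m + Pi.single i (-n : ℤ)) := by
  induction n with
  | zero => simpa using hw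
  | succ n ih =>
    rw [pow_succ', Module.End.mul_apply, LieModule.toEnd_apply_apply]
    convert elt_e_lie_mem_gr hD ih i a using 2
    rw [add_assoc, ← Pi.single_add]
    congr 2
    push_cast
    ring

variable {v : V} {ψ : Module.Dual ℂ (CurCartan R A D)}

/-- The weights of a highest weight module lie in the cone below the highest weight. -/
theorem iSup_gr_eq_top (hspan : LieSubmodule.lieSpan ℂ (Cur R A D) {v} = ⊤)
    (he : ∀ i (a : A), ⁅elt R D a (e' R i), v⁆ = 0)
    (hh : ∀ h, ⁅curCartanIncl R A D h, v⁆ = ψ h • v)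
    (hχ : ∀ y, ψ (cartanLift A hD (toCartan R y)) = χ y) :
    ⨆ m : ι → ℕ, gr A hD V χ (fun i => (m i : ℤ)) = ⊤ := by
  classical
  refine highestWeight_induction hspan he hh _ ?_ ?_
  · refine Submodule.mem_iSup_of_mem 0 ((mem_gr hD V).mpr fun y => ?_)
    rw [← hχ]
    simpa [hElt] using hh _
  · intro i a w hw
    induction hw using Submodule.iSup_induction' with
    | mem m w hw =>
      refine Submodule.mem_iSup_of_mem (m + Pi.single i 1) ?_
      convert elt_f_lie_mem_gr hD hw i a using 2
      ext j
      by_cases hj : j = i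
      · subst hj; simp
      · simp [hj]
    | zero => simp
    | add x y _ _ hx hy => rw [lie_add]; exact add_mem hx hy

/-- There are no vectors of weight `χ - ∑ m_i α_i` if some `m_i` is negative. -/
theorem gr_eq_bot (htop : ⨆ m : ι → ℕ, gr A hD V χ (fun i => (m i : ℤ)) = ⊤) {m : ι → ℤ} {i : ι}
    (hm : m i < 0) {w : V} (hw : w ∈ gr A hD V χ m) : w = 0 := by
  classical
  obtain ⟨y, hy⟩ := exists_dual_root R i
  set T : Module.End ℂ V := LieModule.toEnd ℂ (Cur R A D) V (hElt A hD y) with hT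
  have hgr : ∀ n : ι → ℤ, gr A hD V χ n ≤ T.eigenspace (χ y - n i) := by
    intro n w hw
    rw [Module.End.mem_eigenspace_iff, hT, LieModule.toEnd_apply_apply, (mem_gr hD V).mp hw y]
    simp [hy]
  have hind := (Module.End.eigenspaces_iSupIndep T) (χ y - m i)
  refine Submodule.disjoint_def.mp hind w (hgr m hw) ?_
  have hle : ⨆ n : ι → ℕ, gr A hD V χ (fun i => (n i : ℤ)) ≤
      ⨆ μ, ⨆ _ : μ ≠ χ y - m i, T.eigenspace μ := by
    refine iSup_le fun n => (hgr _).trans (le_iSup₂_of_le _ (fun h => ?_) le_rfl)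
    have h2 : ((n i : ℤ) : ℂ) = (m i : ℂ) := sub_right_injective h
    have h3 : (n i : ℤ) = m i := by exact_mod_cast h2
    omega
  rw [htop] at hle
  exact hle Submodule.mem_top

open scoped Classical in
/-- A bound, uniform over all modules, for the length of the `α_i`-string of weights of a highest
weight module on which `e_i` and `f_i` act locally nilpotently. -/
theorem gr_string_eq_bot (htop : ⨆ m : ι → ℕ, gr A hD V χ (fun i => (m i : ℤ)) = ⊤)
    (i : ι) (hen : ∀ w : V, ∃ n : ℕ,
      ((LieModule.toEnd ℂ (Cur R A D) V (elt R D 1 (e' R i))) ^ n) w = 0)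
    (hfn : ∀ w : V, ∃ n : ℕ,
      ((LieModule.toEnd ℂ (Cur R A D) V (elt R D 1 (f' R i))) ^ n) w = 0)
    {c : ℤ} (hc : χ (R.coroot i) = c) {m : ι → ℤ} {n : ℕ}
    (hn : m i + c - ∑ j, m j * C i j < n) {u : V}
    (hu : u ∈ gr A hD V χ (m + Pi.single i (n : ℤ))) : u = 0 := by
  by_contra hu0
  set E := elt R D (1 : A) (e' R i) with hE
  set F := elt R D (1 : A) (f' R i) with hF
  have hH : ⁅E, F⁆ = hElt A hD (R.coroot i) := (hElt_coroot hD i).symm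
  have hrt : R.root i (R.coroot i) = 2 := by rw [R.pairing, R.gcm.diag]; norm_num
  -- the bottom `u'` of the string through `u`
  obtain ⟨r, hr⟩ : ∃ r, Nat.find (hfn u) = r + 1 :=
    Nat.exists_eq_succ_of_ne_zero fun h0 => hu0 <| by simpa [h0] using Nat.find_spec (hfn u)
  have h1 : (LieModule.toEnd ℂ (Cur R A D) V F ^ (r + 1)) u = 0 := hr ▸ Nat.find_spec (hfn u)
  have h2 : (LieModule.toEnd ℂ (Cur R A D) V F ^ r) u ≠ 0 := Nat.find_min (hfn u) (by omega)
  set u' := (LieModule.toEnd ℂ (Cur R A D) V F ^ r) u with hu'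
  have hu'mem := elt_f_pow_mem_gr hD hu i 1 r
  rw [add_assoc, ← Pi.single_add, ← hF, ← hu'] at hu'mem
  have hFu' : ⁅F, u'⁆ = 0 := by
    rw [pow_succ', Module.End.mul_apply] at h1; exact h1
  have hwt := (mem_gr hD V).mp hu'mem (R.coroot i)
  rw [sum_root_add_single, hc, hrt, ← hH] at hwt
  have hsum : ∑ j, (m j : ℂ) * R.root j (R.coroot i) = ((∑ j, m j * C i j : ℤ) : ℂ) := by
    push_cast
    exact Finset.sum_congr rfl fun j _ => by rw [R.pairing]
  rw [hsum] at hwt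
  -- `u'` is a lowest weight vector, so that applying `e_i` climbs to the reflected weight
  have h3 := sl2_exists_nat (e := F) (f := E) (h := -⁅E, F⁆) (w := u')
    (μ := -((c : ℂ) - (((∑ j, m j * C i j : ℤ) : ℂ) + ((n + r : ℤ) : ℂ) * 2)))
    (by rw [lie_skew]) (by rw [neg_lie, hH, hElt_lie_elt_e, hrt])
    (by rw [neg_lie, hwt, neg_smul]) hFu' h2 (hen u')
  obtain ⟨d, hd, hd0, -⟩ := h3
  refine hd0 (gr_eq_bot hD htop (i := i) ?_ (elt_e_pow_mem_gr hD hu'mem i 1 d))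
  have hd' : -(c - (∑ j, m j * C i j + (n + r) * 2)) = (d : ℤ) := by exact_mod_cast hd
  simp only [Pi.add_apply, Pi.single_eq_same]
  omega

/-- A module spanned by weight vectors is diagonalisable over `𝔥`. -/
theorem iSup_weightSpace_eq_top
    (htop : ⨆ m : ι → ℕ, gr A hD V χ (fun i => (m i : ℤ)) = ⊤) :
    ⨆ μ : Module.Dual ℂ (cartan R), weightSpace R A D V μ = ⊤ := by
  obtain ⟨s, hs⟩ := LinearMap.exists_rightInverse_of_surjective (toCartan R)
    (LinearMap.range_eq_top.mpr toCartan_surjective)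
  have hs' : ∀ x, toCartan R (s x) = x := LinearMap.congr_fun hs
  rw [eq_top_iff, ← htop]
  refine iSup_le fun m => le_iSup_of_le
    ((χ - ∑ i, ((m i : ℤ) : ℂ) • R.root i).comp s) fun w hw => ⟨fun x => ?_, fun x => ?_⟩
  · have := hw (s x)
    rwa [hElt, LinearMap.comp_apply, LinearMap.comp_apply, hs', cartanLift_cartan'] at this
  · have := hw (s x)
    rwa [hElt, LinearMap.comp_apply, LinearMap.comp_apply, hs', cartanLift_right] at this

/-- In a highest weight module all `e_i` act locally nilpotently. -/
theorem exists_pow_e_eq_zero (htop : ⨆ m : ι → ℕ, gr A hD V χ (fun i => (m i : ℤ)) = ⊤)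
    (i : ι) (w : V) : ∃ n : ℕ,
      ((LieModule.toEnd ℂ (Cur R A D) V (elt R D 1 (e' R i))) ^ n) w = 0 := by
  classical
  have hw : w ∈ ⨆ m : ι → ℕ, gr A hD V χ (fun i => (m i : ℤ)) := htop ▸ Submodule.mem_top
  induction hw using Submodule.iSup_induction' with
  | mem m w hw =>
    refine ⟨m i + 1, gr_eq_bot hD htop (i := i) ?_ (elt_e_pow_mem_gr hD hw i 1 _)⟩
    simp
  | zero => exact ⟨0, by simp⟩
  | add x y _ _ hx hy =>
    obtain ⟨n, hn⟩ := hx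
    obtain ⟨n', hn'⟩ := hy
    refine ⟨n + n', ?_⟩
    rw [map_add, pow_add, Module.End.mul_apply, Module.End.mul_apply, hn', map_zero, add_zero,
      ← Module.End.mul_apply, ← pow_add, add_comm, pow_add, Module.End.mul_apply, hn, map_zero]

end Weights

end KacMoody

/-! ### Universal properties of `M(ψ, I)` and `W(ψ, I)` -/

namespace KacMoody

section Lift

theorem exists_quotient_hom {L M V : Type*} [LieRing L] [LieAlgebra ℂ L] [AddCommGroup M]
    [Module ℂ M] [LieRingModule L M] [LieModule ℂ L M] [AddCommGroup V] [Module ℂ V]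
    [LieRingModule L V] [LieModule ℂ L V] (N : LieSubmodule ℂ L M) (g : M →ₗ⁅ℂ, L⁆ V)
    (h : N ≤ g.ker) :
    ∃ g' : M ⧸ N →ₗ⁅ℂ, L⁆ V, ∀ x, g' (LieSubmodule.Quotient.mk (N := N) x) = g x := by
  refine ⟨{ Submodule.liftQ N.toSubmodule (g : M →ₗ[ℂ] V) h with map_lie' := ?_ }, fun x => rfl⟩
  intro x m
  obtain ⟨m, rfl⟩ := LieSubmodule.Quotient.surjective_mk' N m
  exact LieModuleHom.map_lie g x m

theorem lieSpan_eq_top_of_surjective {L M V : Type*} [LieRing L] [LieAlgebra ℂ L] [AddCommGroup M]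
    [Module ℂ M] [LieRingModule L M] [LieModule ℂ L M] [AddCommGroup V] [Module ℂ V]
    [LieRingModule L V] [LieModule ℂ L V] (g : M →ₗ⁅ℂ, L⁆ V) (hg : Function.Surjective g) {v : M}
    (hv : LieSubmodule.lieSpan ℂ L {v} = ⊤) : LieSubmodule.lieSpan ℂ L {g v} = ⊤ := by
  have : LieSubmodule.lieSpan ℂ L {v} ≤ (LieSubmodule.lieSpan ℂ L {g v}).comap g :=
    LieSubmodule.lieSpan_le.mpr (Set.singleton_subset_iff.mpr
      (LieSubmodule.subset_lieSpan (Set.mem_singleton _)))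
  rw [hv] at this
  rw [eq_top_iff]
  rintro w -
  obtain ⟨w, rfl⟩ := hg w
  exact this (LieSubmodule.mem_top w)

variable {ι : Type*} [Fintype ι] {C : Matrix ι ι ℤ} {H : Type*} [AddCommGroup H] [Module ℂ H]
  {R : Realization C H} {A : Type*} [CommRing A] [Algebra ℂ A] {D : LieSubalgebra ℂ (cartan R)}

variable {V : Type*} [AddCommGroup V] [Module ℂ V] [LieRingModule (Cur R A D) V]

/-- The defining relations of the highest weight vector of `M(ψ, I)`. -/
structure IsHWVector (ψ : Module.Dual ℂ (CurCartan R A D)) (I : Ideal A) (v : V) : Prop where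
  raise : ∀ (m : ι → ℕ) (x : derived R) (a : A), m ≠ 0 →
    (x : Alg R) ∈ rootSpace R (fun i => (m i : ℤ)) → ⁅elt R D a x, v⁆ = 0
  weight : ∀ h, ⁅curCartanIncl R A D h, v⁆ = ψ h • v
  lower : ∀ (m : ι → ℕ) (x : derived R) (a : A), m ≠ 0 →
    (x : Alg R) ∈ rootSpace R (fun i => -(m i : ℤ)) → a ∈ I ^ expo R ψ m → ⁅elt R D a x, v⁆ = 0

variable {ψ : Module.Dual ℂ (CurCartan R A D)} {I : Ideal A}

theorem IsHWVector.lie_e {v : V} (hv : IsHWVector ψ I v) (i : ι) (a : A) :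
    ⁅elt R D a (e' R i), v⁆ = 0 := by
  classical
  have h := (IsWord.single (g := e R) i)
  exact hv.raise _ (e' R i) a h.ne_zero h.e_mem_rootSpace

theorem IsHWVector.map {V' : Type*} [AddCommGroup V'] [Module ℂ V']
    [LieRingModule (Cur R A D) V'] (g : V →ₗ⁅ℂ, Cur R A D⁆ V')
    {v : V} (hv : IsHWVector ψ I v) : IsHWVector ψ I (g v) where
  raise m x a hm hx := by rw [← LieModuleHom.map_lie, hv.raise m x a hm hx, map_zero]
  weight h := by rw [← LieModuleHom.map_lie, hv.weight, map_smul]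
  lower m x a hm hx ha := by rw [← LieModuleHom.map_lie, hv.lower m x a hm hx ha, map_zero]

variable [LieModule ℂ (Cur R A D) V]

variable (ψ I) in
/-- The highest weight vector of `M(ψ, I)`. -/
noncomputable def hwVec : HWModule R ψ I :=
  LieSubmodule.Quotient.mk (N := hwIdeal R ψ I) (vermaVec R ψ)

variable (ψ I) in
/-- The highest weight vector of `W(ψ, I)`. -/
noncomputable def weylVec : Weyl R ψ I :=
  LieSubmodule.Quotient.mk (N := weylIdeal R ψ I) (hwVec ψ I)

theorem env_lieSpan_one : LieSubmodule.lieSpan ℂ (Cur R A D) {(1 : Env R A D)} = ⊤ := by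
  set N := LieSubmodule.lieSpan ℂ (Cur R A D) {(1 : Env R A D)}
  -- the elements that preserve the submodule by left multiplication form a subalgebra
  let S : Subalgebra ℂ (Env R A D) :=
    { carrier := {u | ∀ w ∈ N, u * w ∈ N}
      mul_mem' := fun {a b} ha hb w hw => by rw [mul_assoc]; exact ha _ (hb _ hw)
      add_mem' := fun {a b} ha hb w hw => by rw [add_mul]; exact add_mem (ha w hw) (hb w hw)
      algebraMap_mem' := fun c w hw => by
        rw [← Algebra.smul_def]; exact N.smul_mem c hw }
  have hS : ∀ x, UniversalEnvelopingAlgebra.ι ℂ x ∈ S := fun x w hw => N.lie_mem (x := x) hw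
  have htop : ∀ u, u ∈ S := by
    let _ : LieRing S := LieRing.ofAssociativeRing
    let _ : LieRing (Env R A D) := LieRing.ofAssociativeRing
    let φ : Cur R A D →ₗ⁅ℂ⁆ S :=
      { toFun := fun x => ⟨UniversalEnvelopingAlgebra.ι ℂ x, hS x⟩
        map_add' := fun x y => Subtype.ext (map_add _ x y)
        map_smul' := fun c x => Subtype.ext (map_smul _ c x)
        map_lie' := fun {x y} => Subtype.ext (LieHom.map_lie _ x y) }
    have : S.val.comp (UniversalEnvelopingAlgebra.lift ℂ φ) = AlgHom.id ℂ _ := by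
      apply UniversalEnvelopingAlgebra.hom_ext
      ext x
      change ((UniversalEnvelopingAlgebra.lift ℂ φ (UniversalEnvelopingAlgebra.ι ℂ x) : S) :
        Env R A D) = UniversalEnvelopingAlgebra.ι ℂ x
      rw [UniversalEnvelopingAlgebra.lift_ι_apply]
      rfl
    intro u
    have h := AlgHom.congr_fun this u
    rw [AlgHom.id_apply] at h
    rw [← h]
    exact (UniversalEnvelopingAlgebra.lift ℂ φ u).2
  rw [eq_top_iff]
  intro u _
  have := htop u 1 (LieSubmodule.subset_lieSpan (Set.mem_singleton _))
  rwa [mul_one] at this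

theorem hwVec_lieSpan : LieSubmodule.lieSpan ℂ (Cur R A D) {hwVec ψ I} = ⊤ :=
  lieSpan_eq_top_of_surjective (LieSubmodule.Quotient.mk' (hwIdeal R ψ I))
    (LieSubmodule.Quotient.surjective_mk' _)
    (lieSpan_eq_top_of_surjective (LieSubmodule.Quotient.mk' (vermaIdeal R ψ))
      (LieSubmodule.Quotient.surjective_mk' _) env_lieSpan_one)

theorem weylVec_lieSpan : LieSubmodule.lieSpan ℂ (Cur R A D) {weylVec ψ I} = ⊤ :=
  lieSpan_eq_top_of_surjective (LieSubmodule.Quotient.mk' (weylIdeal R ψ I))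
    (LieSubmodule.Quotient.surjective_mk' _) hwVec_lieSpan

theorem hwVec_isHWVector : IsHWVector ψ I (hwVec ψ I) := by
  have key : ∀ u : Env R A D, ∀ x : Cur R A D,
      (LieSubmodule.Quotient.mk (N := vermaIdeal R ψ) (UniversalEnvelopingAlgebra.ι ℂ x * u) :
        Verma R ψ) = ⁅x, (LieSubmodule.Quotient.mk (N := vermaIdeal R ψ) u : Verma R ψ)⁆ :=
    fun u x => rfl
  have hraise : ∀ (m : ι → ℕ) (x : derived R) (a : A), m ≠ 0 →
      (x : Alg R) ∈ rootSpace R (fun i => (m i : ℤ)) → ⁅elt R D a x, vermaVec R ψ⁆ = 0 := by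
    intro m x a hm hx
    refine (key 1 _).symm.trans ?_
    rw [mul_one]
    exact LieSubmodule.Quotient.mk_eq_zero'.mpr
      (LieSubmodule.subset_lieSpan (Or.inl ⟨m, x, a, hm, hx, rfl⟩))
  have hcartan : ∀ h, ⁅curCartanIncl R A D h, vermaVec R ψ⁆ = ψ h • vermaVec R ψ := by
    intro h
    refine (key 1 _).symm.trans ?_
    rw [mul_one]
    refine (Submodule.Quotient.eq _).mpr (LieSubmodule.subset_lieSpan (Or.inr ⟨h, ?_⟩))
    rw [Algebra.algebraMap_eq_smul_one]
  let q : Verma R ψ →ₗ⁅ℂ, Cur R A D⁆ HWModule R ψ I := LieSubmodule.Quotient.mk' (hwIdeal R ψ I)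
  refine ⟨fun m x a hm hx => ?_, fun h => ?_, fun m x a hm hx ha => ?_⟩
  · exact (LieModuleHom.map_lie q _ _).symm.trans ((congrArg q (hraise m x a hm hx)).trans
      (map_zero q))
  · exact (LieModuleHom.map_lie q _ _).symm.trans ((congrArg q (hcartan h)).trans
      (map_smul q _ _))
  · exact (LieModuleHom.map_lie q _ _).symm.trans (LieSubmodule.Quotient.mk_eq_zero'.mpr
      (LieSubmodule.subset_lieSpan ⟨m, x, a, hm, hx, ha, rfl⟩))

variable (R A D ψ I) in
/-- The projection from `M(ψ, I)` onto `W(ψ, I)`. -/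
noncomputable def toWeyl : HWModule R ψ I →ₗ⁅ℂ, Cur R A D⁆ Weyl R ψ I :=
  LieSubmodule.Quotient.mk' (weylIdeal R ψ I)

theorem toWeyl_surjective : Function.Surjective (toWeyl R A D ψ I) :=
  LieSubmodule.Quotient.surjective_mk' _

theorem toWeyl_eq_zero {u : HWModule R ψ I} : toWeyl R A D ψ I u = 0 ↔ u ∈ weylIdeal R ψ I :=
  LieSubmodule.Quotient.mk_eq_zero'

theorem weylVec_isHWVector : IsHWVector ψ I (weylVec ψ I) :=
  hwVec_isHWVector.map (toWeyl R A D ψ I)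

/-- The universal property of `M(ψ, I)`. -/
theorem exists_hwModule_hom {v : V} (hv : IsHWVector ψ I v) :
    ∃ g : HWModule R ψ I →ₗ⁅ℂ, Cur R A D⁆ V, g (hwVec ψ I) = v := by
  let _ : LieRing (Module.End ℂ V) := LieRing.ofAssociativeRing
  let F : Env R A D →ₐ[ℂ] Module.End ℂ V :=
    UniversalEnvelopingAlgebra.lift ℂ (LieModule.toEnd ℂ (Cur R A D) V)
  have hF : ∀ x, F (UniversalEnvelopingAlgebra.ι ℂ x) = LieModule.toEnd ℂ (Cur R A D) V x :=
    fun x => UniversalEnvelopingAlgebra.lift_ι_apply ℂ _ x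
  let g₀ : Env R A D →ₗ⁅ℂ, Cur R A D⁆ V :=
    { toFun := fun u => F u v
      map_add' := fun u w => by rw [map_add, LinearMap.add_apply]
      map_smul' := fun c u => by rw [map_smul, LinearMap.smul_apply]; rfl
      map_lie' := fun {x u} => by
        change F (UniversalEnvelopingAlgebra.ι ℂ x * u) v = _
        rw [map_mul, hF]; rfl }
  obtain ⟨g₁, hg₁⟩ := exists_quotient_hom (vermaIdeal R ψ) g₀ (by
    refine LieSubmodule.lieSpan_le.mpr ?_
    rintro u (⟨m, x, a, hm, hx, rfl⟩ | ⟨h, rfl⟩)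
    · change F _ v = 0
      rw [hF]
      exact hv.raise m x a hm hx
    · change F _ v = 0
      rw [map_sub, hF, AlgHom.commutes, LinearMap.sub_apply, LieModule.toEnd_apply_apply,
        hv.weight, Module.algebraMap_end_apply, sub_self])
  have hg₁v : g₁ (vermaVec R ψ) = v := by
    refine (hg₁ 1).trans ?_
    change F 1 v = v
    rw [map_one, Module.End.one_apply]
  obtain ⟨g₂, hg₂⟩ := exists_quotient_hom (hwIdeal R ψ I) g₁ (by
    refine LieSubmodule.lieSpan_le.mpr ?_
    rintro w ⟨m, x, a, hm, hx, ha, rfl⟩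
    refine LieModuleHom.mem_ker.mpr ((LieModuleHom.map_lie g₁ _ _).trans ?_)
    rw [hg₁v]
    exact hv.lower m x a hm hx ha)
  exact ⟨g₂, (hg₂ _).trans hg₁v⟩

theorem toEnd_pow_map {L M V : Type*} [LieRing L] [LieAlgebra ℂ L] [AddCommGroup M]
    [Module ℂ M] [LieRingModule L M] [LieModule ℂ L M] [AddCommGroup V] [Module ℂ V]
    [LieRingModule L V] [LieModule ℂ L V] (g : M →ₗ⁅ℂ, L⁆ V) (x : L) (n : ℕ) (w : M) :
    g ((LieModule.toEnd ℂ L M x ^ n) w) = (LieModule.toEnd ℂ L V x ^ n) (g w) := by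
  induction n with
  | zero => rfl
  | succ n ih =>
    rw [pow_succ', pow_succ', Module.End.mul_apply, Module.End.mul_apply, ← ih,
      LieModule.toEnd_apply_apply, LieModule.toEnd_apply_apply, LieModuleHom.map_lie]

section

variable (hD : IsCompl (cartan' R).toSubmodule D.toSubmodule)
  {lam : Module.Dual ℂ (cartan R)} (hres : RestrictsTo R ψ lam)

include hres in
theorem IsHWVector.iSup_gr_eq_top {v : V} (hv : IsHWVector ψ I v)
    (hspan : LieSubmodule.lieSpan ℂ (Cur R A D) {v} = ⊤) :
    ⨆ m : ι → ℕ, gr A hD V (lam.comp (toCartan R)) (fun i => (m i : ℤ)) = ⊤ :=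
  KacMoody.iSup_gr_eq_top hD hspan hv.lie_e hv.weight fun _ => apply_cartanLift hD hres _

include hD hres in
/-- The universal property of `W(ψ, I)`. Only the local nilpotency of the `f_i` has to be assumed: a
highest weight module is `𝔥`-diagonalisable and the `e_i` act locally nilpotently on it. -/
theorem exists_weyl_hom {v : V} (hv : IsHWVector ψ I v)
    (hf : ∀ i (w : V), ∃ n : ℕ,
      ((LieModule.toEnd ℂ (Cur R A D) V (elt R D 1 (f' R i))) ^ n) w = 0) :
    ∃ g : Weyl R ψ I →ₗ⁅ℂ, Cur R A D⁆ V, g (weylVec ψ I) = v := by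
  obtain ⟨g, hg⟩ := exists_hwModule_hom hv
  let q : HWModule R ψ I →ₗ⁅ℂ, Cur R A D⁆ HWModule R ψ I ⧸ g.ker := LieSubmodule.Quotient.mk' g.ker
  have hq : Function.Surjective q := LieSubmodule.Quotient.surjective_mk' _
  have htop := (hwVec_isHWVector.map q).iSup_gr_eq_top hD hres
    (lieSpan_eq_top_of_surjective q hq hwVec_lieSpan)
  have hint : IsIntegrable R A D (HWModule R ψ I ⧸ g.ker) := by
    refine ⟨iSup_weightSpace_eq_top hD htop, exists_pow_e_eq_zero hD htop, fun i w => ?_⟩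
    obtain ⟨w, rfl⟩ := hq w
    obtain ⟨n, hn⟩ := hf i (g w)
    refine ⟨n, ?_⟩
    rw [← toEnd_pow_map] at hn ⊢
    exact LieSubmodule.Quotient.mk_eq_zero'.mpr hn
  obtain ⟨g', hg'⟩ := exists_quotient_hom (weylIdeal R ψ I) g (sInf_le hint)
  exact ⟨g', (hg' _).trans hg⟩

include hres in
theorem weyl_iSup_gr_eq_top :
    ⨆ m : ι → ℕ, gr A hD (Weyl R ψ I) (lam.comp (toCartan R)) (fun i => (m i : ℤ)) = ⊤ :=
  weylVec_isHWVector.iSup_gr_eq_top hD hres weylVec_lieSpan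

include hD hres in
/-- The module `W(ψ, I)` is integrable: since the lengths of the strings of weights are bounded
independently of the integrable quotient of `M(ψ, I)`, a long enough string is killed in all of
them. -/
theorem weyl_f_nilpotent (hdom : IsDominantIntegral R lam) (i : ι) (w : Weyl R ψ I) :
    ∃ n : ℕ, ((LieModule.toEnd ℂ (Cur R A D) (Weyl R ψ I) (elt R D 1 (f' R i))) ^ n) w = 0 := by
  classical
  obtain ⟨w, rfl⟩ := toWeyl_surjective w
  have hw : w ∈ ⨆ m : ι → ℕ, gr A hD (HWModule R ψ I) (lam.comp (toCartan R))
      (fun i => (m i : ℤ)) :=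
    hwVec_isHWVector.iSup_gr_eq_top hD hres hwVec_lieSpan ▸ Submodule.mem_top
  obtain ⟨c, hc⟩ := hdom i
  induction hw using Submodule.iSup_induction' with
  | mem m w hw =>
    obtain ⟨n, hn⟩ : ∃ n : ℕ, (m i : ℤ) + c - ∑ j, (m j : ℤ) * C i j < n :=
      ⟨((m i : ℤ) + c - ∑ j, (m j : ℤ) * C i j + 1).toNat, by omega⟩
    refine ⟨n, ?_⟩
    rw [← toEnd_pow_map, toWeyl_eq_zero]
    rw [weylIdeal, ← SetLike.mem_coe, LieSubmodule.coe_sInf, Set.mem_iInter₂]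
    intro N hN
    let q : HWModule R ψ I →ₗ⁅ℂ, Cur R A D⁆ HWModule R ψ I ⧸ N := LieSubmodule.Quotient.mk' N
    have hq : Function.Surjective q := LieSubmodule.Quotient.surjective_mk' _
    have htop := (hwVec_isHWVector.map q).iSup_gr_eq_top hD hres
      (lieSpan_eq_top_of_surjective q hq hwVec_lieSpan)
    exact LieSubmodule.Quotient.mk_eq_zero'.mp (gr_string_eq_bot hD htop i (hN.e_nilpotent i)
      (hN.f_nilpotent i) (c := c) (by simpa [toCartan_coroot] using hc) hn
      (map_mem_gr hD q (elt_f_pow_mem_gr hD hw i 1 n)))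
  | zero => exact ⟨0, by simp⟩
  | add x y _ _ hx hy =>
    obtain ⟨n, hn⟩ := hx
    obtain ⟨n', hn'⟩ := hy
    refine ⟨n + n', ?_⟩
    rw [map_add, map_add, pow_add, Module.End.mul_apply, Module.End.mul_apply, hn', map_zero,
      add_zero, ← Module.End.mul_apply, ← pow_add, add_comm, pow_add, Module.End.mul_apply, hn,
      map_zero]

include hres in
open scoped Classical in
/-- Long strings of weights of `W(ψ, I)` vanish. -/
theorem weyl_gr_string_eq_bot (hdom : IsDominantIntegral R lam) (i : ι) (m : ι → ℤ) :
    ∃ n₀ : ℕ, ∀ n : ℕ, n₀ ≤ n → ∀ w ∈ gr A hD (Weyl R ψ I) (lam.comp (toCartan R))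
      (m + Pi.single i (n : ℤ)), w = 0 := by
  obtain ⟨c, hc⟩ := hdom i
  refine ⟨((m i : ℤ) + c - ∑ j, (m j : ℤ) * C i j + 1).toNat, fun n hn w hw => ?_⟩
  have htop := weyl_iSup_gr_eq_top (I := I) hD hres
  exact gr_string_eq_bot hD htop i (exists_pow_e_eq_zero hD htop i)
    (weyl_f_nilpotent hD hres hdom i) (c := c) (by simpa [toCartan_coroot] using hc)
    (by omega) hw

end

end Lift

end KacMoody

/-! ### The relations of a highest weight vector in an integrable module -/

namespace KacMoody

section Garland

variable {ι : Type*} [Fintype ι] {C : Matrix ι ι ℤ} {H : Type*} [AddCommGroup H] [Module ℂ H]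
  {R : Realization C H} {A : Type*} [CommRing A] [Algebra ℂ A] {D : LieSubalgebra ℂ (cartan R)}

theorem coroot'_lie_f' (i : ι) : ⁅cartan'Incl R (coroot' R i), f' R i⁆ = (-2 : ℂ) • f' R i := by
  refine derived_ext ?_
  change ⁅cartanMap R (R.coroot i), f R i⁆ = (-2 : ℂ) • f R i
  rw [cartanMap_f, R.pairing, R.gcm.diag, neg_smul]
  norm_num

theorem coroot_lie_elt_f (i : ι) (a b : A) :
    ⁅curCartanIncl R A D (a ⊗ₜ coroot' R i, 0), elt R D b (f' R i)⁆ =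
      (-2 : ℂ) • elt R D (a * b) (f' R i) := by
  rw [curCartanIncl_tmul, lie_elt, coroot'_lie_f', elt_smul]

variable {V : Type*} [AddCommGroup V] [LieRingModule (Cur R A D) V]
  {ψ : Module.Dual ℂ (CurCartan R A D)} {I : Ideal A} {v : V}

/-- The vector `(f_i ⊗ b₁) ⋯ (f_i ⊗ bᵣ) v`. -/
noncomputable def fList (D : LieSubalgebra ℂ (cartan R)) [LieRingModule (Cur R A D) V] (i : ι)
    (v : V) (l : List A) : V :=
  l.foldr (fun b w => ⁅elt R D b (f' R i), w⁆) v

theorem fList_cons (i : ι) (v : V) (b : A) (l : List A) :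
    fList D i v (b :: l) = ⁅elt R D b (f' R i), fList D i v l⁆ := rfl

theorem lie_sum_fList (i : ι) (b : A) (ls : List (List A)) :
    ⁅elt R D b (f' R i), (ls.map (fList D i v)).sum⁆ =
      ((ls.map (List.cons b)).map (fList D i v)).sum := by
  induction ls with
  | nil => simp
  | cons l ls ih => simp only [List.map_cons, List.sum_cons, lie_add, ih, fList_cons]

/-- The vector `(e_i ⊗ aₛ) ⋯ (e_i ⊗ a₁) w`. -/
noncomputable def eList (D : LieSubalgebra ℂ (cartan R)) [LieRingModule (Cur R A D) V] (i : ι)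
    (l : List A) (w : V) : V :=
  l.foldl (fun w a => ⁅elt R D a (e' R i), w⁆) w

theorem eList_cons (i : ι) (a : A) (l : List A) (w : V) :
    eList D i (a :: l) w = eList D i l ⁅elt R D a (e' R i), w⁆ := rfl

theorem eList_add (i : ι) (l : List A) (w w' : V) :
    eList D i l (w + w') = eList D i l w + eList D i l w' := by
  induction l generalizing w w' with
  | nil => rfl
  | cons a l ih => rw [eList_cons, lie_add, ih]; rfl

/-- The relations for simple roots imply those for all roots, as `N_{λ, β}` is additive in `β`. -/
theorem word_lie_eq_zero (hf : ∀ i, ∀ a ∈ I ^ wt R ψ i, ⁅elt R D a (f' R i), v⁆ = 0)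
    {m : ι → ℕ} {y : derived R} (hy : IsWord (f' R) m y) :
    ∀ a ∈ I ^ expo R ψ m, ⁅elt R D a y, v⁆ = 0 := by
  classical
  induction hy with
  | single i =>
    have : expo R ψ (Pi.single i 1) = wt R ψ i := by
      rw [expo, Finset.sum_eq_single i]
      · simp
      · intro j _ hj; simp [hj]
      · simp
    rw [this]
    exact hf i
  | @lie i m y hy ih =>
    have : expo R ψ (m + Pi.single i 1) = wt R ψ i + expo R ψ m := by
      rw [add_comm, expo, expo]
      simp only [Pi.add_apply, add_mul, Finset.sum_add_distrib]
      congr 1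
      rw [Finset.sum_eq_single i]
      · simp
      · intro j _ hj; simp [hj]
      · simp
    rw [this, pow_add]
    intro a ha
    induction ha using Submodule.mul_induction_on' with
    | mem_mul_mem x hx z hz =>
      rw [← lie_elt, lie_lie, ih z hz, hf i x hx, lie_zero, lie_zero, sub_zero]
    | add x hx y hy hx' hy' => rw [elt_add_left, add_lie, hx', hy', add_zero]

variable [Module ℂ V] [LieModule ℂ (Cur R A D) V]

/-- Moving `α_i^∨ ⊗ c` with `c ∈ I` through `(f_i ⊗ b₁) ⋯ (f_i ⊗ bᵣ)` to `v`, where it vanishes,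
gives `-2` times the sum of the `r` products in which one `b_j` is replaced by `c b_j`. -/
theorem coroot_lie_fList (hh : ∀ h, ⁅curCartanIncl R A D h, v⁆ = ψ h • v)
    (hvan : VanishesOn R ψ I) (i : ι) {c : A} (hc : c ∈ I) (l : List A) :
    ∃ ls : List (List A), ls.length = l.length ∧
      (∀ l' ∈ ls, l'.length = l.length ∧ l'.prod = c * l.prod) ∧
      ⁅curCartanIncl R A D (c ⊗ₜ coroot' R i, 0), fList D i v l⁆ =
        (-2 : ℂ) • (ls.map (fList D i v)).sum := by
  induction l with
  | nil =>
    refine ⟨[], rfl, by simp, ?_⟩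
    simp [fList, hh, hvan c hc]
  | cons b l ih =>
    obtain ⟨ls, hlen, hls, h⟩ := ih
    refine ⟨(c * b :: l) :: ls.map (List.cons b), by simp [hlen], ?_, ?_⟩
    · intro l' hl'
      rcases List.mem_cons.mp hl' with rfl | hl'
      · simp [mul_assoc]
      · obtain ⟨l'', hl'', rfl⟩ := List.mem_map.mp hl'
        refine ⟨by simp [(hls l'' hl'').1], ?_⟩
        rw [List.prod_cons, List.prod_cons, (hls l'' hl'').2]
        ring
    · rw [fList_cons, leibniz_lie, h, coroot_lie_elt_f, smul_lie, lie_smul, lie_sum_fList,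
        List.map_cons, List.sum_cons, smul_add, fList_cons]

/-- Applying `e_i ⊗ a` with `a ∈ I` to `(f_i ⊗ b₁) ⋯ (f_i ⊗ bᵣ) v` gives `-2` times a sum of at
least `r - 1` products of the same form with one factor less. -/
theorem e_lie_fList (he : ∀ i (a : A), ⁅elt R D a (e' R i), v⁆ = 0)
    (hh : ∀ h, ⁅curCartanIncl R A D h, v⁆ = ψ h • v)
    (hvan : VanishesOn R ψ I) (i : ι) {a : A} (ha : a ∈ I) (l : List A) :
    ∃ ls : List (List A), l.length ≤ ls.length + 1 ∧
      (∀ l' ∈ ls, l'.length + 1 = l.length ∧ l'.prod = a * l.prod) ∧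
      ⁅elt R D a (e' R i), fList D i v l⁆ = (-2 : ℂ) • (ls.map (fList D i v)).sum := by
  induction l with
  | nil =>
    refine ⟨[], by simp, by simp, ?_⟩
    simp [fList, he]
  | cons b l ih =>
    obtain ⟨ls, hlen, hls, h⟩ := ih
    obtain ⟨ls', hlen', hls', h'⟩ :=
      coroot_lie_fList hh hvan i (I.mul_mem_right b ha) l
    refine ⟨ls' ++ ls.map (List.cons b), by simp [hlen'], ?_, ?_⟩
    · intro l' hl'
      rcases List.mem_append.mp hl' with hl' | hl'
      · refine ⟨by simp [(hls' l' hl').1], ?_⟩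
        rw [(hls' l' hl').2, List.prod_cons, mul_assoc]
      · obtain ⟨l'', hl'', rfl⟩ := List.mem_map.mp hl'
        refine ⟨by simp [(hls l'' hl'').1], ?_⟩
        rw [List.prod_cons, List.prod_cons, (hls l'' hl'').2]
        ring
    · rw [fList_cons, leibniz_lie, h, elt_e_lie_elt_f, h', lie_smul, lie_sum_fList,
        List.map_append, List.sum_append, smul_add]

theorem eList_smul (i : ι) (l : List A) (c : ℂ) (w : V) :
    eList D i l (c • w) = c • eList D i l w := by
  induction l generalizing w with
  | nil => rfl
  | cons a l ih => rw [eList_cons, lie_smul, ih]; rfl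

/-- Applying `s` operators `e_i ⊗ a` with `a ∈ I` to a product of `s + 1` operators `f_i ⊗ b`
leaves a single operator `f_i ⊗ c`, where `c` is the product of all the coefficients: as `𝔥' ⊗ I`
annihilates `v`, each `e_i ⊗ a` can only merge two of the factors `f_i ⊗ b`, with the same factor
`-2` each time, so that no cancellation occurs. -/
theorem eList_fList (he : ∀ i (a : A), ⁅elt R D a (e' R i), v⁆ = 0)
    (hh : ∀ h, ⁅curCartanIncl R A D h, v⁆ = ψ h • v)
    (hvan : VanishesOn R ψ I) (i : ι) (as : List A) (has : ∀ a ∈ as, a ∈ I) (l : List A)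
    (hl : l.length = as.length + 1) :
    ∃ c : ℕ, 0 < c ∧ eList D i as (fList D i v l) =
      ((-2 : ℂ) ^ as.length * c) • ⁅elt R D (as.prod * l.prod) (f' R i), v⁆ := by
  induction as generalizing l with
  | nil =>
    obtain ⟨b, rfl⟩ := List.length_eq_one_iff.mp hl
    exact ⟨1, one_pos, by simp [eList, fList]⟩
  | cons a as ih =>
    obtain ⟨ls, hlen, hls, h⟩ := e_lie_fList he hh hvan i (has a (by simp)) l
    have key : ∀ ls : List (List A),
        (∀ l' ∈ ls, l'.length + 1 = l.length ∧ l'.prod = a * l.prod) →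
        ∃ c : ℕ, ls.length ≤ c ∧ eList D i as (ls.map (fList D i v)).sum =
          ((-2 : ℂ) ^ as.length * c) • ⁅elt R D ((a :: as).prod * l.prod) (f' R i), v⁆ := by
      intro ls
      induction ls with
      | nil =>
        intro _
        refine ⟨0, le_rfl, ?_⟩
        have := eList_smul (D := D) (V := V) i as 0 0
        simpa using this
      | cons l' ls ih' =>
        intro hls
        obtain ⟨c, hc, h1⟩ := ih' fun l'' hl'' => hls l'' (List.mem_cons_of_mem _ hl'')
        obtain ⟨hl1, hl2⟩ := hls l' (by simp)
        obtain ⟨c', hc', h2⟩ := ih (fun a ha => has a (List.mem_cons_of_mem _ ha)) l' (by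
          rw [hl] at hl1; simpa using hl1)
        refine ⟨c' + c, by simp only [List.length_cons]; omega, ?_⟩
        have hprod : as.prod * l'.prod = (a :: as).prod * l.prod := by
          rw [hl2, List.prod_cons]; ring
        rw [List.map_cons, List.sum_cons, eList_add, h1, h2, hprod, ← add_smul]
        congr 1
        push_cast
        ring
    obtain ⟨c, hc, h1⟩ := key ls hls
    refine ⟨c, by simp only [List.length_cons] at hl; omega, ?_⟩
    rw [eList_cons, h, eList_smul, h1, smul_smul, List.length_cons]
    congr 1
    ring

/-- The annihilator of the highest weight vector among the `f_i ⊗ a` is an ideal. -/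
theorem elt_mul_f_lie_eq_zero (hh : ∀ h, ⁅curCartanIncl R A D h, v⁆ = ψ h • v) (i : ι) (a b : A)
    (hb : ⁅elt R D b (f' R i), v⁆ = 0) : ⁅elt R D (a * b) (f' R i), v⁆ = 0 := by
  have h1 : ⁅curCartanIncl R A D (a ⊗ₜ coroot' R i, 0), ⁅elt R D b (f' R i), v⁆⁆ = 0 := by
    rw [hb, lie_zero]
  rw [leibniz_lie, hh, lie_smul, hb, smul_zero, add_zero, coroot_lie_elt_f, smul_lie] at h1
  exact (smul_eq_zero.mp h1).resolve_left (by norm_num)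

theorem wt_eq {lam : Module.Dual ℂ (cartan R)} (hres : RestrictsTo R ψ lam)
    (hdom : IsDominantIntegral R lam) (i : ι) :
    ψ ((1 : A) ⊗ₜ[ℂ] coroot' R i, 0) = wt R ψ i := by
  obtain ⟨n, hn⟩ := hdom i
  have : ψ ((1 : A) ⊗ₜ[ℂ] coroot' R i, 0) = n := (hres.1 _).trans hn
  rw [wt, this]
  simp

/-- With `n = λ(α_i^∨)`, representation theory of `sl₂` gives `(f_i ⊗ 1)ⁿ⁺¹ v = 0`. Applying
operators `e_i ⊗ a_1, …, e_i ⊗ a_n` with `a_j ∈ I` gives `(f_i ⊗ a_1 ⋯ a_n) v = 0`. -/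
theorem f_lie_eq_zero_of_mem_pow {lam : Module.Dual ℂ (cartan R)} (hres : RestrictsTo R ψ lam)
    (hdom : IsDominantIntegral R lam) (he : ∀ i (a : A), ⁅elt R D a (e' R i), v⁆ = 0)
    (hh : ∀ h, ⁅curCartanIncl R A D h, v⁆ = ψ h • v) (hvan : VanishesOn R ψ I) (i : ι)
    (hf : ∃ n : ℕ, ((LieModule.toEnd ℂ (Cur R A D) V (elt R D 1 (f' R i))) ^ n) v = 0)
    {a : A} (ha : a ∈ I ^ wt R ψ i) : ⁅elt R D a (f' R i), v⁆ = 0 := by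
  by_cases hv : v = 0
  · rw [hv, lie_zero]
  have hH := elt_e_lie_elt_f (R := R) (D := D) i (1 : A) 1
  obtain ⟨r, hr, -, hr0⟩ := sl2_exists_nat (V := V) hH
    (by rw [coroot_lie_elt_f, mul_one, mul_one, neg_smul]) (hh _) (he i 1) hv hf
  rw [mul_one, wt_eq hres hdom, Nat.cast_inj] at hr
  have hfl : fList D i v (List.replicate (wt R ψ i + 1) (1 : A)) = 0 := by
    rw [← hr0, ← hr]
    generalize wt R ψ i + 1 = n
    induction n with
    | zero => rfl
    | succ n ih => rw [List.replicate_succ, fList_cons, ih, pow_succ']; rfl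
  have hprod : ∀ as : List A, as.length = wt R ψ i → (∀ a ∈ as, a ∈ I) →
      ⁅elt R D as.prod (f' R i), v⁆ = 0 := by
    intro as hlen has
    obtain ⟨c, hc, h⟩ := eList_fList he hh hvan i as has (List.replicate (wt R ψ i + 1) (1 : A))
      (by simp [hlen])
    have h0 : eList D i as (0 : V) = 0 := by
      have := eList_smul (D := D) (V := V) i as 0 0
      simpa using this
    rw [hfl, h0, List.prod_replicate, one_pow, mul_one, eq_comm] at h
    refine (smul_eq_zero.mp h).resolve_left (mul_ne_zero (pow_ne_zero _ (by norm_num)) ?_)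
    exact_mod_cast hc.ne'
  have key : ∀ (s : ℕ) (a : A), a ∈ I ^ s → ∀ as : List A, s + as.length = wt R ψ i →
      (∀ a ∈ as, a ∈ I) → ⁅elt R D (a * as.prod) (f' R i), v⁆ = 0 := by
    intro s
    induction s with
    | zero =>
      intro a _ as hlen has
      exact elt_mul_f_lie_eq_zero hh i a _ (hprod as (by simpa using hlen) has)
    | succ s ih =>
      intro a ha
      rw [pow_succ] at ha
      induction ha using Submodule.mul_induction_on' with
      | mem_mul_mem x hx y hy =>
        intro as hlen has
        have := ih x hx (y :: as) (by simp only [List.length_cons]; omega) (by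
          intro a ha
          rcases List.mem_cons.mp ha with rfl | ha
          exacts [hy, has a ha])
        rwa [List.prod_cons, ← mul_assoc] at this
      | add x hx y hy hx' hy' =>
        intro as hlen has
        rw [add_mul, elt_add_left, add_lie, hx' as hlen has, hy' as hlen has, add_zero]
  simpa using key _ a ha [] (by simp) (by simp)

/-- In an integrable module, a highest weight vector on which `𝔥' ⊗ I` acts by zero satisfies the
relations of `M(ψ, I)`. -/
theorem isHWVector_of_nilpotent {lam : Module.Dual ℂ (cartan R)} (hres : RestrictsTo R ψ lam)
    (hdom : IsDominantIntegral R lam) (hvan : VanishesOn R ψ I)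
    (hraise : ∀ (m : ι → ℕ) (x : derived R) (a : A), m ≠ 0 →
      (x : Alg R) ∈ rootSpace R (fun i => (m i : ℤ)) → ⁅elt R D a x, v⁆ = 0)
    (hh : ∀ h, ⁅curCartanIncl R A D h, v⁆ = ψ h • v)
    (hf : ∀ i, ∃ n : ℕ, ((LieModule.toEnd ℂ (Cur R A D) V (elt R D 1 (f' R i))) ^ n) v = 0) :
    IsHWVector ψ I v where
  raise := hraise
  weight := hh
  lower m x a hm hx ha := by
    classical
    have he : ∀ i (a : A), ⁅elt R D a (e' R i), v⁆ = 0 := fun i a =>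
      hraise _ (e' R i) a (IsWord.single (g := e R) i).ne_zero
        (IsWord.single (g := e R) i).e_mem_rootSpace
    have hx' := mem_span_word_of_mem_rootSpace_neg hm hx
    clear hx
    induction hx' using Submodule.span_induction with
    | mem y hy =>
      exact word_lie_eq_zero (fun i a ha =>
        f_lie_eq_zero_of_mem_pow hres hdom he hh hvan i (hf i) ha) hy a ha
    | zero => rw [elt_zero, zero_lie]
    | add y z _ _ hy hz => rw [elt_add, add_lie, hy, hz, add_zero]
    | smul c y _ hy => rw [elt_smul, smul_lie, hy, smul_zero]

end Garland

end KacMoody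

/-! ### Idempotents of the completion acting on locally adic modules -/

namespace KacMoody

section Splitting

open Filter

/-- The value that a sequence eventually takes, and `0` if the sequence is not eventually
constant. -/
noncomputable def eventualValue {V : Type*} [Zero V] (s : ℕ → V) : V :=
  open scoped Classical in
  if h : ∃ w, ∀ᶠ n in atTop, s n = w then h.choose else 0

theorem eventualValue_eq {V : Type*} [Zero V] {s : ℕ → V} {w : V} (h : ∀ᶠ n in atTop, s n = w) :
    eventualValue s = w := by
  have h' : ∃ w, ∀ᶠ n in atTop, s n = w := ⟨w, h⟩
  rw [eventualValue, dif_pos h']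
  obtain ⟨n, h1, h2⟩ := (h'.choose_spec.and h).exists
  exact h1.symm.trans h2

/-- A sequence of elements of `A` that converges to an idempotent in the `I`-adic completion. -/
structure AdicIdem {A : Type*} [CommRing A] (I : Ideal A) where
  /-- the approximations -/
  seq : ℕ → A
  mul_self_sub_mem : ∀ n, seq n * seq n - seq n ∈ I ^ n
  sub_mem : ∀ n m, n ≤ m → seq m - seq n ∈ I ^ n

variable {ι : Type*} [Fintype ι] {C : Matrix ι ι ℤ} {H : Type*} [AddCommGroup H] [Module ℂ H]
  {R : Realization C H} {A : Type*} [CommRing A] [Algebra ℂ A] {D : LieSubalgebra ℂ (cartan R)}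

variable {V : Type*} [AddCommGroup V] [LieRingModule (Cur R A D) V]

variable (R D V) in
/-- Every vector of `V` is annihilated by `X ⊗ Iᴺ` for each `X` and some `N` depending on `X`. -/
def IsLocallyAdic (I : Ideal A) : Prop :=
  ∀ (x : A ⊗[ℂ] derived R) (w : V), ∃ N : ℕ, ∀ a ∈ I ^ N, ⁅curInl R A D (a • x), w⁆ = 0

variable {I : Ideal A} {ψ : Module.Dual ℂ (CurCartan R A D)} {v : V}

theorem isLocallyAdic_of_elt
    (h : ∀ (x : derived R) (w : V), ∃ N : ℕ, ∀ a ∈ I ^ N, ⁅elt R D a x, w⁆ = 0) :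
    IsLocallyAdic R D V I := by
  intro x w
  induction x using TensorProduct.induction_on with
  | zero => exact ⟨0, fun a _ => by rw [smul_zero, map_zero, zero_lie]⟩
  | tmul c x =>
    obtain ⟨N, hN⟩ := h x w
    refine ⟨N, fun a ha => ?_⟩
    rw [TensorProduct.smul_tmul', ← elt_eq]
    exact hN _ (Ideal.mul_mem_right _ _ ha)
  | add x y hx hy =>
    obtain ⟨N, hN⟩ := hx
    obtain ⟨N', hN'⟩ := hy
    refine ⟨max N N', fun a ha => ?_⟩
    rw [smul_add, map_add, add_lie, hN a (Ideal.pow_le_pow_right (le_max_left _ _) ha),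
      hN' a (Ideal.pow_le_pow_right (le_max_right _ _) ha), add_zero]

theorem IsLocallyAdic.eventually (hV : IsLocallyAdic R D V I) (x : A ⊗[ℂ] derived R) (w : V) :
    ∀ᶠ n in atTop, ∀ a ∈ I ^ n, ⁅curInl R A D (a • x), w⁆ = 0 := by
  obtain ⟨N, hN⟩ := hV x w
  filter_upwards [eventually_ge_atTop N] with n hn a ha
  exact hN a (Ideal.pow_le_pow_right hn ha)

theorem IsLocallyAdic.exists_eventually (hV : IsLocallyAdic R D V I) (ε : AdicIdem I)
    (x : A ⊗[ℂ] derived R) (w : V) :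
    ∃ w', ∀ᶠ n in atTop, ⁅curInl R A D (ε.seq n • x), w⁆ = w' := by
  obtain ⟨N, hN⟩ := hV x w
  refine ⟨⁅curInl R A D (ε.seq N • x), w⁆, ?_⟩
  filter_upwards [eventually_ge_atTop N] with n hn
  rw [← sub_eq_zero, ← sub_lie, ← map_sub, ← sub_smul]
  exact hN _ (ε.sub_mem N n hn)

variable (R D) in
/-- The operator `X ⊗ a ε` on a locally `I`-adic module, for an idempotent `ε` of the `I`-adic
completion of `A`. -/
noncomputable def idemAct (ε : AdicIdem I) (x : A ⊗[ℂ] derived R) (w : V) : V :=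
  eventualValue fun n => ⁅curInl R A D (ε.seq n • x), w⁆

theorem idemAct_eq {ε : AdicIdem I} {x : A ⊗[ℂ] derived R} {w w' : V}
    (h : ∀ᶠ n in atTop, ⁅curInl R A D (ε.seq n • x), w⁆ = w') : idemAct R D ε x w = w' :=
  eventualValue_eq h

theorem IsLocallyAdic.idemAct_spec (hV : IsLocallyAdic R D V I) (ε : AdicIdem I)
    (x : A ⊗[ℂ] derived R) (w : V) :
    ∀ᶠ n in atTop, ⁅curInl R A D (ε.seq n • x), w⁆ = idemAct R D ε x w := by
  obtain ⟨w', h⟩ := hV.exists_eventually ε x w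
  rwa [idemAct_eq h]

theorem IsLocallyAdic.exists_idemAct_eq (hV : IsLocallyAdic R D V I) (ε : AdicIdem I) (a : A)
    (x : derived R) (w : V) :
    ∃ n, idemAct R D ε (a ⊗ₜ x) w = ⁅elt R D (ε.seq n * a) x, w⁆ := by
  obtain ⟨n, hn⟩ := (hV.idemAct_spec ε (a ⊗ₜ x) w).exists
  exact ⟨n, hn.symm⟩

section

variable (hV : IsLocallyAdic R D V I) (ε : AdicIdem I)
include hV

theorem idemAct_add_left (x y : A ⊗[ℂ] derived R) (w : V) :
    idemAct R D ε (x + y) w = idemAct R D ε x w + idemAct R D ε y w := by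
  refine idemAct_eq ?_
  filter_upwards [hV.idemAct_spec ε x w, hV.idemAct_spec ε y w] with n h1 h2
  rw [smul_add, map_add, add_lie, h1, h2]

theorem idemAct_add_right (x : A ⊗[ℂ] derived R) (w w' : V) :
    idemAct R D ε x (w + w') = idemAct R D ε x w + idemAct R D ε x w' := by
  refine idemAct_eq ?_
  filter_upwards [hV.idemAct_spec ε x w, hV.idemAct_spec ε x w'] with n h1 h2
  rw [lie_add, h1, h2]

/-- As `ε` is idempotent, `X ⊗ a ↦ X ⊗ a ε` is an action. -/
theorem idemAct_lie (x y : A ⊗[ℂ] derived R) (w : V) :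
    idemAct R D ε x (idemAct R D ε y w) =
      idemAct R D ε ⁅x, y⁆ w + idemAct R D ε y (idemAct R D ε x w) := by
  refine idemAct_eq ?_
  filter_upwards [hV.idemAct_spec ε x w, hV.idemAct_spec ε y w,
    hV.idemAct_spec ε x (idemAct R D ε y w), hV.idemAct_spec ε y (idemAct R D ε x w),
    hV.idemAct_spec ε ⁅x, y⁆ w, hV.eventually ⁅x, y⁆ w] with n h1 h2 h3 h4 h5 h6
  rw [← h4, ← h1, ← h2, leibniz_lie, ← LieHom.map_lie, smul_lie, lie_smul, smul_smul,
    ← h5, add_left_inj, ← sub_eq_zero, ← sub_lie, ← map_sub, ← sub_smul]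
  exact h6 _ (ε.mul_self_sub_mem n)

/-- The actions modified by orthogonal idempotents commute. -/
theorem idemAct_comm {ε ε' : AdicIdem I} (hε : ∀ n, ε.seq n * ε'.seq n ∈ I ^ n)
    (x y : A ⊗[ℂ] derived R) (w : V) :
    idemAct R D ε x (idemAct R D ε' y w) = idemAct R D ε' y (idemAct R D ε x w) := by
  refine idemAct_eq ?_
  filter_upwards [hV.idemAct_spec ε x w, hV.idemAct_spec ε' y w,
    hV.idemAct_spec ε' y (idemAct R D ε x w), hV.eventually ⁅x, y⁆ w] with n h1 h2 h3 h4
  rw [← h3, ← h1, ← h2, leibniz_lie, ← LieHom.map_lie, smul_lie, lie_smul, smul_smul,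
    h4 _ (hε n), zero_add]

theorem inr_lie_idemAct (d : D) (x : A ⊗[ℂ] derived R) (w : V) :
    ⁅curInr R A D d, idemAct R D ε x w⁆ =
      idemAct R D ε (curAct R A D d x) w + idemAct R D ε x ⁅curInr R A D d, w⁆ := by
  obtain ⟨n, h1, h2, h3⟩ := ((hV.idemAct_spec ε x w).and
    ((hV.idemAct_spec ε (curAct R A D d x) w).and
      (hV.idemAct_spec ε x ⁅curInr R A D d, w⁆))).exists
  rw [← h1, ← h2, ← h3, leibniz_lie, inr_lie_inl, curAct_smul]

theorem sum_idemAct {κ : Type*} [Fintype κ] (ε : κ → AdicIdem I)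
    (hε : ∀ n, 1 - ∑ k, (ε k).seq n ∈ I ^ n) (x : A ⊗[ℂ] derived R) (w : V) :
    ∑ k, idemAct R D (ε k) x w = ⁅curInl R A D x, w⁆ := by
  obtain ⟨n, h1, h2⟩ := ((eventually_all.mpr fun k => hV.idemAct_spec (ε k) x w).and
    (hV.eventually x w)).exists
  have h3 := h2 _ (hε n)
  rw [sub_smul, one_smul, map_sub, sub_lie, sub_eq_zero, Finset.sum_smul, map_sum,
    sum_lie] at h3
  rw [h3]
  exact (Finset.sum_congr rfl fun k _ => h1 k).symm

end

variable [Module ℂ V]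

/-- The module `V` with `X ⊗ a` acting as `X ⊗ a ε` and with the action of `𝔥''` shifted by `-ν`. -/
@[nolint unusedArguments]
def SplitModule (_ : IsLocallyAdic R D V I) (_ : AdicIdem I) (_ : Module.Dual ℂ D) : Type _ := V

section

variable (hV : IsLocallyAdic R D V I) (ε : AdicIdem I) (ν : Module.Dual ℂ D)

instance : AddCommGroup (SplitModule hV ε ν) := inferInstanceAs (AddCommGroup V)
instance : Module ℂ (SplitModule hV ε ν) := inferInstanceAs (Module ℂ V)

/-- A vector of `V`, as a vector of the module with the modified action. -/
def toSplit : V ≃ₗ[ℂ] SplitModule hV ε ν := LinearEquiv.refl ℂ V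

theorem lie_eq_zero_right (d d' : D) : ⁅d, d'⁆ = 0 := by
  obtain ⟨⟨_, y, rfl⟩, hd⟩ := d
  obtain ⟨⟨_, y', rfl⟩, hd'⟩ := d'
  exact Subtype.ext (Subtype.ext (cartanMap_lie R y y'))

variable (R D) in
/-- The modified action of an element of `𝔤̃`. -/
noncomputable def splitAct (ε : AdicIdem I) (ν : Module.Dual ℂ D) (z : Cur R A D) (w : V) : V :=
  idemAct R D ε z.left w + (⁅curInr R A D z.right, w⁆ - ν z.right • w)

include hV

theorem splitAct_add_left (z z' : Cur R A D) (w : V) :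
    splitAct R D ε ν (z + z') w = splitAct R D ε ν z w + splitAct R D ε ν z' w := by
  change idemAct R D ε (z.left + z'.left) w +
    (⁅curInr R A D (z.right + z'.right), w⁆ - ν (z.right + z'.right) • w) = _
  rw [idemAct_add_left hV, map_add, map_add, add_lie, add_smul, splitAct, splitAct]
  abel

theorem splitAct_add_right (z : Cur R A D) (w w' : V) :
    splitAct R D ε ν z (w + w') = splitAct R D ε ν z w + splitAct R D ε ν z w' := by
  rw [splitAct, splitAct, splitAct, idemAct_add_right hV, lie_add, smul_add]
  abel

end

variable [LieModule ℂ (Cur R A D) V]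

/-- A module generated by a highest weight vector of `M(ψ, I)` is locally `I`-adic. -/
theorem IsHWVector.isLocallyAdic (hv : IsHWVector ψ I v)
    (hspan : LieSubmodule.lieSpan ℂ (Cur R A D) {v} = ⊤) (hvan : VanishesOn R ψ I) :
    IsLocallyAdic R D V I := by
  refine isLocallyAdic_of_elt ?_
  have hmono : ∀ {N N' : ℕ} {a : A}, N ≤ N' → a ∈ I ^ N' → a ∈ I ^ N :=
    fun h ha => Ideal.pow_le_pow_right h ha
  let P : Submodule ℂ V :=
    { carrier := {w | ∀ x : derived R, ∃ N : ℕ, ∀ a ∈ I ^ N, ⁅elt R D a x, w⁆ = 0}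
      add_mem' := fun {w w'} hw hw' x => by
        obtain ⟨N, hN⟩ := hw x
        obtain ⟨N', hN'⟩ := hw' x
        refine ⟨max N N', fun a ha => ?_⟩
        rw [lie_add, hN a (hmono (le_max_left _ _) ha), hN' a (hmono (le_max_right _ _) ha),
          add_zero]
      zero_mem' := fun x => ⟨0, fun a _ => lie_zero _⟩
      smul_mem' := fun c w hw x => by
        obtain ⟨N, hN⟩ := hw x
        exact ⟨N, fun a ha => by rw [lie_smul, hN a ha, smul_zero]⟩ }
  suffices hP : P = ⊤ from fun x w => (hP ▸ Submodule.mem_top : w ∈ P) x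
  refine highestWeight_induction hspan hv.lie_e hv.weight P ?_ ?_
  · let Q : Submodule ℂ (derived R) :=
      { carrier := {x | ∃ N : ℕ, ∀ a ∈ I ^ N, ⁅elt R D a x, v⁆ = 0}
        add_mem' := fun {x y} hx hy => by
          obtain ⟨N, hN⟩ := hx
          obtain ⟨N', hN'⟩ := hy
          refine ⟨max N N', fun a ha => ?_⟩
          rw [elt_add, add_lie, hN a (hmono (le_max_left _ _) ha),
            hN' a (hmono (le_max_right _ _) ha), add_zero]
        zero_mem' := ⟨0, fun a _ => by rw [elt_zero, zero_lie]⟩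
        smul_mem' := fun c x hx => by
          obtain ⟨N, hN⟩ := hx
          exact ⟨N, fun a ha => by rw [elt_smul, smul_lie, hN a ha, smul_zero]⟩ }
    have hQ : Q = ⊤ := by
      refine derived_eq_top Q (fun m y hy => ?_) (fun x => ?_) (fun m y hy => ?_)
      · exact ⟨_, fun a ha => hv.lower m y a hy.ne_zero
          (IsWord.coe_derived R (g := f R) (fun _ => rfl) hy).f_mem_rootSpace ha⟩
      · refine ⟨1, fun a ha => ?_⟩
        rw [← curCartanIncl_tmul, hv.weight, hvan a (by rwa [pow_one] at ha), zero_smul]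
      · exact ⟨0, fun a _ => hv.raise m y a hy.ne_zero
          (IsWord.coe_derived R (g := e R) (fun _ => rfl) hy).e_mem_rootSpace⟩
    exact fun x => (hQ ▸ Submodule.mem_top : x ∈ Q)
  · intro i b w hw x
    obtain ⟨N, hN⟩ := hw x
    obtain ⟨N', hN'⟩ := hw ⁅x, f' R i⁆
    refine ⟨max N N', fun a ha => ?_⟩
    rw [leibniz_lie, lie_elt, hN a (hmono (le_max_left _ _) ha),
      hN' _ (Ideal.mul_mem_right _ _ (hmono (le_max_right _ _) ha)), lie_zero, add_zero]

section

variable (hV : IsLocallyAdic R D V I) (ε : AdicIdem I)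
include hV

theorem idemAct_smul_left (c : ℂ) (x : A ⊗[ℂ] derived R) (w : V) :
    idemAct R D ε (c • x) w = c • idemAct R D ε x w := by
  refine idemAct_eq ?_
  filter_upwards [hV.idemAct_spec ε x w] with n h1
  rw [smul_comm, map_smul, smul_lie, h1]

theorem idemAct_smul_right (c : ℂ) (x : A ⊗[ℂ] derived R) (w : V) :
    idemAct R D ε x (c • w) = c • idemAct R D ε x w := by
  refine idemAct_eq ?_
  filter_upwards [hV.idemAct_spec ε x w] with n h1
  rw [lie_smul, h1]

end

section

variable (hV : IsLocallyAdic R D V I) (ε : AdicIdem I) (ν : Module.Dual ℂ D)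
include hV

theorem splitAct_smul_left (c : ℂ) (z : Cur R A D) (w : V) :
    splitAct R D ε ν (c • z) w = c • splitAct R D ε ν z w := by
  change idemAct R D ε (c • z.left) w +
    (⁅curInr R A D (c • z.right), w⁆ - ν (c • z.right) • w) = _
  rw [idemAct_smul_left hV, map_smul, map_smul, smul_lie, splitAct, smul_add, smul_sub, smul_assoc]

theorem splitAct_smul_right (c : ℂ) (z : Cur R A D) (w : V) :
    splitAct R D ε ν z (c • w) = c • splitAct R D ε ν z w := by
  rw [splitAct, splitAct, idemAct_smul_right hV, lie_smul, smul_add, smul_sub,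
    smul_comm c (ν z.right)]

theorem splitAct_lie (z z' : Cur R A D) (w : V) :
    splitAct R D ε ν z (splitAct R D ε ν z' w) =
      splitAct R D ε ν ⁅z, z'⁆ w + splitAct R D ε ν z' (splitAct R D ε ν z w) := by
  obtain ⟨x, d⟩ := z
  obtain ⟨y, d'⟩ := z'
  have hneg : ∀ (x : A ⊗[ℂ] derived R) (w : V), idemAct R D ε (-x) w = -idemAct R D ε x w :=
    fun x w => by rw [← neg_one_smul ℂ x, idemAct_smul_left hV, neg_one_smul]
  have hneg' : ∀ (x : A ⊗[ℂ] derived R) (w : V), idemAct R D ε x (-w) = -idemAct R D ε x w :=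
    fun x w => by rw [← neg_one_smul ℂ w, idemAct_smul_right hV, neg_one_smul]
  have hcomm : ⁅curInr R A D d, ⁅curInr R A D d', w⁆⁆ = ⁅curInr R A D d', ⁅curInr R A D d, w⁆⁆ := by
    rw [leibniz_lie, ← LieHom.map_lie, lie_eq_zero_right, map_zero, zero_lie, zero_add]
  change idemAct R D ε x (idemAct R D ε y w + (⁅curInr R A D d', w⁆ - ν d' • w))
      + (⁅curInr R A D d, idemAct R D ε y w + (⁅curInr R A D d', w⁆ - ν d' • w)⁆
        - ν d • (idemAct R D ε y w + (⁅curInr R A D d', w⁆ - ν d' • w))) =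
    (idemAct R D ε (⁅x, y⁆ + curAct R A D d y - curAct R A D d' x) w
      + (⁅curInr R A D ⁅d, d'⁆, w⁆ - ν ⁅d, d'⁆ • w)) +
    (idemAct R D ε y (idemAct R D ε x w + (⁅curInr R A D d, w⁆ - ν d • w))
      + (⁅curInr R A D d', idemAct R D ε x w + (⁅curInr R A D d, w⁆ - ν d • w)⁆
        - ν d' • (idemAct R D ε x w + (⁅curInr R A D d, w⁆ - ν d • w))))
  rw [lie_eq_zero_right, map_zero, map_zero, zero_lie, zero_smul, sub_zero, add_zero]
  simp only [sub_eq_add_neg, idemAct_add_right hV, idemAct_add_left hV, hneg, hneg', lie_add,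
    lie_neg, smul_add, smul_neg, idemAct_smul_right hV, lie_smul, inr_lie_idemAct hV]
  rw [idemAct_lie hV, hcomm, smul_comm (ν d) (ν d')]
  abel

end

section

variable (hV : IsLocallyAdic R D V I) (ε : AdicIdem I) (ν : Module.Dual ℂ D)

noncomputable instance : LieRingModule (Cur R A D) (SplitModule hV ε ν) where
  bracket := splitAct (V := V) R D ε ν
  add_lie := splitAct_add_left hV ε ν
  lie_add := splitAct_add_right hV ε ν
  leibniz_lie := splitAct_lie hV ε ν

noncomputable instance : LieModule ℂ (Cur R A D) (SplitModule hV ε ν) where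
  smul_lie := splitAct_smul_left hV ε ν
  lie_smul := splitAct_smul_right hV ε ν

theorem inl_lie_toSplit (x : A ⊗[ℂ] derived R) (w : V) :
    ⁅curInl R A D x, toSplit hV ε ν w⁆ = toSplit hV ε ν (idemAct R D ε x w) := by
  change idemAct R D ε x w + (⁅curInr R A D 0, w⁆ - ν 0 • w) = idemAct R D ε x w
  rw [map_zero, map_zero, zero_lie, zero_smul, sub_zero, add_zero]

theorem inr_lie_toSplit (d : D) (w : V) :
    ⁅curInr R A D d, toSplit hV ε ν w⁆ = toSplit hV ε ν (⁅curInr R A D d, w⁆ - ν d • w) := by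
  change idemAct R D ε 0 w + (⁅curInr R A D d, w⁆ - ν d • w) = _
  rw [idemAct_eq (w' := (0 : V)), zero_add]
  · rfl
  · filter_upwards with n
    rw [smul_zero, map_zero, zero_lie]

end

end Splitting

end KacMoody

/-! ### Tensor products of cyclic modules -/

section TensorProducts

/-- If one factor of a product in a monoid commutes with all the others, it can be moved to the
right. -/
theorem List.exists_prod_ofFn_update_eq_mul {M : Type*} [Monoid M] {k : ℕ} (h : Fin k → M)
    (i : Fin k) :
    ∃ Q : M, (∀ y, (∀ j, j ≠ i → Commute y (h j)) → Commute y Q) ∧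
      ∀ x, (∀ j, j ≠ i → Commute x (h j)) →
        (List.ofFn (Function.update h i x)).prod = Q * x := by
  induction k with
  | zero => exact i.elim0
  | succ k ih =>
    refine Fin.cases ?_ (fun i' => ?_) i
    · refine ⟨(List.ofFn fun j : Fin k => h j.succ).prod, fun y hy => ?_, fun x hx => ?_⟩
      · refine Commute.list_prod_right _ _ fun z hz => ?_
        obtain ⟨j, rfl⟩ := (List.mem_ofFn' _ _).mp hz
        exact hy _ (Fin.succ_ne_zero j)
      · rw [List.ofFn_succ, List.prod_cons, Function.update_self]
        have : (fun j : Fin k => Function.update h 0 x j.succ) = fun j => h j.succ := by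
          funext j
          rw [Function.update_of_ne (Fin.succ_ne_zero j)]
        rw [this]
        refine Commute.list_prod_right _ _ fun z hz => ?_
        obtain ⟨j, rfl⟩ := (List.mem_ofFn' _ _).mp hz
        exact hx _ (Fin.succ_ne_zero j)
    · obtain ⟨Q, hQ, hQ'⟩ := ih (fun j => h j.succ) i'
      have hne : ∀ {j : Fin k}, j ≠ i' → j.succ ≠ i'.succ := fun hj h => hj (Fin.succ_injective _ h)
      refine ⟨h 0 * Q, fun y hy => ?_, fun x hx => ?_⟩
      · exact (hy 0 (Fin.succ_ne_zero i').symm).mul_right (hQ y fun j hj => hy _ (hne hj))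
      · have : (fun j : Fin k => Function.update h i'.succ x j.succ) =
            Function.update (fun j => h j.succ) i' x := by
          funext j
          by_cases hj : j = i'
          · subst hj; simp
          · rw [Function.update_of_ne (hne hj), Function.update_of_ne hj]
        rw [List.ofFn_succ, List.prod_cons, Function.update_of_ne (Fin.succ_ne_zero i').symm, this,
          hQ' x fun j hj => hx _ (hne hj), mul_assoc]

/-- Cyclic modules `V_j = F v_j`, whose relations hold for commuting actions `T_j` of `F` on `W` and
a vector `v` of `W`, have a multilinear map to `W` that intertwines the actions. -/
theorem exists_multilinear_of_commute {K F W : Type*} [Field K] [Ring F] [Algebra K F]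
    [AddCommGroup W] [Module K W] {k : ℕ} {V : Fin k → Type*} [∀ j, AddCommGroup (V j)]
    [∀ j, Module K (V j)] (σ : ∀ j, F →ₐ[K] Module.End K (V j)) (vj : ∀ j, V j)
    (hsurj : ∀ j w, ∃ u, σ j u (vj j) = w) (T : Fin k → F →ₐ[K] Module.End K W)
    (hcomm : ∀ i j, i ≠ j → ∀ u u', Commute (T i u) (T j u'))
    (θ : ∀ j, V j →ₗ[K] W) (v : W) (hθ : ∀ j, θ j (vj j) = v)
    (hθσ : ∀ j u w, θ j (σ j u w) = T j u (θ j w)) :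
    ∃ Θ : MultilinearMap K V W, Θ vj = v ∧
      ∀ w i u, Θ (Function.update w i (σ i u (w i))) = T i u (Θ w) := by
  choose s hs using fun j => LinearMap.exists_rightInverse_of_surjective
    ((LinearMap.applyₗ (vj j)).comp (σ j).toLinearMap) (LinearMap.range_eq_top.mpr (hsurj j))
  have hs' : ∀ j w, σ j (s j w) (vj j) = w := fun j w => LinearMap.congr_fun (hs j) w
  have hTs : ∀ j w, T j (s j w) v = θ j w := by
    intro j w
    rw [← hθ j, ← hθσ, hs']
  -- `Θ(w₁, …, wₖ) = T₁(u₁) ⋯ Tₖ(uₖ) v`, where `w_j = u_j v_j`.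
  let g : ∀ j, V j →ₗ[K] Module.End K W := fun j => (T j).toLinearMap.comp (s j)
  let Θ : MultilinearMap K V W := (LinearMap.applyₗ v).compMultilinearMap
    ((MultilinearMap.mkPiAlgebraFin K k (Module.End K W)).compLinearMap g)
  have hΘ : ∀ w, Θ w = (List.ofFn fun j => T j (s j (w j))).prod v := fun w => rfl
  refine ⟨Θ, ?_, fun w i u => ?_⟩
  · rw [hΘ]
    have key : ∀ l : List (Module.End K W), (∀ S ∈ l, S v = v) → l.prod v = v := by
      intro l
      induction l with
      | nil => intro _; rfl
      | cons S l ih =>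
        intro h
        rw [List.prod_cons, Module.End.mul_apply,
          ih fun S hS => h S (List.mem_cons_of_mem _ hS), h S (by simp)]
    refine key _ fun S hS => ?_
    obtain ⟨j, rfl⟩ := (List.mem_ofFn' _ _).mp hS
    exact (hTs j _).trans (hθ j)
  · obtain ⟨Q, hQ, hQ'⟩ := List.exists_prod_ofFn_update_eq_mul (fun j => T j (s j (w j))) i
    have h1 : ∀ x, Θ (Function.update w i x) = Q (θ i x) := by
      intro x
      have : (fun j => T j (s j (Function.update w i x j))) =
          Function.update (fun j => T j (s j (w j))) i (T i (s i x)) := by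
        funext j
        by_cases hj : j = i
        · subst hj; simp
        · rw [Function.update_of_ne hj, Function.update_of_ne hj]
      rw [hΘ, this, hQ' _ fun j hj => hcomm i j hj.symm _ _, Module.End.mul_apply, hTs]
    have h2 : Θ w = Q (θ i (w i)) := by rw [← h1, Function.update_eq_self]
    have h3 : T i u * Q = Q * T i u := hQ _ fun j hj => hcomm i j hj.symm _ _
    rw [h1, h2, hθσ]
    exact (LinearMap.congr_fun h3 _).symm

namespace PiTensorLie

variable {κ : Type*} [Fintype κ] [DecidableEq κ] {K L : Type*} [Field K] [LieRing L]
  [LieAlgebra K L] {V : κ → Type*} [∀ i, AddCommGroup (V i)] [∀ i, Module K (V i)]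
  [∀ i, LieRingModule L (V i)] [∀ i, LieModule K L (V i)]

theorem actAt_commute (i j : κ) (x : L) : Commute (actAt (R := K) V i x) (actAt V j x) := by
  by_cases hij : i = j
  · subst hij; exact Commute.refl _
  · ext v
    simp only [LinearMap.compMultilinearMap_apply, Module.End.mul_apply]
    rw [actAt_tprod, actAt_tprod, actAt_tprod, actAt_tprod, Function.update_of_ne hij,
      Function.update_of_ne (Ne.symm hij), Function.update_comm (Ne.symm hij)]

theorem actAt_pow_tprod (i : κ) (x : L) (v : ∀ j, V j) (n : ℕ) :
    (actAt (R := K) V i x ^ n) (PiTensorProduct.tprod K v) =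
      PiTensorProduct.tprod K (Function.update v i ((LieModule.toEnd K L (V i) x ^ n) (v i))) := by
  induction n with
  | zero => simp
  | succ n ih =>
    rw [pow_succ', Module.End.mul_apply, ih, actAt_tprod, Function.update_self,
      Function.update_idem, pow_succ', Module.End.mul_apply, LieModule.toEnd_apply_apply]

/-- A Lie algebra element that acts locally nilpotently on all factors acts locally nilpotently on
the tensor product. -/
theorem exists_pow_toEnd_eq_zero (x : L)
    (h : ∀ j (w : V j), ∃ n : ℕ, (LieModule.toEnd K L (V j) x ^ n) w = 0) (t : ⨂[K] j, V j) :
    ∃ n : ℕ, (LieModule.toEnd K L (⨂[K] j, V j) x ^ n) t = 0 := by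
  have hE : LieModule.toEnd K L (⨂[K] j, V j) x = ∑ i, actAt V i x := rfl
  rw [hE]
  -- Local nilpotency is membership in the generalised eigenspace for `0`, which is compatible with
  -- sums of commuting operators.
  suffices ht : t ∈ Module.End.maxGenEigenspace (∑ i, actAt (R := K) V i x) 0 by
    simpa [Module.End.mem_maxGenEigenspace] using ht
  have key : ∀ (s : Finset κ) (v : ∀ j, V j), PiTensorProduct.tprod K v ∈
      Module.End.maxGenEigenspace (∑ i ∈ s, actAt (R := K) V i x) 0 := by
    intro s v
    induction s using Finset.induction_on with
    | empty => exact (Module.End.mem_maxGenEigenspace _ _ _).mpr ⟨1, by simp⟩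
    | insert i s hi ih =>
      have h1 : PiTensorProduct.tprod K v ∈
          Module.End.maxGenEigenspace (actAt (R := K) V i x) 0 := by
        obtain ⟨n, hn⟩ := h i (v i)
        refine (Module.End.mem_maxGenEigenspace _ _ _).mpr ⟨n, ?_⟩
        rw [zero_smul, sub_zero, actAt_pow_tprod, hn, MultilinearMap.map_update_zero]
      have h2 := Module.End.genEigenspace_inf_le_add (actAt (R := K) V i x)
        (∑ i ∈ s, actAt (R := K) V i x) 0 0 ⊤ ⊤
        (Commute.sum_right _ _ _ fun j _ => actAt_commute i j x) ⟨h1, ih⟩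
      rw [Finset.sum_insert hi]
      simpa using h2
  induction t using PiTensorProduct.induction_on with
  | smul_tprod c v => exact Submodule.smul_mem _ _ (key _ v)
  | add x y hx hy => exact add_mem hx hy

end PiTensorLie

end TensorProducts

/-! ### Idempotents from the Chinese remainder theorem -/

section ChineseRemainder

/-- The orthogonal idempotents of the completion of `A` at an intersection of pairwise coprime
ideals. -/
theorem KacMoody.exists_adicIdem {A : Type*} [CommRing A] {κ : Type*} [Fintype κ] {𝔪 : κ → Ideal A}
    (h𝔪 : ∀ i j, i ≠ j → IsCoprime (𝔪 i) (𝔪 j)) {I : Ideal A} (hI : I = ⨅ i, 𝔪 i) :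
    ∃ ε : κ → KacMoody.AdicIdem I,
      (∀ i n, (ε i).seq n - 1 ∈ 𝔪 i ^ n) ∧ (∀ i j n, i ≠ j → (ε i).seq n ∈ 𝔪 j ^ n) ∧
      (∀ i j n, i ≠ j → (ε i).seq n * (ε j).seq n ∈ I ^ n) ∧
      ∀ n, 1 - ∑ i, (ε i).seq n ∈ I ^ n := by
  classical
  have hmem : ∀ n a, (∀ i, a ∈ 𝔪 i ^ n) → a ∈ I ^ n := by
    intro n a ha
    have h1 : ∏ i, 𝔪 i ^ n = ⨅ i ∈ Finset.univ, 𝔪 i ^ n :=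
      Ideal.prod_eq_iInf_of_pairwise_isCoprime fun i _ j _ hij => (h𝔪 i j hij).pow
    have h2 : ∏ i, 𝔪 i = ⨅ i ∈ Finset.univ, 𝔪 i :=
      Ideal.prod_eq_iInf_of_pairwise_isCoprime fun i _ j _ hij => h𝔪 i j hij
    have h3 : I ^ n = ⨅ i, 𝔪 i ^ n := by
      rw [hI]
      simp only [Finset.mem_univ, iInf_pos] at h1 h2
      rw [← h1, ← h2, Finset.prod_pow]
    rw [h3]
    exact (Submodule.mem_iInf _).mpr ha
  choose b hb using fun (i : κ) (n : ℕ) => Ideal.exists_forall_sub_mem_ideal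
    (I := fun j => 𝔪 j ^ n) (fun j j' hj => (h𝔪 j j' hj).pow)
    (fun j => if i = j then (1 : A) else 0)
  have hb1 : ∀ i n, b i n - 1 ∈ 𝔪 i ^ n := fun i n => by simpa using hb i n i
  have hb0 : ∀ i j n, i ≠ j → b i n ∈ 𝔪 j ^ n := fun i j n hij => by simpa [hij] using hb i n j
  refine ⟨fun i => ⟨b i, fun n => hmem n _ fun j => ?_, fun n m hnm => hmem n _ fun j => ?_⟩,
    hb1, hb0, fun i j n hij => hmem n _ fun j' => ?_, fun n => hmem n _ fun j => ?_⟩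
  · by_cases hij : i = j
    · subst hij
      have : b i n * b i n - b i n = b i n * (b i n - 1) := by ring
      rw [this]
      exact Ideal.mul_mem_left _ _ (hb1 i n)
    · exact sub_mem (Ideal.mul_mem_left _ _ (hb0 i j n hij)) (hb0 i j n hij)
  · have h := Ideal.pow_le_pow_right hnm (hb i m j)
    have : b i m - b i n = (b i m - if i = j then (1 : A) else 0)
      - (b i n - if i = j then (1 : A) else 0) := by ring
    rw [this]
    exact sub_mem h (hb i n j)
  · by_cases hi : i = j'
    · subst hi
      exact Ideal.mul_mem_left _ _ (hb0 j i n hij.symm)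
    · exact Ideal.mul_mem_right _ _ (hb0 i j' n hi)
  · have : 1 - ∑ i, b i n = -∑ i, (b i n - if i = j then (1 : A) else 0) := by
      rw [Finset.sum_sub_distrib, Finset.sum_ite_eq' Finset.univ j, if_pos (Finset.mem_univ j)]
      ring
    rw [this]
    exact neg_mem (sum_mem fun i _ => hb i n j)

end ChineseRemainder

/-! ### Highest weight vectors of tensor products and of modules with a modified action -/

namespace KacMoody

section TensorHighestWeight

variable {ι : Type*} [Fintype ι] {C : Matrix ι ι ℤ} {H : Type*} [AddCommGroup H] [Module ℂ H]
  {R : Realization C H} {A : Type*} [CommRing A] [Algebra ℂ A] {D : LieSubalgebra ℂ (cartan R)}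

section Sums

variable {κ : Type*} [Fintype κ] {ψ : κ → Module.Dual ℂ (CurCartan R A D)}
  {lam : κ → Module.Dual ℂ (cartan R)} {𝔪 : κ → Ideal A} {I : Ideal A}

theorem restrictsTo_sum (hres : ∀ j, RestrictsTo R (ψ j) (lam j)) :
    RestrictsTo R (∑ j, ψ j) (∑ j, lam j) := by
  refine ⟨fun x => ?_, fun x => ?_⟩ <;> rw [LinearMap.sum_apply, LinearMap.sum_apply]
  · exact Finset.sum_congr rfl fun j _ => (hres j).1 x
  · exact Finset.sum_congr rfl fun j _ => (hres j).2 x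

theorem isDominantIntegral_sum (hdom : ∀ j, IsDominantIntegral R (lam j)) :
    IsDominantIntegral R (∑ j, lam j) := fun i => by
  choose n hn using fun j => hdom j i
  exact ⟨∑ j, n j, by
    rw [LinearMap.sum_apply, Nat.cast_sum]
    exact Finset.sum_congr rfl fun j _ => hn j⟩

theorem vanishesOn_sum (hvan : ∀ j, VanishesOn R (ψ j) (𝔪 j)) (hI : ∀ j, I ≤ 𝔪 j) :
    VanishesOn R (∑ j, ψ j) I := fun a ha x => by
  rw [LinearMap.sum_apply]
  exact Finset.sum_eq_zero fun j _ => hvan j a (hI j ha) x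

variable (hres : ∀ j, RestrictsTo R (ψ j) (lam j)) (hdom : ∀ j, IsDominantIntegral R (lam j))
include hres hdom

theorem wt_sum (i : ι) : wt R (∑ j, ψ j) i = ∑ j, wt R (ψ j) i := by
  rw [← Nat.cast_inj (R := ℂ), ← wt_eq (restrictsTo_sum hres) (isDominantIntegral_sum hdom),
    LinearMap.sum_apply, Nat.cast_sum]
  exact Finset.sum_congr rfl fun j _ => wt_eq (hres j) (hdom j) i

theorem expo_le_expo_sum (j : κ) (m : ι → ℕ) : expo R (ψ j) m ≤ expo R (∑ j, ψ j) m := by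
  refine Finset.sum_le_sum fun i _ => Nat.mul_le_mul_left _ ?_
  rw [wt_sum hres hdom]
  exact Finset.single_le_sum (f := fun j => wt R (ψ j) i) (fun _ _ => Nat.zero_le _)
    (Finset.mem_univ j)

/-- The tensor product of highest weight vectors of `M(ψ_j, 𝔪_j)` satisfies the relations of
`M(∑ ψ_j, I)` for `I ≤ ⋂ 𝔪_j`, since the exponent `N_{λ, β}` is additive in `λ`. -/
theorem isHWVector_tprod [DecidableEq κ] {V : κ → Type*} [∀ j, AddCommGroup (V j)]
    [∀ j, Module ℂ (V j)] [∀ j, LieRingModule (Cur R A D) (V j)]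
    [∀ j, LieModule ℂ (Cur R A D) (V j)] {v : ∀ j, V j}
    (hv : ∀ j, IsHWVector (ψ j) (𝔪 j) (v j)) (hI : ∀ j, I ≤ 𝔪 j) :
    IsHWVector (∑ j, ψ j) I (PiTensorProduct.tprod ℂ v) where
  raise m x a hm hx := by
    rw [PiTensorLie.lie_tprod]
    refine Finset.sum_eq_zero fun j _ => ?_
    rw [(hv j).raise m x a hm hx, MultilinearMap.map_update_zero]
  weight h := by
    rw [PiTensorLie.lie_tprod, LinearMap.sum_apply, Finset.sum_smul]
    refine Finset.sum_congr rfl fun j _ => ?_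
    rw [(hv j).weight, MultilinearMap.map_update_smul, Function.update_eq_self]
  lower m x a hm hx ha := by
    rw [PiTensorLie.lie_tprod]
    refine Finset.sum_eq_zero fun j _ => ?_
    rw [(hv j).lower m x a hm hx (Ideal.pow_right_mono (hI j) _
      (Ideal.pow_le_pow_right (expo_le_expo_sum hres hdom j m) ha)), MultilinearMap.map_update_zero]

end Sums

variable {V : Type*} [AddCommGroup V] [Module ℂ V] [LieRingModule (Cur R A D) V]
  [LieModule ℂ (Cur R A D) V] {I : Ideal A} (hV : IsLocallyAdic R D V I) (ε : AdicIdem I)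
  (ν : Module.Dual ℂ D)

theorem elt_lie_toSplit (a : A) (x : derived R) (w : V) :
    ⁅elt R D a x, toSplit hV ε ν w⁆ = toSplit hV ε ν (idemAct R D ε (a ⊗ₜ x) w) :=
  inl_lie_toSplit hV ε ν _ w

open scoped Classical in
/-- The modified action has the same weights up to a shift, so it inherits local nilpotency from
the boundedness of strings of weights. -/
theorem split_f_nilpotent (hD : IsCompl (cartan' R).toSubmodule D.toSubmodule)
    {χ : Module.Dual ℂ H}
    (htop : ⨆ m : ι → ℕ, gr A hD V χ (fun i => (m i : ℤ)) = ⊤) (i : ι)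
    (hstring : ∀ m : ι → ℤ, ∃ n₀ : ℕ, ∀ n : ℕ, n₀ ≤ n → ∀ w ∈ gr A hD V χ
      (m + Pi.single i (n : ℤ)), w = 0) (w : V) :
    ∃ n : ℕ, ((LieModule.toEnd ℂ (Cur R A D) (SplitModule hV ε ν) (elt R D 1 (f' R i))) ^ n)
      (toSplit hV ε ν w) = 0 := by
  have hw : w ∈ ⨆ m : ι → ℕ, gr A hD V χ (fun i => (m i : ℤ)) := htop ▸ Submodule.mem_top
  induction hw using Submodule.iSup_induction' with
  | mem m w hw =>
    have key : ∀ n : ℕ, ∃ w' ∈ gr A hD V χ ((fun i => (m i : ℤ)) + Pi.single i (n : ℤ)),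
        ((LieModule.toEnd ℂ (Cur R A D) (SplitModule hV ε ν) (elt R D 1 (f' R i))) ^ n)
          (toSplit hV ε ν w) = toSplit hV ε ν w' := by
      intro n
      induction n with
      | zero => exact ⟨w, by simpa using hw, rfl⟩
      | succ n ih =>
        obtain ⟨w', hw', h⟩ := ih
        obtain ⟨N, hN⟩ := hV.exists_idemAct_eq ε 1 (f' R i) w'
        refine ⟨_, ?_, by rw [pow_succ', Module.End.mul_apply, h, LieModule.toEnd_apply_apply,
          elt_lie_toSplit, hN]⟩
        convert elt_f_lie_mem_gr hD hw' i _ using 2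
        rw [add_assoc, ← Pi.single_add]
        push_cast
        rfl
    obtain ⟨n, hn⟩ := hstring fun i => (m i : ℤ)
    obtain ⟨w', hw', h⟩ := key n
    exact ⟨n, by rw [h, hn n le_rfl w' hw', map_zero]⟩
  | zero => exact ⟨0, by simp⟩
  | add x y _ _ hx hy =>
    obtain ⟨n, hn⟩ := hx
    obtain ⟨n', hn'⟩ := hy
    refine ⟨n + n', ?_⟩
    rw [map_add, map_add, pow_add, Module.End.mul_apply, Module.End.mul_apply, hn', map_zero,
      add_zero, ← Module.End.mul_apply, ← pow_add, add_comm, pow_add, Module.End.mul_apply, hn,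
      map_zero]

/-- If the idempotent `ε` cuts `ψ₁` out of `ψ` on `𝔥' ⊗ A`, then a highest weight vector of weight
`ψ` is one of weight `ψ₁` for the action modified by `ε`. -/
theorem toSplit_isHWVector {ψ ψ₁ : Module.Dual ℂ (CurCartan R A D)} {v : V} {𝔫 : Ideal A}
    (hv : IsHWVector ψ I v) {lam₁ : Module.Dual ℂ (cartan R)} (hres : RestrictsTo R ψ₁ lam₁)
    (hdom : IsDominantIntegral R lam₁) (hvan : VanishesOn R ψ₁ 𝔫)
    (hε : ∀ a x, ∀ᶠ n in Filter.atTop, ψ ((ε.seq n * a) ⊗ₜ x, 0) = ψ₁ (a ⊗ₜ x, 0))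
    (hν : ∀ d, ν d = ψ (0, d) - ψ₁ (0, d))
    (hf : ∀ i, ∃ n : ℕ, ((LieModule.toEnd ℂ (Cur R A D) (SplitModule hV ε ν)
      (elt R D 1 (f' R i))) ^ n) (toSplit hV ε ν v) = 0) :
    IsHWVector ψ₁ 𝔫 (toSplit hV ε ν v) := by
  refine isHWVector_of_nilpotent hres hdom hvan (fun m x a hm hx => ?_) (fun h => ?_) hf
  · obtain ⟨n, hn⟩ := hV.exists_idemAct_eq ε a x v
    rw [elt_lie_toSplit, hn, hv.raise m x _ hm hx, map_zero]
  · obtain ⟨h, d⟩ := h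
    have h2 : ⁅curCartanIncl R A D (0, d), toSplit hV ε ν v⁆ = ψ₁ (0, d) • toSplit hV ε ν v := by
      rw [curCartanIncl_right, inr_lie_toSplit, ← curCartanIncl_right, hv.weight, hν, ← sub_smul,
        sub_sub_cancel, map_smul]
    have h1 : ⁅curCartanIncl R A D (h, 0), toSplit hV ε ν v⁆ = ψ₁ (h, 0) • toSplit hV ε ν v := by
      induction h using TensorProduct.induction_on with
      | zero =>
        have : ((0, 0) : CurCartan R A D) = 0 := rfl
        rw [this, map_zero, map_zero, zero_lie, zero_smul]
      | tmul a x =>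
        rw [curCartanIncl_tmul, elt_lie_toSplit, idemAct_eq (w' := ψ₁ (a ⊗ₜ x, 0) • v), map_smul]
        filter_upwards [hε a x] with n hn
        rw [TensorProduct.smul_tmul', smul_eq_mul, ← elt_eq, ← curCartanIncl_tmul, hv.weight, hn]
      | add x y hx hy =>
        have : ((x + y, 0) : CurCartan R A D) = (x, 0) + (y, 0) := by simp
        rw [this, map_add, map_add, add_lie, hx, hy, add_smul]
    have : ((h, d) : CurCartan R A D) = (h, 0) + (0, d) := by simp
    rw [this, map_add, map_add, add_lie, h1, h2, add_smul]

end TensorHighestWeight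

end KacMoody

/-! ### Maps from and onto tensor products of highest weight modules -/

namespace KacMoody

section Decomposition

open Filter

variable {ι : Type*} [Fintype ι] {C : Matrix ι ι ℤ} {H : Type*} [AddCommGroup H] [Module ℂ H]
  {R : Realization C H} {A : Type*} [CommRing A] [Algebra ℂ A] {D : LieSubalgebra ℂ (cartan R)}

section LoweringAlgebra

variable {V : Type*} [AddCommGroup V] [Module ℂ V] [LieRingModule (Cur R A D) V]
  [LieModule ℂ (Cur R A D) V] {I : Ideal A}

variable (R A D V) in
/-- The action on `V` of the free algebra on the symbols `f_i ⊗ a`. -/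
noncomputable def lowerAct : FreeAlgebra ℂ (ι × A) →ₐ[ℂ] Module.End ℂ V :=
  FreeAlgebra.lift ℂ fun p => LieModule.toEnd ℂ (Cur R A D) V (elt R D p.2 (f' R p.1))

theorem lowerAct_ι (i : ι) (a : A) (w : V) :
    lowerAct R A D V (FreeAlgebra.ι ℂ (i, a)) w = ⁅elt R D a (f' R i), w⁆ := by
  rw [lowerAct, FreeAlgebra.lift_ι_apply, LieModule.toEnd_apply_apply]

theorem IsHWVector.exists_lowerAct_eq {ψ : Module.Dual ℂ (CurCartan R A D)} {v : V}
    (hv : IsHWVector ψ I v) (hspan : LieSubmodule.lieSpan ℂ (Cur R A D) {v} = ⊤) (w : V) :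
    ∃ u, lowerAct R A D V u v = w := by
  have h := highestWeight_induction hspan hv.lie_e hv.weight
    (LinearMap.range ((LinearMap.applyₗ v).comp (lowerAct R A D V).toLinearMap))
    ⟨1, by simp⟩ (by
      rintro i a _ ⟨u, rfl⟩
      refine ⟨FreeAlgebra.ι ℂ (i, a) * u, ?_⟩
      change lowerAct R A D V (FreeAlgebra.ι ℂ (i, a) * u) v = _
      rw [map_mul, Module.End.mul_apply, lowerAct_ι]
      rfl)
  exact LinearMap.range_eq_top.mp h w

variable (hV : IsLocallyAdic R D V I) (ε : AdicIdem I)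

/-- The operator `X ⊗ a ε` as a linear map. -/
noncomputable def idemEnd (x : A ⊗[ℂ] derived R) : Module.End ℂ V where
  toFun := idemAct R D ε x
  map_add' := idemAct_add_right hV ε x
  map_smul' c := idemAct_smul_right hV ε c x

/-- The action on `V` of the free algebra on the symbols `f_i ⊗ a`, modified by an idempotent. -/
noncomputable def idemLowerAct : FreeAlgebra ℂ (ι × A) →ₐ[ℂ] Module.End ℂ V :=
  FreeAlgebra.lift ℂ fun p => idemEnd hV ε (p.2 ⊗ₜ f' R p.1)

theorem idemLowerAct_ι (i : ι) (a : A) (w : V) :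
    idemLowerAct hV ε (FreeAlgebra.ι ℂ (i, a)) w = idemAct R D ε (a ⊗ₜ f' R i) w := by
  rw [idemLowerAct, FreeAlgebra.lift_ι_apply]
  rfl

theorem idemLowerAct_commute {ε ε' : AdicIdem I} (hε : ∀ n, ε.seq n * ε'.seq n ∈ I ^ n)
    (u u' : FreeAlgebra ℂ (ι × A)) : Commute (idemLowerAct hV ε u) (idemLowerAct hV ε' u') := by
  induction u using FreeAlgebra.induction with
  | grade0 c => rw [AlgHom.commutes]; exact Algebra.commutes c _
  | grade1 p =>
    induction u' using FreeAlgebra.induction with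
    | grade0 c => rw [AlgHom.commutes]; exact (Algebra.commutes c _).symm
    | grade1 q =>
      refine LinearMap.ext fun w => ?_
      rw [Module.End.mul_apply, Module.End.mul_apply, idemLowerAct_ι, idemLowerAct_ι,
        idemLowerAct_ι, idemLowerAct_ι]
      exact idemAct_comm hV hε _ _ w
    | mul u u' h h' => rw [map_mul]; exact h.mul_right h'
    | add u u' h h' => rw [map_add]; exact h.add_right h'
  | mul u u' h h' => rw [map_mul]; exact h.mul_left h'
  | add u u' h h' => rw [map_add]; exact h.add_left h'

theorem map_lowerAct {W : Type*} [AddCommGroup W] [Module ℂ W] [LieRingModule (Cur R A D) W]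
    [LieModule ℂ (Cur R A D) W] (θ : W →ₗ[ℂ] V)
    (hθ : ∀ i a w, θ ⁅elt R D a (f' R i), w⁆ = idemAct R D ε (a ⊗ₜ f' R i) (θ w))
    (u : FreeAlgebra ℂ (ι × A)) (w : W) :
    θ (lowerAct R A D W u w) = idemLowerAct hV ε u (θ w) := by
  induction u using FreeAlgebra.induction generalizing w with
  | grade0 c => rw [AlgHom.commutes, AlgHom.commutes]; exact map_smul θ c w
  | grade1 p =>
    obtain ⟨i, a⟩ := p
    rw [lowerAct_ι, idemLowerAct_ι, hθ]
  | mul u u' h h' =>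
    rw [map_mul, map_mul, Module.End.mul_apply, Module.End.mul_apply, h, h']
  | add u u' h h' =>
    rw [map_add, map_add, LinearMap.add_apply, LinearMap.add_apply, map_add, h, h']

end LoweringAlgebra

variable {k : ℕ} {V : Fin k → Type*} [∀ j, AddCommGroup (V j)] [∀ j, Module ℂ (V j)]
  [∀ j, LieRingModule (Cur R A D) (V j)] [∀ j, LieModule ℂ (Cur R A D) (V j)]
  {W : Type*} [AddCommGroup W] [Module ℂ W] [LieRingModule (Cur R A D) W]
  {I : Ideal A} {𝔪 : Fin k → Ideal A} {ε : Fin k → AdicIdem I}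
  {ψ : Fin k → Module.Dual ℂ (CurCartan R A D)} {v : ∀ j, V j}

/-- Homomorphisms from highest weight modules `V_j` to `W` with its actions modified by orthogonal
idempotents, with the same value `v₀` at the highest weight vectors, combine to a map on the tensor
product, since the modified actions commute. -/
theorem exists_tensor_lift [LieModule ℂ (Cur R A D) W] (hW : IsLocallyAdic R D W I)
    (hε : ∀ i j n, i ≠ j → (ε i).seq n * (ε j).seq n ∈ I ^ n)
    (hε1 : ∀ n, 1 - ∑ i, (ε i).seq n ∈ I ^ n)
    (hv : ∀ j, IsHWVector (ψ j) (𝔪 j) (v j))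
    (hspan : ∀ j, LieSubmodule.lieSpan ℂ (Cur R A D) {v j} = ⊤)
    (θ : ∀ j, V j →ₗ[ℂ] W) {v₀ : W} (hθv : ∀ j, θ j (v j) = v₀)
    (hθ : ∀ j i a w, θ j ⁅elt R D a (f' R i), w⁆ = idemAct R D (ε j) (a ⊗ₜ f' R i) (θ j w)) :
    ∃ Θ : (⨂[ℂ] j, V j) →ₗ[ℂ] W, Θ (PiTensorProduct.tprod ℂ v) = v₀ ∧
      ∀ i (a : A) t, Θ ⁅elt R D a (f' R i), t⁆ = ⁅elt R D a (f' R i), Θ t⁆ := by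
  obtain ⟨Θ, hΘ, hΘσ⟩ := exists_multilinear_of_commute (K := ℂ) (V := V) (W := W)
    (F := FreeAlgebra ℂ (ι × A)) (fun j => lowerAct R A D (V j)) v
    (fun j => (hv j).exists_lowerAct_eq (hspan j)) (fun j => idemLowerAct hW (ε j))
    (fun i j hij => idemLowerAct_commute hW fun n => hε i j n hij) θ v₀ hθv
    (fun j => map_lowerAct hW (ε j) (θ j) (hθ j))
  refine ⟨PiTensorProduct.lift Θ, by rw [PiTensorProduct.lift.tprod, hΘ], fun i a t => ?_⟩
  induction t using PiTensorProduct.induction_on with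
  | smul_tprod c w =>
    rw [lie_smul, map_smul, map_smul, lie_smul, PiTensorLie.lie_tprod, map_sum,
      PiTensorProduct.lift.tprod, elt_eq, ← sum_idemAct hW ε hε1]
    congr 1
    refine Finset.sum_congr rfl fun j _ => ?_
    have h := hΘσ w j (FreeAlgebra.ι ℂ (i, a))
    rw [lowerAct_ι, idemLowerAct_ι] at h
    rw [PiTensorProduct.lift.tprod, ← elt_eq, h]
  | add x y hx hy => rw [lie_add, map_add, map_add, lie_add, hx, hy]

/-- An element `f_i ⊗ a ε_j` with `ε_j` close to the idempotent of `𝔪_j` acts on the `j`-th factor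
only. Hence the tensor product of highest weight modules is generated by the product of the highest
weight vectors. -/
theorem surjective_of_map_eq_tprod (φ : W →ₗ⁅ℂ, Cur R A D⁆ ⨂[ℂ] j, V j) {v₀ : W}
    (hφ : φ v₀ = PiTensorProduct.tprod ℂ v)
    (hε1 : ∀ i n, (ε i).seq n - 1 ∈ 𝔪 i ^ n)
    (hε : ∀ i j n, i ≠ j → (ε i).seq n ∈ 𝔪 j ^ n)
    (hV : ∀ j, IsLocallyAdic R D (V j) (𝔪 j))
    (hv : ∀ j, IsHWVector (ψ j) (𝔪 j) (v j))
    (hspan : ∀ j, LieSubmodule.lieSpan ℂ (Cur R A D) {v j} = ⊤) : Function.Surjective φ := by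
  -- The coordinates are released from `v_j` one at a time.
  have key : ∀ (s : Finset (Fin k)) (w : ∀ j, V j), (∀ j ∉ s, w j = v j) →
      PiTensorProduct.tprod ℂ w ∈ φ.range := by
    intro s
    induction s using Finset.induction_on with
    | empty =>
      intro w hw
      rw [funext fun j => hw j (Finset.notMem_empty j), ← hφ]
      exact LieModuleHom.mem_range _ _ |>.mpr ⟨v₀, rfl⟩
    | insert i s hi ih =>
      intro w hw
      have h := highestWeight_induction (hspan i) (hv i).lie_e (hv i).weight
        ((φ.range : Submodule ℂ (⨂[ℂ] j, V j)).comap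
          ((PiTensorProduct.tprod ℂ).toLinearMap w i)) ?_ ?_
      · have h' : w i ∈ (φ.range : Submodule ℂ (⨂[ℂ] j, V j)).comap
          ((PiTensorProduct.tprod ℂ).toLinearMap w i) := h ▸ Submodule.mem_top
        rw [Submodule.mem_comap, MultilinearMap.toLinearMap_apply, Function.update_eq_self] at h'
        exact h'
      · refine ih _ fun j hj => ?_
        by_cases hji : j = i
        · subst hji; rw [Function.update_self]
        · rw [Function.update_of_ne hji]
          exact hw j (by simp [hji, hj])
      · intro i' a x hx
        rw [Submodule.mem_comap, MultilinearMap.toLinearMap_apply] at hx ⊢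
        obtain ⟨n, hn⟩ := (eventually_all.mpr fun j => (hV j).eventually (a ⊗ₜ f' R i')
          (Function.update w i x j)).exists
        have hzero : ∀ j b, b ∈ 𝔪 j ^ n →
            ⁅elt R D (b * a) (f' R i'), Function.update w i x j⁆ = 0 := fun j b hb => hn j b hb
        have hmem : ⁅elt R D ((ε i).seq n * a) (f' R i'),
            PiTensorProduct.tprod ℂ (Function.update w i x)⁆ ∈ φ.range := φ.range.lie_mem hx
        rw [PiTensorLie.lie_tprod, Finset.sum_eq_single i] at hmem
        · have h1 := hzero i _ (hε1 i n)
          rw [sub_mul, one_mul, sub_eq_add_neg, elt_add_left, add_lie, ← neg_one_smul ℂ a,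
            elt_smul_left, smul_lie, neg_one_smul, ← sub_eq_add_neg, sub_eq_zero] at h1
          rw [h1, Function.update_self, Function.update_idem] at hmem
          exact hmem
        · intro j _ hj
          rw [hzero j _ (hε i j n (Ne.symm hj)), MultilinearMap.map_update_zero]
        · simp
  intro t
  rw [← LieModuleHom.mem_range]
  induction t using PiTensorProduct.induction_on with
  | smul_tprod c w => exact φ.range.smul_mem c (key Finset.univ w (by simp))
  | add x y hx hy => exact φ.range.add_mem hx hy

end Decomposition

end KacMoody

/-! ### Decomposition of the Weyl module -/

namespace KacMoody

section WeylModules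

open Filter

variable {ι : Type*} [Fintype ι] {C : Matrix ι ι ℤ} {H : Type*} [AddCommGroup H] [Module ℂ H]
  {R : Realization C H} {A : Type*} [CommRing A] [Algebra ℂ A] {D : LieSubalgebra ℂ (cartan R)}
  {κ : Type*} [Fintype κ] {I : Ideal A} {𝔪 : κ → Ideal A} {ε : κ → AdicIdem I}
  {ψ : κ → Module.Dual ℂ (CurCartan R A D)} {lam : κ → Module.Dual ℂ (cartan R)}

/-- The approximations of the `j`-th idempotent cut `ψ_j` out of `∑ ψ_j` on `𝔥' ⊗ A`. -/
theorem eventually_sum_apply (hvan : ∀ j, VanishesOn R (ψ j) (𝔪 j))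
    (hε1 : ∀ i n, (ε i).seq n - 1 ∈ 𝔪 i ^ n) (hε : ∀ i j n, i ≠ j → (ε i).seq n ∈ 𝔪 j ^ n)
    (j : κ) (a : A) (x : cartan' R) :
    ∀ᶠ n in atTop, (∑ j, ψ j) (((ε j).seq n * a) ⊗ₜ x, 0) = ψ j (a ⊗ₜ x, 0) := by
  filter_upwards [eventually_ge_atTop 1] with n hn
  have hle : ∀ i, 𝔪 i ^ n ≤ 𝔪 i := fun i => Ideal.pow_le_self (by omega)
  rw [LinearMap.sum_apply, Finset.sum_eq_single j]
  · have h := hvan j _ (Ideal.mul_mem_right a _ (hle j (hε1 j n))) x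
    have h' : ((((ε j).seq n - 1) * a) ⊗ₜ[ℂ] x, (0 : D)) =
        (((ε j).seq n * a) ⊗ₜ[ℂ] x, 0) - (a ⊗ₜ[ℂ] x, 0) := by
      rw [sub_mul, one_mul, TensorProduct.sub_tmul, Prod.mk_sub_mk, sub_zero]
    rwa [h', map_sub, sub_eq_zero] at h
  · intro i _ hi
    exact hvan i _ (Ideal.mul_mem_right a _ (hle i (hε j i n (Ne.symm hi)))) x
  · simp

/-- The map `W(ψ_j, 𝔪_j) → W(∑ ψ_j, I)` that takes highest weight vectors to each other and
intertwines `f_i ⊗ a` with `f_i ⊗ a ε_j`. It comes from the universal property of `W(ψ_j, 𝔪_j)`,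
applied to `W(∑ ψ_j, I)` with the action modified by `ε_j`. -/
theorem exists_weyl_factor_map (hD : IsCompl (cartan' R).toSubmodule D.toSubmodule)
    (hvan : ∀ j, VanishesOn R (ψ j) (𝔪 j)) (hres : ∀ j, RestrictsTo R (ψ j) (lam j))
    (hdom : ∀ j, IsDominantIntegral R (lam j))
    (hε1 : ∀ i n, (ε i).seq n - 1 ∈ 𝔪 i ^ n) (hε : ∀ i j n, i ≠ j → (ε i).seq n ∈ 𝔪 j ^ n)
    (hW : IsLocallyAdic R D (Weyl R (∑ j, ψ j) I) I) (j : κ) :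
    ∃ θ : Weyl R (ψ j) (𝔪 j) →ₗ[ℂ] Weyl R (∑ j, ψ j) I,
      θ (weylVec (ψ j) (𝔪 j)) = weylVec (∑ j, ψ j) I ∧
      ∀ i (a : A) w, θ ⁅elt R D a (f' R i), w⁆ = idemAct R D (ε j) (a ⊗ₜ f' R i) (θ w) := by
  let ν : Module.Dual ℂ D := (∑ j, ψ j - ψ j).comp (LinearMap.inr ℂ (A ⊗[ℂ] cartan' R) D)
  have hnil := fun i => split_f_nilpotent hW (ε j) ν hD
    (weyl_iSup_gr_eq_top hD (restrictsTo_sum hres)) i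
    (weyl_gr_string_eq_bot hD (restrictsTo_sum hres) (isDominantIntegral_sum hdom) i)
  obtain ⟨g, hg⟩ := exists_weyl_hom hD (hres j) (toSplit_isHWVector hW (ε j) ν
    weylVec_isHWVector (hres j) (hdom j) (hvan j) (eventually_sum_apply hvan hε1 hε j)
    (fun d => rfl) fun i => hnil i _) hnil
  refine ⟨(toSplit hW (ε j) ν).symm.toLinearMap.comp (g : _ →ₗ[ℂ] _), ?_, fun i a w => ?_⟩
  · change (toSplit hW (ε j) ν).symm (g _) = _
    rw [hg, LinearEquiv.symm_apply_apply]
  · change (toSplit hW (ε j) ν).symm (g _) = idemAct R D (ε j) _ ((toSplit hW (ε j) ν).symm (g w))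
    rw [LieModuleHom.map_lie, LinearEquiv.symm_apply_eq, ← elt_lie_toSplit,
      LinearEquiv.apply_symm_apply]

end WeylModules

end KacMoody

theorem mainTheorem2 {ι : Type*} [Fintype ι] {C : Matrix ι ι ℤ} {H : Type*} [AddCommGroup H]
    [Module ℂ H] (R : KacMoody.Realization C H)
    (A : Type*) [CommRing A] [Algebra ℂ A] [Algebra.FiniteType ℂ A]
    (D : LieSubalgebra ℂ (KacMoody.cartan R))
    (hD : IsCompl (KacMoody.cartan' R).toSubmodule D.toSubmodule)
    (k : ℕ) (𝔪 : Fin k → Ideal A) (h𝔪 : ∀ i, (𝔪 i).IsMaximal) (hinj : Function.Injective 𝔪)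
    (I : Ideal A) (hI : I = ⨅ i, 𝔪 i)
    (ψ : Fin k → Module.Dual ℂ (KacMoody.CurCartan R A D))
    (lam : Fin k → Module.Dual ℂ (KacMoody.cartan R))
    (hvan : ∀ i, KacMoody.VanishesOn R (ψ i) (𝔪 i))
    (hres : ∀ i, KacMoody.RestrictsTo R (ψ i) (lam i))
    (hdom : ∀ i, KacMoody.IsDominantIntegral R (lam i)) :
    Nonempty (KacMoody.Weyl R (∑ i, ψ i) I
      ≃ₗ⁅ℂ, KacMoody.Cur R A D⁆ ⨂[ℂ] i, KacMoody.Weyl R (ψ i) (𝔪 i)) := by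
  open KacMoody in
  obtain ⟨ε, hε1, hε0, hεε, hεs⟩ := exists_adicIdem (𝔪 := 𝔪) (I := I)
    (fun i j hij => Ideal.isCoprime_of_isMaximal (hinj.ne hij)) hI
  have hle : ∀ j, I ≤ 𝔪 j := fun j => hI ▸ iInf_le _ j
  have hv : ∀ j, IsHWVector (ψ j) (𝔪 j) (weylVec (ψ j) (𝔪 j)) := fun j => weylVec_isHWVector
  have hspan : ∀ j, LieSubmodule.lieSpan ℂ (Cur R A D) {weylVec (ψ j) (𝔪 j)} = ⊤ :=
    fun j => weylVec_lieSpan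
  have hv₀ : IsHWVector (∑ j, ψ j) I (weylVec (∑ j, ψ j) I) := weylVec_isHWVector
  have hspan₀ : LieSubmodule.lieSpan ℂ (Cur R A D) {weylVec (∑ j, ψ j) I} = ⊤ := weylVec_lieSpan
  have hW := hv₀.isLocallyAdic hspan₀ (vanishesOn_sum hvan hle)
  obtain ⟨φ, hφ⟩ := exists_weyl_hom hD (restrictsTo_sum hres)
    (isHWVector_tprod hres hdom hv hle)
    fun i => PiTensorLie.exists_pow_toEnd_eq_zero _ fun j =>
      weyl_f_nilpotent hD (hres j) (hdom j) i
  choose θ hθv hθ using exists_weyl_factor_map hD hvan hres hdom hε1 hε0 hW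
  obtain ⟨Θ, hΘ, hΘf⟩ := exists_tensor_lift hW hεε hεs hv hspan θ hθv hθ
  -- `Θ ∘ φ` fixes the highest weight vector and commutes with the lowering operators
  have hleft : ∀ w, Θ (φ w) = w := by
    have h := highestWeight_induction hspan₀ hv₀.lie_e hv₀.weight
      (LinearMap.eqLocus (Θ.comp (φ : _ →ₗ[ℂ] _)) LinearMap.id)
      (by
        change Θ (φ _) = _
        rw [hφ, hΘ]
        rfl)
      (fun i a w hw => by
        change Θ (φ w) = w at hw
        change Θ (φ _) = _
        rw [LieModuleHom.map_lie, hΘf, hw]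
        rfl)
    intro w
    exact (h ▸ Submodule.mem_top : w ∈ LinearMap.eqLocus (Θ.comp (φ : _ →ₗ[ℂ] _)) LinearMap.id)
  have hsurj : Function.Surjective φ := surjective_of_map_eq_tprod φ hφ hε1 hε0
    (fun j => (hv j).isLocallyAdic (hspan j) (hvan j)) hv hspan
  exact ⟨{ φ with
    invFun := Θ
    left_inv := hleft
    right_inv := fun t => by
      obtain ⟨w, rfl⟩ := hsurj t
      exact congrArg φ (hleft w) }⟩
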